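/- **Setting.** Points lie in complex projective spaces $\mathbb P^3,\mathbb P^2$. A camera is a real $3\times4$ matrix of rank 3, defined up to scale and viewed as a projection $\mathbb P^3\dashrightarrow\mathbb P^2$; its centre is its kernel. All pairs of cameras $(P_1,P_2)$ are assumed to have distinct centres $p_1\ne p_2$. The fundamental matrix $F_P$ is the real $3\times 3$ matrix, considered up to scale, with $\mathbf x^TF_P\mathbf y=\det\begin{bmatrix}P_1&\mathbf x&0\\P_2&0&\mathbf y\end{bmatrix}$. We say that $(u,v)\in\mathbb P^2\times\mathbb P^2$ is an image of $x\in\mathbb P^3$ under $(P_1,P_2)$ if $(x,(u,v))$ lies in the closure of the graph of $x\mapsto(P_1x,P_2x)$, i.e. if $P_1x$ is proportional to $u$ or zero and $P_2x$ is proportional to $v$ or zero. A configuration $(P_1,P_2,X)$ with $X\subseteq\mathbb P^3$ is a reconstruction of $\Sigma\subseteq\mathbb P^2\times\mathbb P^2$ if every $x\in X$ has an image in $\Sigma$ and every element of $\Sigma$ is an image of some $x\in X$. Two configurations $(P_1,P_2,X)$, $(Q_1,Q_2,Y)$ are equivalent if some $H\in\mathrm{PGL}(4,\mathbb R)$ satisfies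 $H(X)=Y$ and $P_iH^{-1}=Q_i$ up to scale for $i=1,2$; they are conjugate if they are nonequivalent reconstructions of a common set $\Sigma$. The conjugate is non-trivial if $F_P\neq F_Q$ (up to scale), and $(P_1,P_2,X)$ is non-trivially critical if it has a non-trivial conjugate. The set of critical points of $(P_1,P_2)$ with respect to $(Q_1,Q_2)$ is the set of $x\in\mathbb P^3$ having an image under $(P_1,P_2)$ which is also an image of some $y\in\mathbb P^3$ under $(Q_1,Q_2)$. A quadric is given by a nonzero real symmetric $4\times4$ matrix; it is identified with its set of complex points where no multiplicity matters. It is smooth, a cone, two planes (real or complex conjugate), or a double plane if the rank is $4,3,2,1$; its singular locus is the kernel of the matrix (the vertex of a cone, the singular line of two planes). It is ruled if it contains a real line. A quadric $S$ is a *critical quadric* with respect to $(P_1,P_2)$ if it contains $p_1,p_2$ and is of one of the following types, where "on a line" means that the line $\overline{p_1p_2}$ is contained in $S$: | | Type of $S$ | Type of conjugate quadrics | Number of conjugates | |---|---|---|---| | 1 | smooth ruled, centres not on a line | 1 | $2$ | | 2 | smooth ruled, centres on a line | 3 | $1$ | | 3 | cone, centres not on a line | 2 | $1$ | | 4 | cone,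 exactly one centre at the vertex | 4 | $\infty$ | | 5 | two planes, centres in the same plane, neither on the singular line | 5 | $\infty$ | | 6 | two planes, exactly one centre on the singular line | 6 | $\infty$ | | 7 | two planes, both centres on the singular line | 7 | $\infty$ | | 8 | double plane, centres in the plane | 8 | $\infty$ | A *conjugate* of a critical quadric $S$ is a configuration $(Q_1,Q_2,Y)$ with $F_Q\ne F_P$ such that $S$ is the set of critical points of $(P_1,P_2)$ with respect to $(Q_1,Q_2)$ and $Y$ is the set of critical points of $(Q_1,Q_2)$ with respect to $(P_1,P_2)$. **Theorem.** Let $(P_1,P_2)$ be a pair of cameras. 1. For every $X\subseteq\mathbb P^3$, the configuration $(P_1,P_2,X)$ is non-trivially critical if and only if there is a critical quadric (with respect to $P_1,P_2$) containing both camera centres and all of $X$. 2. Let $S$ be a critical quadric. Every conjugate $(Q_1,Q_2,Y)$ of $S$ is a non-trivial conjugate of the configuration $(P_1,P_2,S)$, and $Y$ is a quadric whose type with respect to $(Q_1,Q_2)$ is the one given in the third column of the table. If $S$ is not a double plane, then every non-trivial conjugate $(Q_1,Q_2,Y')$ of the configuration $(P_1,P_2,S)$ satisfies $Y'\subseteq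 Y$ for a conjugate $(Q_1,Q_2,Y)$ of $S$ with the same cameras. The number of conjugates of $S$ up to equivalence is the one given in the last column. -/

import Mathlib

open scoped LinearAlgebra.Projectivization Matrix MatrixGroups

namespace TwoView

noncomputable section

/-- Space points: complex projective 3-space. -/
abbrev Space : Type := ℙ ℂ (Fin 4 → ℂ)

/-- Image points: the complex projective plane. -/
abbrev Image : Type := ℙ ℂ (Fin 3 → ℂ)

/-- A real matrix regarded as a complex one. -/
abbrev cx {m n : Type*} (A : Matrix m n ℝ) : Matrix m n ℂ := A.map (algebraMap ℝ ℂ)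

/-! ### Cameras -/

/-- A camera: a real `3 × 4` matrix of full rank. -/
structure Camera where
  mat : Matrix (Fin 3) (Fin 4) ℝ
  full_rank : mat.rank = 3

lemma Camera.exists_right_inverse (C : Camera) :
    ∃ R : Matrix (Fin 4) (Fin 3) ℝ, C.mat * R = 1 := by
  have hs : Function.Surjective C.mat.mulVecLin := by
    rw [← LinearMap.range_eq_top]
    apply Submodule.eq_top_of_finrank_eq
    have := C.full_rank
    rw [Matrix.rank] at this
    simpa using this
  choose g hg using hs
  refine ⟨Matrix.of fun i j => g (Pi.single j 1) i, ?_⟩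
  ext i j
  have := congrFun (hg (Pi.single j 1)) i
  simpa [Matrix.mul_apply, Matrix.mulVec, dotProduct, Matrix.one_apply, Pi.single_apply] using this

lemma Camera.finrank_ker (C : Camera) :
    Module.finrank ℂ (LinearMap.ker (cx C.mat).mulVecLin) = 1 := by
  obtain ⟨R, hR⟩ := C.exists_right_inverse
  have hR' : cx C.mat * cx R = 1 := by
    rw [← Matrix.map_mul, hR]
    simp
  have hs : LinearMap.range (cx C.mat).mulVecLin = ⊤ := by
    rw [LinearMap.range_eq_top]
    intro v
    exact ⟨cx R *ᵥ v, by simp [hR']⟩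
  have h := LinearMap.finrank_range_add_finrank_ker (cx C.mat).mulVecLin
  rw [hs] at h
  simp at h
  omega

/-- The camera centre: the kernel of the camera matrix, a point of space. -/
def Camera.center (C : Camera) : Space :=
  Projectivization.mk'' (LinearMap.ker (cx C.mat).mulVecLin) C.finrank_ker

/-- `C.Sees x u`: the space point `x` lies on the back-projected line of the image point `u`,
i.e. on the closure of the preimage of `u` under the projection. If `x` is not the centre, this
says that `u` is the image of `x`; the centre lies on all back-projected lines. -/
def Camera.Sees (C : Camera) (x : Space) (u : Image) : Prop :=
  cx C.mat *ᵥ x.rep ∈ u.submodule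

/-- A pair of cameras with distinct centres. -/
structure CameraPair where
  fst : Camera
  snd : Camera
  center_ne : fst.center ≠ snd.center

/-- The closure of the graph of the joint camera map `x ↦ (P₁ x, P₂ x)`. As the two centres are
distinct, it is given by the two conditions `x ∈ closure (Pᵢ⁻¹ (sᵢ))`; outside the two centres it is
the graph itself. -/
def CameraPair.Sees (P : CameraPair) (x : Space) (s : Image × Image) : Prop :=
  P.fst.Sees x s.1 ∧ P.snd.Sees x s.2

/-- The `6 × 6` matrix with block rows `(P₁, x, 0)` and `(P₂, 0, y)`. -/
def CameraPair.jointMatrix (P : CameraPair) (x y : Fin 3 → ℝ) : Matrix (Fin 6) (Fin 6) ℝ :=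
  Matrix.reindex finSumFinEquiv finSumFinEquiv
    (Matrix.fromBlocks P.fst.mat (Matrix.of fun i => ![x i, 0])
      P.snd.mat (Matrix.of fun i => ![0, y i]))

/-- The fundamental matrix: the matrix of the bilinear form `(x, y) ↦ det (P.jointMatrix x y)`. -/
def CameraPair.fundamentalMatrix (P : CameraPair) : Matrix (Fin 3) (Fin 3) ℝ :=
  Matrix.of fun i j => (P.jointMatrix (Pi.single i 1) (Pi.single j 1)).det

/-- Equality of the fundamental matrices as matrices defined up to scale. -/
def CameraPair.SameFundamental (P Q : CameraPair) : Prop :=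
  ∃ c : ℝ, c ≠ 0 ∧ Q.fundamentalMatrix = c • P.fundamentalMatrix

/-! ### Configurations -/

/-- A configuration of two cameras and a set of space points. -/
@[ext]
structure Configuration where
  cameras : CameraPair
  points : Set Space

/-- The configuration `c` is a reconstruction of the set `S` of pairs of image points:
every point of `c` has an image in `S` and every member of `S` is an image of a point of `c`. -/
def Configuration.IsReconstruction (c : Configuration) (S : Set (Image × Image)) : Prop :=
  (∀ x ∈ c.points, ∃ s ∈ S, c.cameras.Sees x s) ∧ (∀ s ∈ S, ∃ x ∈ c.points, c.cameras.Sees x s)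

lemma cx_mul {l m n : Type*} [Fintype m] (A : Matrix l m ℝ) (B : Matrix m n ℝ) :
    cx (A * B) = cx A * cx B := Matrix.map_mul

lemma cx_one {n : Type*} [DecidableEq n] : cx (1 : Matrix n n ℝ) = 1 := by simp

lemma cx_mulVec_injective (H : GL (Fin 4) ℝ) :
    Function.Injective (cx (H : Matrix (Fin 4) (Fin 4) ℝ)).mulVecLin := by
  apply Function.LeftInverse.injective (g := (cx (↑H⁻¹ : Matrix (Fin 4) (Fin 4) ℝ)).mulVecLin)
  intro v
  simp only [Matrix.mulVecLin_apply, Matrix.mulVec_mulVec]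
  rw [← cx_mul, ← Units.val_mul, inv_mul_cancel, Units.val_one, cx_one, Matrix.one_mulVec]

/-- The real projective transformation of space given by an invertible real matrix. -/
def projAct (H : GL (Fin 4) ℝ) : Space → Space :=
  Projectivization.map (cx (H : Matrix (Fin 4) (Fin 4) ℝ)).mulVecLin (cx_mulVec_injective H)

lemma projAct_one : projAct 1 = id := by
  funext x
  induction x using Projectivization.ind with
  | h v hv =>
    simp only [projAct, Projectivization.map_mk, id]
    congr 1
    simp

lemma projAct_mul (H K : GL (Fin 4) ℝ) : projAct (H * K) = projAct H ∘ projAct K := by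
  funext x
  induction x using Projectivization.ind with
  | h v hv =>
    simp only [projAct, Projectivization.map_mk, Function.comp]
    congr 1
    simp only [Matrix.mulVecLin_apply, Matrix.mulVec_mulVec, Units.val_mul, cx_mul]

/-- Equivalence of configurations under `PGL(4)`: `H(X) = Y` and `Pᵢ H⁻¹ = Qᵢ` up to scale. -/
def Configuration.Equivalent (c d : Configuration) : Prop :=
  ∃ H : GL (Fin 4) ℝ, projAct H '' c.points = d.points ∧
    (∃ a : ℝ, a ≠ 0 ∧
      c.cameras.fst.mat * (↑H⁻¹ : Matrix (Fin 4) (Fin 4) ℝ) = a • d.cameras.fst.mat) ∧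
    (∃ b : ℝ, b ≠ 0 ∧
      c.cameras.snd.mat * (↑H⁻¹ : Matrix (Fin 4) (Fin 4) ℝ) = b • d.cameras.snd.mat)

lemma scale_symm {A B : Matrix (Fin 3) (Fin 4) ℝ} {H : GL (Fin 4) ℝ}
    (h : ∃ a : ℝ, a ≠ 0 ∧ A * (↑H⁻¹ : Matrix (Fin 4) (Fin 4) ℝ) = a • B) :
    ∃ a : ℝ, a ≠ 0 ∧ B * (↑(H⁻¹)⁻¹ : Matrix (Fin 4) (Fin 4) ℝ) = a • A := by
  obtain ⟨a, ha, h⟩ := h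
  refine ⟨a⁻¹, inv_ne_zero ha, ?_⟩
  have hB : B = a⁻¹ • (A * (↑H⁻¹ : Matrix (Fin 4) (Fin 4) ℝ)) := by
    rw [h, smul_smul, inv_mul_cancel₀ ha, one_smul]
  rw [hB, inv_inv, Matrix.smul_mul, Matrix.mul_assoc, ← Units.val_mul, inv_mul_cancel,
    Units.val_one, Matrix.mul_one]

lemma scale_trans {A B C : Matrix (Fin 3) (Fin 4) ℝ} {H K : GL (Fin 4) ℝ}
    (h : ∃ a : ℝ, a ≠ 0 ∧ A * (↑H⁻¹ : Matrix (Fin 4) (Fin 4) ℝ) = a • B)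
    (k : ∃ a : ℝ, a ≠ 0 ∧ B * (↑K⁻¹ : Matrix (Fin 4) (Fin 4) ℝ) = a • C) :
    ∃ a : ℝ, a ≠ 0 ∧ A * (↑(K * H)⁻¹ : Matrix (Fin 4) (Fin 4) ℝ) = a • C := by
  obtain ⟨a, ha, h⟩ := h
  obtain ⟨b, hb, k⟩ := k
  refine ⟨a * b, mul_ne_zero ha hb, ?_⟩
  rw [mul_inv_rev, Units.val_mul, ← Matrix.mul_assoc, h, Matrix.smul_mul, k, smul_smul]

/-- Configurations up to the action of `PGL(4)`. -/
instance configurationSetoid : Setoid Configuration where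
  r := Configuration.Equivalent
  iseqv :=
    { refl := fun c => ⟨1, by simp [projAct_one], ⟨1, by simp⟩, ⟨1, by simp⟩⟩
      symm := by
        rintro c d ⟨H, hX, h₁, h₂⟩
        refine ⟨H⁻¹, ?_, scale_symm h₁, scale_symm h₂⟩
        rw [← hX, ← Set.image_comp, ← projAct_mul, inv_mul_cancel, projAct_one, Set.image_id]
      trans := by
        rintro c d e ⟨H, hX, h₁, h₂⟩ ⟨K, kX, k₁, k₂⟩
        refine ⟨K * H, ?_, scale_trans h₁ k₁, scale_trans h₂ k₂⟩
        rw [projAct_mul, Set.image_comp, hX, kX] }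

/-- Conjugate configurations: nonequivalent reconstructions of the same set. -/
def Configuration.Conjugate (c d : Configuration) : Prop :=
  (∃ S : Set (Image × Image), c.IsReconstruction S ∧ d.IsReconstruction S) ∧ ¬ c.Equivalent d

/-- A conjugate whose fundamental matrix is different (up to scale). -/
def Configuration.NontrivialConjugate (c d : Configuration) : Prop :=
  c.Conjugate d ∧ ¬ c.cameras.SameFundamental d.cameras

/-- A non-trivial critical configuration. -/
def Configuration.NontriviallyCritical (c : Configuration) : Prop :=
  ∃ d : Configuration, c.NontrivialConjugate d

/-- The set of critical points of `P` with respect to `Q`. -/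
def criticalPoints (P Q : CameraPair) : Set Space :=
  {x | ∃ y : Space, ∃ s : Image × Image, P.Sees x s ∧ Q.Sees y s}

/-! ### Quadrics -/

/-- A real quadric surface, given by a nonzero real symmetric matrix. -/
structure Quadric where
  mat : Matrix (Fin 4) (Fin 4) ℝ
  symm : mat.IsSymm
  ne_zero : mat ≠ 0

/-- The complex points of a quadric. -/
def Quadric.points (S : Quadric) : Set Space :=
  {x | x.rep ⬝ᵥ (cx S.mat *ᵥ x.rep) = 0}

/-- The singular locus of a quadric: empty, a point, a line or a plane if the rank of the matrix is
`4`, `3`, `2` or `1`. -/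
def Quadric.singularLocus (S : Quadric) : Set Space :=
  {x | cx S.mat *ᵥ x.rep = 0}

/-- A quadric is ruled if it contains a real line. -/
def Quadric.IsRuled (S : Quadric) : Prop :=
  ∃ W : Submodule ℝ (Fin 4 → ℝ), Module.finrank ℝ W = 2 ∧ ∀ w ∈ W, w ⬝ᵥ (S.mat *ᵥ w) = 0

def Quadric.IsSmooth (S : Quadric) : Prop := S.mat.rank = 4

def Quadric.IsCone (S : Quadric) : Prop := S.mat.rank = 3

/-- Two distinct planes, possibly complex conjugates. -/
def Quadric.IsTwoPlanes (S : Quadric) : Prop := S.mat.rank = 2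

def Quadric.IsDoublePlane (S : Quadric) : Prop := S.mat.rank = 1

/-- The line spanned by two distinct points. -/
def lineThrough (p q : Space) : Set Space :=
  {x | x.submodule ≤ p.submodule ⊔ q.submodule}

/-- The plane with equation `l`. -/
def plane (l : Fin 4 → ℂ) : Set Space := {x | l ⬝ᵥ x.rep = 0}

/-- The (distinct) points `p` and `q` lie on a common line of the quadric. -/
def Quadric.OnCommonLine (S : Quadric) (p q : Space) : Prop := lineThrough p q ⊆ S.points

/-- The points `p` and `q` lie in a common plane of the quadric. -/
def Quadric.InCommonPlane (S : Quadric) (p q : Space) : Prop :=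
  ∃ l : Fin 4 → ℂ, l ≠ 0 ∧ plane l ⊆ S.points ∧ p ∈ plane l ∧ q ∈ plane l

/-- The rows of the table of critical quadrics. -/
inductive QuadricType
  /-- smooth ruled quadric, camera centres not on a line -/
  | smoothNotOnLine
  /-- smooth ruled quadric, camera centres on a line -/
  | smoothOnLine
  /-- cone, camera centres not on a line -/
  | coneNotOnLine
  /-- cone, one camera centre at the vertex, the other one not -/
  | coneVertex
  /-- two planes, camera centres in the same plane, neither on the singular line -/
  | planesSamePlane
  /-- two planes, exactly one camera centre on the singular line -/
  | planesOneSingular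
  /-- two planes, both camera centres on the singular line -/
  | planesBothSingular
  /-- a double plane, camera centres in the plane -/
  | doublePlane

/-- The quadric `S` and the camera centres of `P` (which lie on `S`) are of the given type. -/
def Quadric.HasType (S : Quadric) (P : CameraPair) (t : QuadricType) : Prop :=
  P.fst.center ∈ S.points ∧ P.snd.center ∈ S.points ∧
  match t with
  | .smoothNotOnLine =>
      S.IsSmooth ∧ S.IsRuled ∧ ¬ S.OnCommonLine P.fst.center P.snd.center
  | .smoothOnLine =>
      S.IsSmooth ∧ S.IsRuled ∧ S.OnCommonLine P.fst.center P.snd.center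
  | .coneNotOnLine =>
      S.IsCone ∧ ¬ S.OnCommonLine P.fst.center P.snd.center
  | .coneVertex =>
      S.IsCone ∧ Xor (P.fst.center ∈ S.singularLocus) (P.snd.center ∈ S.singularLocus)
  | .planesSamePlane =>
      S.IsTwoPlanes ∧ S.InCommonPlane P.fst.center P.snd.center ∧
        P.fst.center ∉ S.singularLocus ∧ P.snd.center ∉ S.singularLocus
  | .planesOneSingular =>
      S.IsTwoPlanes ∧ Xor (P.fst.center ∈ S.singularLocus) (P.snd.center ∈ S.singularLocus)
  | .planesBothSingular =>
      S.IsTwoPlanes ∧ P.fst.center ∈ S.singularLocus ∧ P.snd.center ∈ S.singularLocus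
  | .doublePlane => S.IsDoublePlane

/-- A critical quadric with respect to a pair of cameras. -/
def Quadric.IsCritical (S : Quadric) (P : CameraPair) : Prop :=
  ∃ t : QuadricType, S.HasType P t

/-- The type of the conjugate quadrics. -/
def QuadricType.conjugate : QuadricType → QuadricType
  | .smoothOnLine => .coneNotOnLine
  | .coneNotOnLine => .smoothOnLine
  | t => t

/-- The number of conjugates. -/
def QuadricType.numConjugates : QuadricType → ℕ∞
  | .smoothNotOnLine => 2
  | .smoothOnLine => 1
  | .coneNotOnLine => 1
  | _ => ⊤

/-- The conjugates of the quadric `S` with respect to the cameras `P`: the configurations `(Q, Y)`,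
with a fundamental matrix different from that of `P`, for which `S` is the set of critical points of
`P` with respect to `Q` and `Y` is the set of critical points of `Q` with respect to `P`. -/
def Quadric.conjugates (S : Quadric) (P : CameraPair) : Set Configuration :=
  {d | ¬ P.SameFundamental d.cameras ∧ S.points = criticalPoints P d.cameras ∧
    d.points = criticalPoints d.cameras P}

/-- The number of conjugates of the quadric `S`, where equivalent configurations are identified. -/
def Quadric.conjugateCount (S : Quadric) (P : CameraPair) : ℕ∞ :=
  (Quotient.mk configurationSetoid '' S.conjugates P).encard

end

end TwoView

/-!
Pulling `F_Q` back along the two projections of `P` gives a symmetric form on `ℝ⁴`, and its zero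
set is the set of critical points of `P` with respect to `Q`. This pullback is linear in `F_Q` with
kernel `ℝ F_P`, and its image consists of the quadrics through both centres. A real quadric is
determined up to scale by its complex points, and every real matrix of rank two is the fundamental
matrix of a camera pair that is unique up to `PGL(4, ℝ)`. Hence the conjugates of the quadric
coming from `F` are, up to equivalence, the matrices of rank two in the pencil `F + x F_P`.

Since `det F_P = 0`, the determinant `det (F + x F_P)` is at most quadratic in `x`. Its coefficients
determine the number of conjugates, and its discriminant is a positive multiple of the determinant
of the quadric. The type of the quadric is read off from invariants of the pencil which are
symmetric in `F_P` and `F_Q`, except that the two mixed determinants are exchanged; this gives the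
type of the conjugate quadric.
-/

namespace TwoView

noncomputable section

/-! ### Symmetric bilinear forms and their isotropic vectors -/

section BilinForm

variable {K V : Type*} [Field K] [AddCommGroup V] [Module K V] {B : LinearMap.BilinForm K V}

lemma exists_isotropic_apply_eq_one [NeZero (2 : K)] (hB : B.IsSymm) {v : V} (hv : B v v = 0)
    (hne : B v ≠ 0) : ∃ w, B w w = 0 ∧ B v w = 1 := by
  obtain ⟨x, hx⟩ := DFunLike.ne_iff.1 hne
  obtain ⟨y, hvy⟩ : ∃ y, B v y = 1 := ⟨(B v x)⁻¹ • x, by simp [inv_mul_cancel₀ hx]⟩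
  have hyv : B y v = 1 := by rw [hB.eq, hvy]
  refine ⟨y - (B y y / 2) • v, ?_, by simp [hv, hvy]⟩
  simp only [map_sub, map_smul, LinearMap.sub_apply, LinearMap.smul_apply, smul_eq_mul, hv, hvy,
    hyv]
  field_simp
  ring

/-- If `B b b ≠ 0`, a suitable `a + t • b` is isotropic, although `B a (a + t • b) = B a a`. -/
lemma isotropic_of_apply_eq_zero [IsAlgClosed K] (hB : B.IsSymm)
    (hker : ∀ v, B v v = 0 → B v = 0) {a b : V} (ha : B a a ≠ 0) (hab : B a b = 0) :
    B b b = 0 := by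
  by_contra hb
  obtain ⟨t, ht⟩ := IsAlgClosed.exists_pow_nat_eq (-(B a a) / B b b) two_pos
  have hba : B b a = 0 := by rw [hB.eq, hab]
  have hiso : B (a + t • b) (a + t • b) = 0 := by
    have htb : t ^ 2 * B b b = -(B a a) := by rw [ht, div_mul_cancel₀ _ hb]
    simp only [map_add, map_smul, LinearMap.add_apply, LinearMap.smul_apply, smul_eq_mul, hab, hba]
    linear_combination htb
  have hval : B (a + t • b) a = B a a := by simp [hba]
  exact ha (by rw [← hval, hker _ hiso, LinearMap.zero_apply])

lemma apply_self_mul_apply_self_eq_sq [IsAlgClosed K] (hB : B.IsSymm)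
    (hker : ∀ v, B v v = 0 → B v = 0) {a : V} (ha : B a a ≠ 0) (z : V) :
    B a a * B z z = B a z ^ 2 := by
  have hza : B z a = B a z := hB.eq z a
  have horth := isotropic_of_apply_eq_zero hB hker ha (b := z - (B a z / B a a) • a)
    (by simp [div_mul_cancel₀ _ ha])
  simp only [map_sub, map_smul, LinearMap.sub_apply, LinearMap.smul_apply, smul_eq_mul, hza]
    at horth
  field_simp at horth
  linear_combination horth

section Hyperbolic

variable [CharZero K] {D : LinearMap.BilinForm K V} (hB : B.IsSymm) (hD : D.IsSymm)
  (h : ∀ z, B z z = 0 → D z z = 0) {v w : V} (hv : B v v = 0) (hw : B w w = 0)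
  (hvw : B v w = 1) (hDvw : D v w = 0)

include hB hD h hv hw hvw hDvw

/-- If `2 * t * s = B x x` then `t • v - s • w + x` is isotropic for `B`; the values of `D` there
for `t = 1, -1, 2` give the claim. -/
lemma apply_eq_zero_of_orthogonal_hyperbolic {x : V} (hvx : B v x = 0) (hwx : B w x = 0) :
    D x x = 0 ∧ D v x = 0 := by
  have hDv := h v hv
  have hDw := h w hw
  have hvalue (t s : K) (hts : 2 * t * s = B x x) :
      2 * t * D v x - 2 * s * D w x + D x x = 0 := by
    have := h (t • v - s • w + x) (by
      simp only [map_add, map_sub, map_smul, LinearMap.add_apply, LinearMap.sub_apply,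
        LinearMap.smul_apply, smul_eq_mul, hv, hw, hvw, hB.eq w v, hvx, hwx, hB.eq x v, hB.eq x w]
      linear_combination -hts)
    simp only [map_add, map_sub, map_smul, LinearMap.add_apply, LinearMap.sub_apply,
      LinearMap.smul_apply, smul_eq_mul, hDv, hDw, hDvw, hD.eq w v, hD.eq x v, hD.eq x w] at this
    linear_combination this
  have h₁ := hvalue 1 (B x x / 2) (by ring)
  have h₂ := hvalue (-1) (-(B x x / 2)) (by ring)
  have h₃ := hvalue 2 (B x x / 4) (by ring)
  constructor
  · linear_combination (h₁ + h₂) / 2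
  · linear_combination (1 / 3) * h₃ - (1 / 4) * h₁ - (1 / 12) * h₂

lemma eq_zero_of_isotropic_imp_of_hyperbolic : D = 0 := by
  refine LinearMap.BilinForm.ext_of_isSymm hD LinearMap.BilinForm.isSymm_zero fun z => ?_
  obtain ⟨x, hx⟩ : ∃ x, x = z - B w z • v - B v z • w := ⟨_, rfl⟩
  have hwv : B w v = 1 := by rw [hB.eq, hvw]
  have hvx : B v x = 0 := by simp [hx, hv, hvw]
  have hwx : B w x = 0 := by simp [hx, hw, hwv]
  obtain ⟨hDx, hDvx⟩ :=
    apply_eq_zero_of_orthogonal_hyperbolic hB hD h hv hw hvw hDvw hvx hwx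
  have hDwx := (apply_eq_zero_of_orthogonal_hyperbolic hB hD h hw hv hwv
    (by rw [hD.eq, hDvw]) hwx hvx).2
  rw [show z = B w z • v + B v z • w + x by rw [hx]; abel]
  simp [h v hv, h w hw, hDvw, hD.eq w v, hD.eq x v, hD.eq x w, hDx, hDvx, hDwx]

end Hyperbolic

lemma eq_smul_of_isotropic_imp_of_hyperbolic [CharZero K] {B' : LinearMap.BilinForm K V}
    (hB : B.IsSymm) (hB' : B'.IsSymm) (h : ∀ z, B z z = 0 → B' z z = 0) {v w : V}
    (hv : B v v = 0) (hw : B w w = 0) (hvw : B v w = 1) : B' = B' v w • B := by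
  refine sub_eq_zero.1 (eq_zero_of_isotropic_imp_of_hyperbolic hB (hB'.sub (hB.smul _))
    (fun z hz => ?_) hv hw hvw ?_)
  · simp [h z hz, hz]
  · simp [hvw]

lemma eq_zero_of_forall_mem_isotropic [NeZero (2 : K)] (hB : B.IsSymm) {W : Submodule K V}
    (h : ∀ w ∈ W, B w w = 0) {v w : V} (hv : v ∈ W) (hw : w ∈ W) : B v w = 0 := by
  have hadd := h _ (W.add_mem hv hw)
  simp only [map_add, LinearMap.add_apply, h v hv, h w hw, hB.eq w v, zero_add, add_zero] at hadd
  rw [← two_mul] at hadd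
  exact (mul_eq_zero.1 hadd).resolve_left two_ne_zero

end BilinForm

/-! ### Ranks and determinants of matrices -/

section Matrix

variable {K : Type*} [Field K]

lemma rank_lt_card_iff_det_eq_zero {n : Type*} [Fintype n] [DecidableEq n] {A : Matrix n n K} :
    A.rank < Fintype.card n ↔ A.det = 0 := by
  constructor
  · contrapose!
    exact fun h => (Matrix.rank_of_det_ne_zero h).ge
  · intro h
    refine lt_of_le_of_ne A.rank_le_card_width fun hrank => ?_
    have hsurj : Function.Surjective A.mulVecLin := by
      rw [← LinearMap.range_eq_top]
      exact Submodule.eq_top_of_finrank_eq (by rw [← Matrix.rank, hrank, Module.finrank_pi])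
    have hunit := (Matrix.isUnit_iff_isUnit_det A).1 (Matrix.mulVec_surjective_iff_isUnit.1 hsurj)
    exact not_isUnit_zero (h ▸ hunit)

lemma card_le_rank_of_det_submatrix_ne_zero {m n k : Type*} [Fintype n] [Fintype k]
    [DecidableEq k] {A : Matrix m n K} (r : k → m) (c : k → n) (h : (A.submatrix r c).det ≠ 0) :
    Fintype.card k ≤ A.rank :=
  Matrix.rank_of_det_ne_zero h ▸ A.rank_submatrix_le r c

lemma rank_pos_of_ne_zero {m n : Type*} [Fintype n] {A : Matrix m n K} (hA : A ≠ 0) :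
    0 < A.rank := by
  obtain ⟨i, j, hij⟩ : ∃ i j, A i j ≠ 0 := by
    by_contra! h
    exact hA (Matrix.ext h)
  exact card_le_rank_of_det_submatrix_ne_zero (k := Fin 1) ![i] ![j] (by
    rw [Matrix.det_fin_one]
    exact hij)

lemma rank_vecMulVec_add_vecMulVec_le {m n : Type*} [Fintype n] (u w : m → K)
    (v x : n → K) : (Matrix.vecMulVec u v + Matrix.vecMulVec w x).rank ≤ 2 := by
  have hfactor : Matrix.vecMulVec u v + Matrix.vecMulVec w x =
      (Matrix.of fun i => ![u i, w i]) * Matrix.of ![v, x] := by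
    ext i j
    simp [Matrix.mul_apply, Fin.sum_univ_two, Matrix.vecMulVec_apply]
  rw [hfactor]
  exact (Matrix.rank_mul_le_right _ _).trans (Matrix.rank_le_card_height _)

lemma crossProduct_row_eq_zero_of_adjugate_eq_zero {R : Type*} [CommRing R]
    {F : Matrix (Fin 3) (Fin 3) R} (h : F.adjugate = 0) (i j : Fin 3) : F i ⨯₃ F j = 0 := by
  have hentry (k l : Fin 3) := congrFun₂ h k l
  simp only [Matrix.adjugate_fin_three, Fin.forall_fin_succ, Matrix.zero_apply,
    Fin.succ_zero_eq_one, Fin.succ_one_eq_two, Matrix.of_apply, Matrix.cons_val,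
    IsEmpty.forall_iff, and_true] at hentry
  rw [cross_apply]
  fin_cases i <;> fin_cases j <;> ext k <;> fin_cases k <;> simp <;> grind

lemma exists_eq_vecMulVec_of_adjugate_eq_zero {F : Matrix (Fin 3) (Fin 3) K}
    (h : F.adjugate = 0) : ∃ u v : Fin 3 → K, F = Matrix.vecMulVec u v := by
  by_cases hF : F = 0
  · exact ⟨0, 0, by rw [hF, Matrix.zero_vecMulVec]⟩
  obtain ⟨i, hi⟩ := Function.ne_iff.1 hF
  have hrow (k : Fin 3) : ∃ a : K, a • F i = F k := by
    have hdep : ¬ LinearIndependent K ![F i, F k] := fun hli =>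
      crossProduct_ne_zero_iff_linearIndependent.2 hli
        (crossProduct_row_eq_zero_of_adjugate_eq_zero h i k)
    rw [LinearIndependent.pair_iff' hi] at hdep
    push Not at hdep
    exact hdep
  choose u hu using hrow
  exact ⟨u, F i, funext fun k => (hu k).symm⟩

lemma exists_isUnit_det_of_linearIndependent {p q : Fin 4 → K}
    (h : LinearIndependent K ![p, q]) :
    ∃ R : Matrix (Fin 4) (Fin 4) K, IsUnit R.det ∧ R 2 = p ∧ R 3 = q := by
  obtain ⟨s, hs⟩ := exists_linearIndependent_cons_of_lt_finrank h (by simp)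
  obtain ⟨t, ht⟩ := exists_linearIndependent_cons_of_lt_finrank hs (by simp)
  refine ⟨Matrix.of ![t, s, p, q], ?_, rfl, rfl⟩
  rw [← Matrix.isUnit_iff_isUnit_det, ← Matrix.linearIndependent_rows_iff_isUnit]
  exact ht

lemma det_eq_sq_of_lowerRight_eq_zero {R : Type*} [CommRing R] {M : Matrix (Fin 4) (Fin 4) R}
    (hM : M.IsSymm) (h₂₂ : M 2 2 = 0) (h₂₃ : M 2 3 = 0) (h₃₃ : M 3 3 = 0) :
    M.det = (M 0 2 * M 1 3 - M 0 3 * M 1 2) ^ 2 := by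
  have h₃₂ : M 3 2 = 0 := by rw [hM.apply 2 3, h₂₃]
  rw [Matrix.det_succ_row_zero]
  simp [Fin.sum_univ_four, Matrix.det_fin_three, Fin.succAbove, h₂₂, h₃₃, h₂₃, h₃₂, hM.apply 0 2,
    hM.apply 0 3, hM.apply 1 2, hM.apply 1 3, hM.apply 0 1]
  ring

/-- In a basis that starts outside and ends inside the isotropic plane, the determinant of the form
is the square of a `2 × 2` minor. -/
lemma det_nonneg_of_isotropic {R : Type*} [Field R] [LinearOrder R] [IsStrictOrderedRing R]
    {S : Matrix (Fin 4) (Fin 4) R} (hS : S.IsSymm) {W : Submodule R (Fin 4 → R)}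
    (hW : Module.finrank R W = 2) (h : ∀ w ∈ W, w ⬝ᵥ (S *ᵥ w) = 0) : 0 ≤ S.det := by
  let b := Module.finBasisOfFinrankEq R W hW
  have hli : LinearIndependent R ![(b 0 : Fin 4 → R), b 1] := by
    have hb : ![(b 0 : Fin 4 → R), b 1] = W.subtype ∘ b := by
      funext i
      fin_cases i <;> rfl
    exact hb ▸ b.linearIndependent.map' W.subtype (Submodule.ker_subtype W)
  obtain ⟨A, hA, hA₂, hA₃⟩ := exists_isUnit_det_of_linearIndependent hli
  have hform (i j : Fin 4) : (A * S * Aᵀ) i j = Matrix.toBilin' S (A i) (A j) := by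
    rw [Matrix.toBilin'_apply', Matrix.mul_assoc, Matrix.mul_apply']
    rfl
  have hzero {v w : Fin 4 → R} (hv : v ∈ W) (hw : w ∈ W) : Matrix.toBilin' S v w = 0 :=
    eq_zero_of_forall_mem_isotropic (Matrix.isSymm_toBilin'_iff_isSymm.2 hS)
      (fun w hw => by rw [Matrix.toBilin'_apply', h w hw]) hv hw
  have hsymm : (A * S * Aᵀ).IsSymm := by
    rw [Matrix.IsSymm, Matrix.transpose_mul, Matrix.transpose_mul, Matrix.transpose_transpose, hS,
      Matrix.mul_assoc]
  have hsq := det_eq_sq_of_lowerRight_eq_zero hsymm (by rw [hform, hA₂, hzero (b 0).2 (b 0).2])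
    (by rw [hform, hA₂, hA₃, hzero (b 0).2 (b 1).2]) (by rw [hform, hA₃, hzero (b 1).2 (b 1).2])
  rw [Matrix.det_mul, Matrix.det_mul, Matrix.det_transpose] at hsq
  have hpos : 0 < A.det * A.det := mul_self_pos.2 hA.ne_zero
  refine nonneg_of_mul_nonneg_right (?_ : 0 ≤ A.det * A.det * S.det) hpos
  rw [mul_right_comm, hsq]
  positivity

end Matrix

/-! ### Complexification and homogeneous coordinates -/

/-- A real vector regarded as a complex one. -/
def cxVec {n : Type*} (v : n → ℝ) : n → ℂ := fun i => (v i : ℂ)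

lemma cxVec_eq_zero_iff {n : Type*} {v : n → ℝ} : cxVec v = 0 ↔ v = 0 := by
  simp [funext_iff, cxVec]

lemma cx_mulVec_cxVec {m n : Type*} [Fintype n] (A : Matrix m n ℝ) (v : n → ℝ) :
    cx A *ᵥ cxVec v = cxVec (A *ᵥ v) := by
  ext i
  simp [Matrix.mulVec, dotProduct, cxVec]

lemma cxVec_dotProduct_cxVec {n : Type*} [Fintype n] (u v : n → ℝ) :
    cxVec u ⬝ᵥ cxVec v = ((u ⬝ᵥ v : ℝ) : ℂ) := by
  simp [dotProduct, cxVec]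

lemma cx_injective {m n : Type*} : Function.Injective (cx : Matrix m n ℝ → Matrix m n ℂ) :=
  Matrix.map_injective Complex.ofReal_injective

lemma cx_smul {m n : Type*} (c : ℝ) (A : Matrix m n ℝ) : cx (c • A) = (c : ℂ) • cx A := by
  ext i j
  simp

lemma cx_add {m n : Type*} (A B : Matrix m n ℝ) : cx (A + B) = cx A + cx B := by
  ext i j
  simp

lemma isSymm_cx {n : Type*} {A : Matrix n n ℝ} (hA : A.IsSymm) : (cx A).IsSymm :=
  hA.map _

lemma exists_ne_zero_rep_mk_eq_smul {K V : Type*} [DivisionRing K] [AddCommGroup V] [Module K V]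
    {v : V} (hv : v ≠ 0) : ∃ a : K, a ≠ 0 ∧ (Projectivization.mk K v hv).rep = a • v := by
  obtain ⟨a, ha⟩ := Projectivization.exists_smul_eq_mk_rep K v hv
  exact ⟨a, a.ne_zero, ha.symm⟩

lemma Quadric.mk_mem_points (S : Quadric) {v : Fin 4 → ℂ} (hv : v ≠ 0) :
    Projectivization.mk ℂ v hv ∈ S.points ↔ v ⬝ᵥ (cx S.mat *ᵥ v) = 0 := by
  obtain ⟨a, ha, h⟩ := exists_ne_zero_rep_mk_eq_smul (K := ℂ) hv
  simp only [Quadric.points, Set.mem_ofPred_eq, h, Matrix.mulVec_smul, dotProduct_smul,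
    smul_dotProduct, smul_eq_mul, mul_eq_zero, ha, false_or]

lemma Quadric.mk_mem_singularLocus (S : Quadric) {v : Fin 4 → ℂ} (hv : v ≠ 0) :
    Projectivization.mk ℂ v hv ∈ S.singularLocus ↔ cx S.mat *ᵥ v = 0 := by
  obtain ⟨a, ha, h⟩ := exists_ne_zero_rep_mk_eq_smul (K := ℂ) hv
  simp only [Quadric.singularLocus, Set.mem_ofPred_eq, h, Matrix.mulVec_smul, smul_eq_zero, ha,
    false_or]

lemma mk_mem_plane (l : Fin 4 → ℂ) {v : Fin 4 → ℂ} (hv : v ≠ 0) :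
    Projectivization.mk ℂ v hv ∈ plane l ↔ l ⬝ᵥ v = 0 := by
  obtain ⟨a, ha, h⟩ := exists_ne_zero_rep_mk_eq_smul (K := ℂ) hv
  simp only [plane, Set.mem_ofPred_eq, h, dotProduct_smul, smul_eq_mul, mul_eq_zero, ha, false_or]

lemma mk_mem_lineThrough {p q v : Fin 4 → ℂ} (hp : p ≠ 0) (hq : q ≠ 0) (hv : v ≠ 0) :
    Projectivization.mk ℂ v hv ∈
      lineThrough (Projectivization.mk ℂ p hp) (Projectivization.mk ℂ q hq) ↔
      ∃ a b : ℂ, a • p + b • q = v := by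
  simp only [lineThrough, Set.mem_ofPred_eq, Projectivization.submodule_mk,
    Submodule.span_singleton_le_iff_mem, ← Submodule.span_union, Set.singleton_union]
  exact Submodule.mem_span_pair

lemma Camera.center_eq_mk (C : Camera) {v : Fin 4 → ℂ} (hv : v ≠ 0) (h : cx C.mat *ᵥ v = 0) :
    C.center = Projectivization.mk ℂ v hv := by
  apply Projectivization.submodule_injective
  rw [Camera.center, Projectivization.submodule_mk'', Projectivization.submodule_mk, eq_comm]
  refine Submodule.eq_of_le_of_finrank_eq ?_ (by rw [C.finrank_ker, finrank_span_singleton hv])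
  rw [Submodule.span_singleton_le_iff_mem]
  exact h

lemma Camera.sees_mk_mk_iff (C : Camera) {z : Fin 4 → ℂ} (hz : z ≠ 0) {u : Fin 3 → ℂ}
    (hu : u ≠ 0) :
    C.Sees (Projectivization.mk ℂ z hz) (Projectivization.mk ℂ u hu) ↔
      ∃ a : ℂ, a • u = cx C.mat *ᵥ z := by
  obtain ⟨c, hc, h⟩ := exists_ne_zero_rep_mk_eq_smul (K := ℂ) hz
  rw [Camera.Sees, h, Matrix.mulVec_smul, Submodule.smul_mem_iff _ hc,
    Projectivization.submodule_mk, Submodule.mem_span_singleton]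

/-! ### The fundamental matrix as a bilinear form -/

section Joint

variable {K : Type*}

section CommRing

variable [CommRing K]

/-- The matrix with block rows `(A, x, 0)` and `(B, 0, y)`; unlike `CameraPair.jointMatrix`, over an
arbitrary ring. -/
def joint (A B : Matrix (Fin 3) (Fin 4) K) (x y : Fin 3 → K) : Matrix (Fin 6) (Fin 6) K :=
  Matrix.reindex finSumFinEquiv finSumFinEquiv
    (Matrix.fromBlocks A (Matrix.of fun i => ![x i, 0]) B (Matrix.of fun i => ![0, y i]))

variable (A B : Matrix (Fin 3) (Fin 4) K)

lemma joint_eq_updateCol_left (x y : Fin 3 → K) :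
    joint A B x y = (joint A B 0 y).updateCol 4 ![x 0, x 1, x 2, 0, 0, 0] := by
  ext i j
  fin_cases i <;> fin_cases j <;> rfl

lemma joint_eq_updateCol_right (x y : Fin 3 → K) :
    joint A B x y = (joint A B x 0).updateCol 5 ![0, 0, 0, y 0, y 1, y 2] := by
  ext i j
  fin_cases i <;> fin_cases j <;> rfl

lemma joint_mulVec (x y : Fin 3 → K) (z : Fin 4 → K) (a b : K) :
    joint A B x y *ᵥ ![z 0, z 1, z 2, z 3, a, b] =
      Fin.append (m := 3) (n := 3) (A *ᵥ z + a • x) (B *ᵥ z + b • y) := by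
  have h₁ : (Matrix.of fun i => ![x i, 0]) *ᵥ ![a, b] = a • x := by
    ext i
    simp
  have h₂ : (Matrix.of fun i => ![0, y i]) *ᵥ ![a, b] = b • y := by
    ext i
    simp
  have hvec : ![z 0, z 1, z 2, z 3, a, b] ∘ finSumFinEquiv = Sum.elim z ![a, b] := by
    ext i
    rcases i with i | i <;> fin_cases i <;> rfl
  rw [joint, Matrix.reindex_apply, Matrix.submatrix_mulVec_equiv, Equiv.symm_symm, hvec,
    Matrix.fromBlocks_mulVec, Sum.elim_comp_inl, Sum.elim_comp_inr, h₁, h₂]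
  ext i
  fin_cases i <;> rfl

lemma joint_map {L : Type*} [CommRing L] (f : K →+* L) (x y : Fin 3 → K) :
    (joint A B x y).map f = joint (A.map f) (B.map f) (f ∘ x) (f ∘ y) := by
  ext i j
  fin_cases i <;> fin_cases j <;> first | rfl | exact f.map_zero

/-- The determinant of the joint matrix as a bilinear form in the two image points. -/
def jointForm : (Fin 3 → K) →ₗ[K] (Fin 3 → K) →ₗ[K] K :=
  LinearMap.mk₂ K (fun x y => (joint A B x y).det)
    (fun x x' y => by
      rw [joint_eq_updateCol_left, joint_eq_updateCol_left A B x, joint_eq_updateCol_left A B x',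
        ← Matrix.det_updateCol_add]
      simp)
    (fun c x y => by
      rw [joint_eq_updateCol_left, joint_eq_updateCol_left A B x, smul_eq_mul,
        ← Matrix.det_updateCol_smul]
      simp)
    (fun x y y' => by
      rw [joint_eq_updateCol_right, joint_eq_updateCol_right A B x y,
        joint_eq_updateCol_right A B x y', ← Matrix.det_updateCol_add]
      simp)
    (fun c x y => by
      rw [joint_eq_updateCol_right, joint_eq_updateCol_right A B x y, smul_eq_mul,
        ← Matrix.det_updateCol_smul]
      simp)

lemma jointForm_apply (x y : Fin 3 → K) : jointForm A B x y = (joint A B x y).det :=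
  rfl

end CommRing

lemma det_joint_eq_zero_iff [Field K] (A B : Matrix (Fin 3) (Fin 4) K) {u v : Fin 3 → K}
    (hu : u ≠ 0) (hv : v ≠ 0) :
    (joint A B u v).det = 0 ↔
      ∃ z : Fin 4 → K, z ≠ 0 ∧ (∃ a : K, a • u = A *ᵥ z) ∧ ∃ b : K, b • v = B *ᵥ z := by
  rw [← Matrix.exists_mulVec_eq_zero_iff]
  constructor
  · rintro ⟨w, hw, h⟩
    obtain ⟨z, a, b, rfl⟩ : ∃ (z : Fin 4 → K) (a b : K), w = ![z 0, z 1, z 2, z 3, a, b] := by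
      refine ⟨![w 0, w 1, w 2, w 3], w 4, w 5, ?_⟩
      ext i
      fin_cases i <;> rfl
    rw [joint_mulVec, funext_iff, Fin.forall_fin_add] at h
    simp only [Fin.append_left, Fin.append_right] at h
    have h₁ : A *ᵥ z + a • u = 0 := funext h.1
    have h₂ : B *ᵥ z + b • v = 0 := funext h.2
    refine ⟨z, ?_, ⟨-a, ?_⟩, -b, ?_⟩
    · rintro rfl
      apply hw
      obtain rfl : a = 0 := by simpa [hu] using h₁
      obtain rfl : b = 0 := by simpa [hv] using h₂
      simp
    · rw [neg_smul, ← eq_neg_of_add_eq_zero_left h₁]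
    · rw [neg_smul, ← eq_neg_of_add_eq_zero_left h₂]
  · rintro ⟨z, hz, ⟨a, ha⟩, b, hb⟩
    refine ⟨![z 0, z 1, z 2, z 3, -a, -b], ?_, ?_⟩
    · contrapose! hz
      ext i
      fin_cases i
      exacts [congrFun hz 0, congrFun hz 1, congrFun hz 2, congrFun hz 3]
    · rw [joint_mulVec, ← ha, ← hb]
      ext i
      refine Fin.addCases (m := 3) (n := 3) (fun i => ?_) (fun i => ?_) i <;>
        simp only [Fin.append_left, Fin.append_right, neg_smul, add_neg_cancel, Pi.zero_apply]

end Joint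

section

variable (P : CameraPair)

lemma CameraPair.fundamentalMatrix_eq_toMatrix₂' :
    P.fundamentalMatrix = LinearMap.toMatrix₂' ℝ (jointForm P.fst.mat P.snd.mat) := by
  ext i j
  rw [LinearMap.toMatrix₂'_apply, jointForm_apply, CameraPair.fundamentalMatrix, Matrix.of_apply,
    CameraPair.jointMatrix, joint]

lemma CameraPair.dotProduct_fundamentalMatrix_mulVec (u v : Fin 3 → ℝ) :
    u ⬝ᵥ (P.fundamentalMatrix *ᵥ v) = (joint P.fst.mat P.snd.mat u v).det := by
  rw [← Matrix.toLinearMap₂'_apply', P.fundamentalMatrix_eq_toMatrix₂',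
    Matrix.toLinearMap₂'_toMatrix', jointForm_apply]

lemma CameraPair.cx_fundamentalMatrix :
    cx P.fundamentalMatrix = LinearMap.toMatrix₂' ℂ (jointForm (cx P.fst.mat) (cx P.snd.mat)) := by
  have hsingle (i : Fin 3) : ⇑(algebraMap ℝ ℂ) ∘ Pi.single i 1 = Pi.single i 1 := by
    ext j
    simp [Pi.single_apply, apply_ite]
  ext i j
  rw [cx, Matrix.map_apply, P.fundamentalMatrix_eq_toMatrix₂', LinearMap.toMatrix₂'_apply,
    LinearMap.toMatrix₂'_apply, jointForm_apply, jointForm_apply, RingHom.map_det,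
    RingHom.mapMatrix_apply, joint_map, hsingle, hsingle]

lemma CameraPair.dotProduct_cx_fundamentalMatrix_mulVec (u v : Fin 3 → ℂ) :
    u ⬝ᵥ (cx P.fundamentalMatrix *ᵥ v) = (joint (cx P.fst.mat) (cx P.snd.mat) u v).det := by
  rw [← Matrix.toLinearMap₂'_apply', P.cx_fundamentalMatrix, Matrix.toLinearMap₂'_toMatrix',
    jointForm_apply]

lemma CameraPair.exists_sees_mk_iff {u v : Fin 3 → ℂ} (hu : u ≠ 0) (hv : v ≠ 0) :
    (∃ x, P.Sees x (Projectivization.mk ℂ u hu, Projectivization.mk ℂ v hv)) ↔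
      u ⬝ᵥ (cx P.fundamentalMatrix *ᵥ v) = 0 := by
  rw [P.dotProduct_cx_fundamentalMatrix_mulVec, det_joint_eq_zero_iff _ _ hu hv]
  constructor
  · rintro ⟨x, h₁, h₂⟩
    induction x using Projectivization.ind with
    | h z hz => exact ⟨z, hz, (P.fst.sees_mk_mk_iff hz hu).1 h₁, (P.snd.sees_mk_mk_iff hz hv).1 h₂⟩
  · rintro ⟨z, hz, h₁, h₂⟩
    exact ⟨Projectivization.mk ℂ z hz, (P.fst.sees_mk_mk_iff hz hu).2 h₁,
      (P.snd.sees_mk_mk_iff hz hv).2 h₂⟩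

lemma CameraPair.eq_zero_of_cx_mulVec_eq_zero {z : Fin 4 → ℂ} (h₁ : cx P.fst.mat *ᵥ z = 0)
    (h₂ : cx P.snd.mat *ᵥ z = 0) : z = 0 := by
  by_contra hz
  exact P.center_ne ((P.fst.center_eq_mk hz h₁).trans (P.snd.center_eq_mk hz h₂).symm)

lemma CameraPair.eq_zero_of_mulVec_eq_zero {z : Fin 4 → ℝ} (h₁ : P.fst.mat *ᵥ z = 0)
    (h₂ : P.snd.mat *ᵥ z = 0) : z = 0 := by
  rw [← cxVec_eq_zero_iff] at h₁ h₂ ⊢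
  rw [← cx_mulVec_cxVec] at h₁ h₂
  exact P.eq_zero_of_cx_mulVec_eq_zero h₁ h₂

end

/-! ### The set of critical points is a quadric -/

section

variable {K m n : Type*} [Field K] [Fintype n]

lemma exists_ne_zero_dotProduct_mulVec_eq_zero [Fintype m] [Nontrivial m] [Nontrivial n]
    (M : Matrix m n K) {a : m → K} {b : n → K} (h : a ⬝ᵥ (M *ᵥ b) = 0) (hab : a ≠ 0 ∨ b ≠ 0) :
    ∃ u v, u ≠ 0 ∧ v ≠ 0 ∧ (∃ s : K, s • u = a) ∧ (∃ t : K, t • v = b) ∧ u ⬝ᵥ (M *ᵥ v) = 0 := by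
  by_cases ha : a = 0
  · obtain ⟨u, hu, huv⟩ := exists_ne_zero_dotProduct_eq_zero (M *ᵥ b)
    exact ⟨u, b, hu, hab.resolve_left (not_not_intro ha), ⟨0, by simp [ha]⟩, ⟨1, one_smul _ _⟩, huv⟩
  by_cases hb : b = 0
  · obtain ⟨v, hv, huv⟩ := exists_ne_zero_dotProduct_eq_zero (a ᵥ* M)
    refine ⟨a, v, ha, hv, ⟨1, one_smul _ _⟩, ⟨0, by simp [hb]⟩, ?_⟩
    rwa [Matrix.dotProduct_mulVec, dotProduct_comm]
  · exact ⟨a, b, ha, hb, ⟨1, one_smul _ _⟩, ⟨1, one_smul _ _⟩, h⟩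

lemma dotProduct_add_transpose_mulVec (M : Matrix n n K) (z : n → K) :
    z ⬝ᵥ ((M + Mᵀ) *ᵥ z) = 2 * (z ⬝ᵥ (M *ᵥ z)) := by
  rw [Matrix.add_mulVec, dotProduct_add, Matrix.dotProduct_transpose_mulVec, two_mul]

lemma dotProduct_transpose_mul_mul_mulVec {k l : Type*} [Fintype k] [Fintype l]
    (A : Matrix k n K) (F : Matrix k l K) (B : Matrix l n K) (z : n → K) :
    z ⬝ᵥ ((Aᵀ * F * B) *ᵥ z) = (A *ᵥ z) ⬝ᵥ (F *ᵥ (B *ᵥ z)) := by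
  rw [← Matrix.mulVec_mulVec, ← Matrix.mulVec_mulVec, Matrix.dotProduct_mulVec,
    Matrix.vecMul_transpose]

end

/-- Twice the symmetric matrix of the quadratic form `z ↦ (P₁ z)ᵀ F (P₂ z)`. -/
def CameraPair.quadMat (P : CameraPair) (F : Matrix (Fin 3) (Fin 3) ℝ) : Matrix (Fin 4) (Fin 4) ℝ :=
  P.fst.matᵀ * F * P.snd.mat + (P.fst.matᵀ * F * P.snd.mat)ᵀ

namespace CameraPair

variable (P Q : CameraPair) (F G : Matrix (Fin 3) (Fin 3) ℝ)

lemma isSymm_quadMat : (P.quadMat F).IsSymm :=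
  Matrix.isSymm_add_transpose_self _

lemma quadMat_smul (c : ℝ) : P.quadMat (c • F) = c • P.quadMat F := by
  simp [quadMat]

lemma quadMat_add : P.quadMat (F + G) = P.quadMat F + P.quadMat G := by
  simp only [quadMat, Matrix.mul_add, Matrix.add_mul, Matrix.transpose_add]
  abel

lemma dotProduct_quadMat_mulVec (z : Fin 4 → ℝ) :
    z ⬝ᵥ (P.quadMat F *ᵥ z) = 2 * ((P.fst.mat *ᵥ z) ⬝ᵥ (F *ᵥ (P.snd.mat *ᵥ z))) := by
  rw [quadMat, dotProduct_add_transpose_mulVec, dotProduct_transpose_mul_mul_mulVec]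

lemma dotProduct_cx_quadMat_mulVec (z : Fin 4 → ℂ) :
    z ⬝ᵥ (cx (P.quadMat F) *ᵥ z) =
      2 * ((cx P.fst.mat *ᵥ z) ⬝ᵥ (cx F *ᵥ (cx P.snd.mat *ᵥ z))) := by
  rw [quadMat, cx_add, cx, cx, Matrix.transpose_map, dotProduct_add_transpose_mulVec, ← cx, cx_mul,
    cx_mul, cx, Matrix.transpose_map, dotProduct_transpose_mul_mul_mulVec]

lemma quadMat_fundamentalMatrix : P.quadMat P.fundamentalMatrix = 0 := by
  apply Matrix.toBilin'.injective
  refine LinearMap.BilinForm.ext_of_isSymm ?_ ?_ fun z => ?_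
  · exact (Matrix.isSymm_toBilin'_iff_isSymm).2 (P.isSymm_quadMat _)
  · exact (Matrix.isSymm_toBilin'_iff_isSymm).2 Matrix.isSymm_zero
  rw [Matrix.toBilin'_apply', dotProduct_quadMat_mulVec, map_zero]
  by_cases h₁ : P.fst.mat *ᵥ z = 0
  · simp [h₁]
  by_cases h₂ : P.snd.mat *ᵥ z = 0
  · simp [h₂]
  have hz : z ≠ 0 := by
    rintro rfl
    exact h₁ (Matrix.mulVec_zero _)
  rw [dotProduct_fundamentalMatrix_mulVec, (det_joint_eq_zero_iff _ _ h₁ h₂).2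
    ⟨z, hz, ⟨1, one_smul _ _⟩, 1, one_smul _ _⟩]
  simp

lemma mk_mem_criticalPoints_iff {z : Fin 4 → ℂ} (hz : z ≠ 0) :
    Projectivization.mk ℂ z hz ∈ criticalPoints P Q ↔
      z ⬝ᵥ (cx (P.quadMat Q.fundamentalMatrix) *ᵥ z) = 0 := by
  rw [dotProduct_cx_quadMat_mulVec, mul_eq_zero_iff_left two_ne_zero]
  constructor
  · rintro ⟨y, ⟨s, t⟩, ⟨hs, ht⟩, hy⟩
    induction s using Projectivization.ind with | h u hu => ?_
    induction t using Projectivization.ind with | h v hv => ?_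
    obtain ⟨a, ha⟩ := (P.fst.sees_mk_mk_iff hz hu).1 hs
    obtain ⟨b, hb⟩ := (P.snd.sees_mk_mk_iff hz hv).1 ht
    rw [← ha, ← hb, Matrix.mulVec_smul, smul_dotProduct, dotProduct_smul,
      (Q.exists_sees_mk_iff hu hv).1 ⟨y, hy⟩, smul_zero, smul_zero]
  · intro h
    have hne : cx P.fst.mat *ᵥ z ≠ 0 ∨ cx P.snd.mat *ᵥ z ≠ 0 := by
      contrapose! hz
      exact P.eq_zero_of_cx_mulVec_eq_zero hz.1 hz.2
    obtain ⟨u, v, hu, hv, ha, hb, huv⟩ := exists_ne_zero_dotProduct_mulVec_eq_zero _ h hne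
    obtain ⟨y, hy⟩ := (Q.exists_sees_mk_iff hu hv).2 huv
    exact ⟨y, _, ⟨(P.fst.sees_mk_mk_iff hz hu).2 ha, (P.snd.sees_mk_mk_iff hz hv).2 hb⟩, hy⟩

end CameraPair

/-! ### A quadric is determined by its complex points -/

lemma exists_eq_smul_of_dotProduct_eq_zero_imp {K n : Type*} [Field K] [Fintype n]
    {m m' : n → K} (h : ∀ z, m ⬝ᵥ z = 0 → m' ⬝ᵥ z = 0) : ∃ c : K, m' = c • m := by
  classical
  have hker : ⨅ _ : Unit, LinearMap.ker (dotProductEquiv K n m) ≤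
      LinearMap.ker (dotProductEquiv K n m') := by
    rw [iInf_const]
    exact h
  have hspan := mem_span_of_iInf_ker_le_ker hker
  rw [Set.range_const, Submodule.mem_span_singleton] at hspan
  obtain ⟨c, hc⟩ := hspan
  exact ⟨c, (dotProductEquiv K n).injective (by rw [map_smul, hc])⟩

lemma cx_vecMulVec {m n : Type*} (u : m → ℝ) (v : n → ℝ) :
    cx (Matrix.vecMulVec u v) = Matrix.vecMulVec (cxVec u) (cxVec v) := by
  ext i j
  simp [Matrix.vecMulVec_apply, cxVec]

lemma exists_eq_smul_of_cx_eq_smul {m n : Type*} {A B : Matrix m n ℝ} (hB : B ≠ 0) {c : ℂ}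
    (h : cx B = c • cx A) : ∃ r : ℝ, r ≠ 0 ∧ B = r • A := by
  have hre : B = c.re • A := by
    ext i j
    simpa using congrArg Complex.re (congrFun (congrFun h i) j)
  refine ⟨c.re, ?_, hre⟩
  rintro h0
  exact hB (by rw [hre, h0, zero_smul])

namespace Quadric

/-- The complex bilinear form of a quadric. -/
def form (S : Quadric) : LinearMap.BilinForm ℂ (Fin 4 → ℂ) :=
  (cx S.mat).toBilin'

variable {S S' : Quadric}

lemma form_apply (v w : Fin 4 → ℂ) : S.form v w = v ⬝ᵥ (cx S.mat *ᵥ w) :=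
  Matrix.toBilin'_apply' _ _ _

lemma form_cxVec (v w : Fin 4 → ℝ) : S.form (cxVec v) (cxVec w) = (v ⬝ᵥ (S.mat *ᵥ w) : ℝ) := by
  rw [form_apply, cx_mulVec_cxVec, cxVec_dotProduct_cxVec]

lemma isSymm_form : S.form.IsSymm :=
  Matrix.isSymm_toBilin'_iff_isSymm.2 (isSymm_cx S.symm)

lemma apply_self_eq_zero_of_points_subset (h : S.points ⊆ S'.points) {z : Fin 4 → ℂ}
    (hz : S.form z z = 0) : S'.form z z = 0 := by
  rcases eq_or_ne z 0 with rfl | h0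
  · rw [map_zero]
  · rw [form_apply] at hz ⊢
    exact (S'.mk_mem_points h0).1 (h ((S.mk_mem_points h0).2 hz))

lemma exists_mat_eq_smul_of_isotropic (h : S.points ⊆ S'.points) {v : Fin 4 → ℂ}
    (hv : S.form v v = 0) (hne : S.form v ≠ 0) : ∃ r : ℝ, r ≠ 0 ∧ S'.mat = r • S.mat := by
  obtain ⟨w, hw, hvw⟩ := exists_isotropic_apply_eq_one isSymm_form hv hne
  have := eq_smul_of_isotropic_imp_of_hyperbolic isSymm_form isSymm_form
    (fun z => apply_self_eq_zero_of_points_subset h) hv hw hvw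
  rw [form, form, ← map_smul] at this
  exact exists_eq_smul_of_cx_eq_smul S'.ne_zero (Matrix.toBilin'.injective this)

lemma exists_dotProduct_mulVec_self_ne_zero (S : Quadric) : ∃ a, a ⬝ᵥ (S.mat *ᵥ a) ≠ 0 := by
  obtain ⟨a, ha⟩ := LinearMap.BilinForm.exists_bilinForm_self_ne_zero
    (B := S.mat.toBilin') (by simpa using S.ne_zero)
    ⟨(Matrix.isSymm_toBilin'_iff_isSymm.2 S.symm).eq⟩
  exact ⟨a, by rwa [Matrix.toBilin'_apply'] at ha⟩

lemma exists_mat_eq_smul_vecMulVec (hker : ∀ v, S.form v v = 0 → S.form v = 0) :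
    ∃ (c : ℝ) (m : Fin 4 → ℝ), S.mat = c • Matrix.vecMulVec m m := by
  obtain ⟨a, ha⟩ := S.exists_dotProduct_mulVec_self_ne_zero
  have haC : S.form (cxVec a) (cxVec a) ≠ 0 := by
    rw [form_cxVec]
    exact_mod_cast ha
  set r := a ⬝ᵥ (S.mat *ᵥ a)
  refine ⟨r⁻¹, S.mat *ᵥ a, ?_⟩
  rw [eq_inv_smul_iff₀ ha]
  apply cx_injective
  apply Matrix.toBilin'.injective
  refine LinearMap.BilinForm.ext_of_isSymm ?_ ?_ fun z => ?_
  · exact Matrix.isSymm_toBilin'_iff_isSymm.2 (isSymm_cx (S.symm.smul r))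
  · exact Matrix.isSymm_toBilin'_iff_isSymm.2 (isSymm_cx (Matrix.transpose_vecMulVec _ _))
  have hsq := apply_self_mul_apply_self_eq_sq isSymm_form hker haC z
  rw [form_cxVec, isSymm_form.eq (cxVec a) z, form_apply, form_apply, cx_mulVec_cxVec] at hsq
  rw [Matrix.toBilin'_apply', Matrix.toBilin'_apply', cx_smul, cx_vecMulVec, Matrix.smul_mulVec,
    dotProduct_smul, Matrix.vecMulVec_mulVec, op_smul_eq_smul, dotProduct_smul,
    dotProduct_comm (cxVec _) z, smul_eq_mul, smul_eq_mul, hsq, sq]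

lemma exists_mat_eq_smul_of_points_subset (hS : 2 ≤ S.mat.rank) (h : S.points ⊆ S'.points) :
    ∃ r : ℝ, r ≠ 0 ∧ S'.mat = r • S.mat := by
  by_cases hker : ∀ v, S.form v v = 0 → S.form v = 0
  · obtain ⟨c, m, hm⟩ := exists_mat_eq_smul_vecMulVec hker
    rw [hm, ← Matrix.smul_vecMulVec] at hS
    exact absurd (Matrix.rank_vecMulVec_le (c • m) m) (by lia)
  · push Not at hker
    obtain ⟨v, hv, hne⟩ := hker
    exact exists_mat_eq_smul_of_isotropic h hv hne

lemma exists_mat_eq_smul_of_eq_vecMulVec {c c' : ℝ} {m m' : Fin 4 → ℝ}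
    (h : S.points = S'.points) (hS : S.mat = c • Matrix.vecMulVec m m)
    (hS' : S'.mat = c' • Matrix.vecMulVec m' m') : ∃ r : ℝ, r ≠ 0 ∧ S'.mat = r • S.mat := by
  have hval {T : Quadric} {d : ℝ} {l : Fin 4 → ℝ} (hT : T.mat = d • Matrix.vecMulVec l l)
      (z : Fin 4 → ℝ) : T.form (cxVec z) (cxVec z) = 0 ↔ l ⬝ᵥ z = 0 := by
    have hd : d ≠ 0 := by
      rintro rfl
      exact T.ne_zero (by rw [hT, zero_smul])
    rw [form_cxVec, hT, Matrix.smul_mulVec, Matrix.vecMulVec_mulVec, op_smul_eq_smul,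
      dotProduct_smul, dotProduct_smul, dotProduct_comm z]
    simp [hd]
  obtain ⟨k, rfl⟩ := exists_eq_smul_of_dotProduct_eq_zero_imp (m := m) (m' := m') fun z hz =>
    (hval hS' z).1 (apply_self_eq_zero_of_points_subset h.le ((hval hS z).2 hz))
  have hc : c ≠ 0 := by
    rintro rfl
    exact S.ne_zero (by rw [hS, zero_smul])
  have hmul : S'.mat = (c' * k ^ 2 / c) • S.mat := by
    rw [hS', hS, Matrix.smul_vecMulVec, Matrix.vecMulVec_smul, smul_smul, smul_smul, smul_smul,
      div_mul_cancel₀ _ hc]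
    ring_nf
  refine ⟨c' * k ^ 2 / c, ?_, hmul⟩
  rintro h0
  exact S'.ne_zero (by rw [hmul, h0, zero_smul])

lemma exists_mat_eq_smul_of_points_eq (h : S.points = S'.points) :
    ∃ r : ℝ, r ≠ 0 ∧ S'.mat = r • S.mat := by
  by_cases hker : ∀ v, S.form v v = 0 → S.form v = 0
  · by_cases hker' : ∀ v, S'.form v v = 0 → S'.form v = 0
    · obtain ⟨c, m, hm⟩ := exists_mat_eq_smul_vecMulVec hker
      obtain ⟨c', m', hm'⟩ := exists_mat_eq_smul_vecMulVec hker'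
      exact exists_mat_eq_smul_of_eq_vecMulVec h hm hm'
    · push Not at hker'
      obtain ⟨v, hv, hne⟩ := hker'
      obtain ⟨r, hr, hSr⟩ := exists_mat_eq_smul_of_isotropic h.ge hv hne
      exact ⟨r⁻¹, inv_ne_zero hr, by rw [hSr, inv_smul_smul₀ hr]⟩
  · push Not at hker
    obtain ⟨v, hv, hne⟩ := hker
    exact exists_mat_eq_smul_of_isotropic h.le hv hne

lemma points_eq_of_mat_eq_smul {r : ℝ} (hr : r ≠ 0) (h : S'.mat = r • S.mat) :
    S'.points = S.points := by
  ext x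
  simp only [points, Set.mem_ofPred_eq, h, cx_smul, Matrix.smul_mulVec, dotProduct_smul,
    smul_eq_mul, mul_eq_zero, Complex.ofReal_eq_zero, hr, false_or]

end Quadric

/-! ### Coordinates adapted to a pair of cameras -/

lemma mul_mul_bijective {K m n : Type*} [CommRing K] [Fintype m] [DecidableEq m] [Fintype n]
    [DecidableEq n] {A : Matrix m m K} {B : Matrix n n K} (hA : IsUnit A.det) (hB : IsUnit B.det) :
    Function.Bijective fun M : Matrix m n K => A * M * B := by
  refine Function.bijective_iff_has_inverse.2 ⟨fun M => A⁻¹ * M * B⁻¹, fun M => ?_, fun M => ?_⟩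
  · simp only [Matrix.mul_assoc, Matrix.mul_nonsing_inv _ hB, Matrix.mul_one,
      Matrix.nonsing_inv_mul_cancel_left _ _ hA]
  · simp only [Matrix.mul_assoc, Matrix.nonsing_inv_mul _ hB, Matrix.mul_one,
      Matrix.mul_nonsing_inv_cancel_left _ _ hA]

lemma mulVec_bijective {K n : Type*} [CommRing K] [Fintype n] [DecidableEq n] {A : Matrix n n K}
    (hA : IsUnit A.det) : Function.Bijective A.mulVec := by
  refine Function.bijective_iff_has_inverse.2 ⟨A⁻¹.mulVec, fun v => ?_, fun v => ?_⟩
  · rw [Matrix.mulVec_mulVec, Matrix.nonsing_inv_mul _ hA, Matrix.one_mulVec]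
  · rw [Matrix.mulVec_mulVec, Matrix.mul_nonsing_inv _ hA, Matrix.one_mulVec]

lemma Camera.exists_mulVec_eq_zero (C : Camera) : ∃ p : Fin 4 → ℝ, p ≠ 0 ∧ C.mat *ᵥ p = 0 := by
  have hker : LinearMap.ker C.mat.mulVecLin ≠ ⊥ := LinearMap.ker_ne_bot_of_finrank_lt (by simp)
  obtain ⟨p, hp, h0⟩ := (Submodule.ne_bot_iff _).1 hker
  exact ⟨p, h0, hp⟩

lemma Camera.isUnit_det_of_mul_eq_mul (C : Camera) {K : Matrix (Fin 4) (Fin 4) ℝ}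
    (hK : IsUnit K.det) {A : Matrix (Fin 3) (Fin 3) ℝ} {N : Matrix (Fin 3) (Fin 4) ℝ}
    (h : C.mat * K = A * N) : IsUnit A.det := by
  obtain ⟨R, hR⟩ := C.exists_right_inverse
  refine Matrix.isUnit_det_of_right_inverse (B := N * K⁻¹ * R) ?_
  rw [← Matrix.mul_assoc, ← Matrix.mul_assoc, ← h, Matrix.mul_nonsing_inv_cancel_right _ _ hK, hR]

/-- The projection to the first three coordinates: the first camera in adapted coordinates. -/
def stdFst : Matrix (Fin 3) (Fin 4) ℝ := !![1, 0, 0, 0; 0, 1, 0, 0; 0, 0, 1, 0]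

/-- The projection to the first, second and fourth coordinate: the second camera in adapted
coordinates. -/
def stdSnd : Matrix (Fin 3) (Fin 4) ℝ := !![1, 0, 0, 0; 0, 1, 0, 0; 0, 0, 0, 1]

/-- The fundamental matrix, up to scale, of the two standard projections. -/
def stdFund : Matrix (Fin 3) (Fin 3) ℝ := !![0, 1, 0; -1, 0, 0; 0, 0, 0]

/-- The matrix `CameraPair.quadMat F` for the two standard projections. -/
def stdQuad (F : Matrix (Fin 3) (Fin 3) ℝ) : Matrix (Fin 4) (Fin 4) ℝ :=
  !![2 * F 0 0, F 0 1 + F 1 0, F 2 0, F 0 2;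
     F 0 1 + F 1 0, 2 * F 1 1, F 2 1, F 1 2;
     F 2 0, F 2 1, 0, F 2 2;
     F 0 2, F 1 2, F 2 2, 0]

lemma mul_transpose_stdFst_mul_stdFst {B : Matrix (Fin 3) (Fin 4) ℝ} (h : B.col 3 = 0) :
    B * stdFstᵀ * stdFst = B := by
  ext i j
  have hi := congrFun h i
  fin_cases j <;> simp_all [Matrix.mul_apply, Fin.sum_univ_succ, stdFst]

lemma mul_transpose_stdSnd_mul_stdSnd {B : Matrix (Fin 3) (Fin 4) ℝ} (h : B.col 2 = 0) :
    B * stdSndᵀ * stdSnd = B := by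
  ext i j
  have hi := congrFun h i
  fin_cases j <;> simp_all [Matrix.mul_apply, Fin.sum_univ_succ, stdSnd]

lemma stdFst_mulVec (w : Fin 4 → ℝ) : stdFst *ᵥ w = ![w 0, w 1, w 2] := by
  simp [stdFst, dotProduct, Fin.sum_univ_succ]

lemma stdSnd_mulVec (w : Fin 4 → ℝ) : stdSnd *ᵥ w = ![w 0, w 1, w 3] := by
  simp [stdSnd, dotProduct, Fin.sum_univ_succ]

lemma stdFst_mulVec_single : stdFst *ᵥ Pi.single 3 1 = 0 := by
  rw [stdFst_mulVec]
  simp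

lemma stdSnd_mulVec_single : stdSnd *ᵥ Pi.single 2 1 = 0 := by
  rw [stdSnd_mulVec]
  simp

lemma add_transpose_eq_stdQuad (F : Matrix (Fin 3) (Fin 3) ℝ) :
    stdFstᵀ * F * stdSnd + (stdFstᵀ * F * stdSnd)ᵀ = stdQuad F := by
  ext i j
  fin_cases i <;> fin_cases j <;>
    simp [Matrix.mul_apply, Fin.sum_univ_succ, stdFst, stdSnd, stdQuad] <;> ring

lemma eq_smul_stdFund_of_stdQuad_eq_zero {F : Matrix (Fin 3) (Fin 3) ℝ} (h : stdQuad F = 0) :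
    F = F 0 1 • stdFund := by
  have hentry (i j) : stdQuad F i j = 0 := by rw [h, Matrix.zero_apply]
  have h00 := hentry 0 0
  have h01 := hentry 0 1
  have h11 := hentry 1 1
  have h02 := hentry 0 2
  have h12 := hentry 1 2
  have h03 := hentry 0 3
  have h13 := hentry 1 3
  have h23 := hentry 2 3
  simp only [stdQuad, Matrix.of_apply, Matrix.cons_val, mul_eq_zero, two_ne_zero, false_or] at *
  ext i j
  fin_cases i <;> fin_cases j <;> simp [stdFund, *]
  linarith

/-- Space and image coordinates in which the cameras become the standard projections. -/
structure CameraPair.Frame (P : CameraPair) where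
  space : Matrix (Fin 4) (Fin 4) ℝ
  left : Matrix (Fin 3) (Fin 3) ℝ
  right : Matrix (Fin 3) (Fin 3) ℝ
  isUnit_space : IsUnit space.det
  isUnit_left : IsUnit left.det
  isUnit_right : IsUnit right.det
  fst_mul : P.fst.mat * space = left * stdFst
  snd_mul : P.snd.mat * space = right * stdSnd

lemma CameraPair.linearIndependent_of_mulVec_eq_zero (P : CameraPair) {p q : Fin 4 → ℝ}
    (hp0 : p ≠ 0) (hp : P.fst.mat *ᵥ p = 0) (hq0 : q ≠ 0) (hq : P.snd.mat *ᵥ q = 0) :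
    LinearIndependent ℝ ![q, p] := by
  rw [LinearIndependent.pair_iff' hq0]
  rintro a rfl
  refine hp0 (P.eq_zero_of_mulVec_eq_zero hp ?_)
  rw [Matrix.mulVec_smul, hq, smul_zero]

lemma CameraPair.nonempty_frame (P : CameraPair) : Nonempty P.Frame := by
  obtain ⟨p, hp0, hp⟩ := P.fst.exists_mulVec_eq_zero
  obtain ⟨q, hq0, hq⟩ := P.snd.exists_mulVec_eq_zero
  obtain ⟨R, hR, hR₂, hR₃⟩ := exists_isUnit_det_of_linearIndependent
    (P.linearIndependent_of_mulVec_eq_zero hp0 hp hq0 hq)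
  replace hR := Matrix.isUnit_det_transpose _ hR
  have hfst := mul_transpose_stdFst_mul_stdFst (B := P.fst.mat * Rᵀ) (by
    rw [← hp, ← hR₃]; rfl)
  have hsnd := mul_transpose_stdSnd_mul_stdSnd (B := P.snd.mat * Rᵀ) (by
    rw [← hq, ← hR₂]; rfl)
  exact ⟨⟨Rᵀ, _, _, hR, P.fst.isUnit_det_of_mul_eq_mul hR hfst.symm,
    P.snd.isUnit_det_of_mul_eq_mul hR hsnd.symm, hfst.symm, hsnd.symm⟩⟩

namespace CameraPair.Frame

variable {P : CameraPair} (φ : P.Frame)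

/-- The matrix of the bilinear form `F` in the image coordinates of the frame. -/
def pull (F : Matrix (Fin 3) (Fin 3) ℝ) : Matrix (Fin 3) (Fin 3) ℝ := φ.leftᵀ * F * φ.right

/-- The matrix of the quadratic form `S` in the space coordinates of the frame. -/
def pullQuad (S : Matrix (Fin 4) (Fin 4) ℝ) : Matrix (Fin 4) (Fin 4) ℝ := φ.spaceᵀ * S * φ.space

lemma pull_bijective : Function.Bijective φ.pull :=
  mul_mul_bijective (Matrix.isUnit_det_transpose _ φ.isUnit_left) φ.isUnit_right

lemma pullQuad_bijective : Function.Bijective φ.pullQuad :=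
  mul_mul_bijective (Matrix.isUnit_det_transpose _ φ.isUnit_space) φ.isUnit_space

lemma pull_zero : φ.pull 0 = 0 := by
  rw [pull, Matrix.mul_zero, Matrix.zero_mul]

lemma pullQuad_zero : φ.pullQuad 0 = 0 := by
  rw [pullQuad, Matrix.mul_zero, Matrix.zero_mul]

lemma pull_smul (c : ℝ) (F : Matrix (Fin 3) (Fin 3) ℝ) : φ.pull (c • F) = c • φ.pull F := by
  rw [pull, Matrix.mul_smul, Matrix.smul_mul, pull]

lemma rank_pullQuad (S : Matrix (Fin 4) (Fin 4) ℝ) : (φ.pullQuad S).rank = S.rank := by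
  rw [pullQuad, Matrix.rank_mul_eq_left_of_isUnit_det _ _ φ.isUnit_space,
    Matrix.rank_mul_eq_right_of_isUnit_det _ _ (Matrix.isUnit_det_transpose _ φ.isUnit_space)]

lemma pullQuad_quadMat (F : Matrix (Fin 3) (Fin 3) ℝ) :
    φ.pullQuad (P.quadMat F) = stdQuad (φ.pull F) := by
  have h : φ.spaceᵀ * (P.fst.matᵀ * F * P.snd.mat) * φ.space = stdFstᵀ * φ.pull F * stdSnd :=
    calc φ.spaceᵀ * (P.fst.matᵀ * F * P.snd.mat) * φ.space
      _ = (P.fst.mat * φ.space)ᵀ * F * (P.snd.mat * φ.space) := by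
          simp only [Matrix.transpose_mul, Matrix.mul_assoc]
      _ = stdFstᵀ * φ.pull F * stdSnd := by
          rw [φ.fst_mul, φ.snd_mul, pull]
          simp only [Matrix.transpose_mul, Matrix.mul_assoc]
  rw [pullQuad, CameraPair.quadMat, Matrix.mul_add, Matrix.add_mul, h,
    ← add_transpose_eq_stdQuad, ← h]
  simp only [Matrix.transpose_mul, Matrix.mul_assoc, Matrix.transpose_transpose]

end CameraPair.Frame

lemma CameraPair.fundamentalMatrix_ne_zero (P : CameraPair) : P.fundamentalMatrix ≠ 0 := by
  intro h
  obtain ⟨φ⟩ := P.nonempty_frame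
  have hleft := (mulVec_bijective φ.isUnit_left).injective
  have hright := (mulVec_bijective φ.isUnit_right).injective
  have hu : φ.left *ᵥ Pi.single 0 1 ≠ 0 := by
    rw [← Matrix.mulVec_zero φ.left]
    exact hleft.ne (by simp)
  have hv : φ.right *ᵥ Pi.single 1 1 ≠ 0 := by
    rw [← Matrix.mulVec_zero φ.right]
    exact hright.ne (by simp)
  obtain ⟨z, hz, ⟨a, ha⟩, b, hb⟩ := (det_joint_eq_zero_iff P.fst.mat P.snd.mat hu hv).1 (by
    rw [← P.dotProduct_fundamentalMatrix_mulVec, h, Matrix.zero_mulVec, dotProduct_zero])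
  obtain ⟨w, rfl⟩ := (mulVec_bijective φ.isUnit_space).surjective z
  rw [Matrix.mulVec_mulVec, φ.fst_mul, ← Matrix.mulVec_mulVec, ← Matrix.mulVec_smul,
    stdFst_mulVec] at ha
  rw [Matrix.mulVec_mulVec, φ.snd_mul, ← Matrix.mulVec_mulVec, ← Matrix.mulVec_smul,
    stdSnd_mulVec] at hb
  have h₁ : w 1 = 0 := by simpa using (congrFun (hleft ha) 1).symm
  have h₂ : w 2 = 0 := by simpa using (congrFun (hleft ha) 2).symm
  have h₀ : w 0 = 0 := by simpa using (congrFun (hright hb) 0).symm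
  have h₃ : w 3 = 0 := by simpa using (congrFun (hright hb) 2).symm
  have hw : w = 0 := by
    funext i
    fin_cases i <;> assumption
  exact hz (by rw [hw, Matrix.mulVec_zero])

lemma CameraPair.Frame.exists_pull_fundamentalMatrix_eq_smul {P : CameraPair} (φ : P.Frame) :
    ∃ c : ℝ, c ≠ 0 ∧ φ.pull P.fundamentalMatrix = c • stdFund := by
  have h : stdQuad (φ.pull P.fundamentalMatrix) = 0 := by
    rw [← φ.pullQuad_quadMat, P.quadMat_fundamentalMatrix, φ.pullQuad_zero]
  refine ⟨_, fun h0 => P.fundamentalMatrix_ne_zero (φ.pull_bijective.injective ?_),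
    eq_smul_stdFund_of_stdQuad_eq_zero h⟩
  rw [eq_smul_stdFund_of_stdQuad_eq_zero h, h0, zero_smul, φ.pull_zero]

lemma CameraPair.exists_frame (P : CameraPair) :
    ∃ φ : P.Frame, φ.pull P.fundamentalMatrix = stdFund := by
  obtain ⟨φ⟩ := P.nonempty_frame
  obtain ⟨c, hc, h⟩ := φ.exists_pull_fundamentalMatrix_eq_smul
  -- Rescaling the first coordinate by `c⁻¹` multiplies the entries `(0, 1)` and `(1, 0)` by `c⁻¹`.
  have hspace : IsUnit (Matrix.diagonal ![c⁻¹, 1, 1, 1]).det := by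
    simpa [Matrix.det_diagonal, Fin.prod_univ_succ] using hc
  have himage : IsUnit (Matrix.diagonal ![c⁻¹, 1, 1]).det := by
    simpa [Matrix.det_diagonal, Fin.prod_univ_succ] using hc
  refine ⟨⟨φ.space * Matrix.diagonal ![c⁻¹, 1, 1, 1], φ.left * Matrix.diagonal ![c⁻¹, 1, 1],
    φ.right * Matrix.diagonal ![c⁻¹, 1, 1], ?_, ?_, ?_, ?_, ?_⟩, ?_⟩
  · rw [Matrix.det_mul]
    exact φ.isUnit_space.mul hspace
  · rw [Matrix.det_mul]
    exact φ.isUnit_left.mul himage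
  · rw [Matrix.det_mul]
    exact φ.isUnit_right.mul himage
  · rw [← Matrix.mul_assoc, φ.fst_mul, Matrix.mul_assoc, Matrix.mul_assoc]
    congr 1
    ext i j
    fin_cases i <;> fin_cases j <;> simp [stdFst]
  · rw [← Matrix.mul_assoc, φ.snd_mul, Matrix.mul_assoc, Matrix.mul_assoc]
    congr 1
    ext i j
    fin_cases i <;> fin_cases j <;> simp [stdSnd]
  · have hpull : Matrix.diagonal ![c⁻¹, 1, 1] * φ.pull P.fundamentalMatrix *
        Matrix.diagonal ![c⁻¹, 1, 1] = stdFund := by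
      rw [h]
      ext i j
      fin_cases i <;> fin_cases j <;> simp [stdFund, hc]
    rw [← hpull]
    simp only [CameraPair.Frame.pull, Matrix.transpose_mul, Matrix.diagonal_transpose,
      Matrix.mul_assoc]

lemma CameraPair.quadMat_eq_zero_iff (P : CameraPair) (F : Matrix (Fin 3) (Fin 3) ℝ) :
    P.quadMat F = 0 ↔ ∃ c : ℝ, F = c • P.fundamentalMatrix := by
  constructor
  · intro h
    obtain ⟨φ, hφ⟩ := P.exists_frame
    have hquad : stdQuad (φ.pull F) = 0 := by rw [← φ.pullQuad_quadMat, h, φ.pullQuad_zero]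
    refine ⟨φ.pull F 0 1, φ.pull_bijective.injective ?_⟩
    rw [φ.pull_smul, hφ]
    exact eq_smul_stdFund_of_stdQuad_eq_zero hquad
  · rintro ⟨c, rfl⟩
    rw [P.quadMat_smul, P.quadMat_fundamentalMatrix, smul_zero]

/-! ### Camera centres on a quadric -/

lemma cxVec_ne_zero {n : Type*} {v : n → ℝ} (hv : v ≠ 0) : cxVec v ≠ 0 :=
  cxVec_eq_zero_iff.not.2 hv

lemma Camera.center_eq_mk_cxVec (C : Camera) {p : Fin 4 → ℝ} (hp : p ≠ 0) (h : C.mat *ᵥ p = 0) :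
    C.center = Projectivization.mk ℂ (cxVec p) (cxVec_ne_zero hp) := by
  refine C.center_eq_mk _ ?_
  rw [cx_mulVec_cxVec, h, cxVec_eq_zero_iff]

namespace Quadric

variable (S : Quadric) {p q : Fin 4 → ℝ} (hp : p ≠ 0) (hq : q ≠ 0)

lemma mk_cxVec_mem_points :
    Projectivization.mk ℂ (cxVec p) (cxVec_ne_zero hp) ∈ S.points ↔ p ⬝ᵥ (S.mat *ᵥ p) = 0 := by
  rw [S.mk_mem_points, cx_mulVec_cxVec, cxVec_dotProduct_cxVec, Complex.ofReal_eq_zero]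

lemma mk_cxVec_mem_singularLocus :
    Projectivization.mk ℂ (cxVec p) (cxVec_ne_zero hp) ∈ S.singularLocus ↔ S.mat *ᵥ p = 0 := by
  rw [S.mk_mem_singularLocus, cx_mulVec_cxVec, cxVec_eq_zero_iff]

lemma onCommonLine_mk_cxVec_iff (hSp : p ⬝ᵥ (S.mat *ᵥ p) = 0) (hSq : q ⬝ᵥ (S.mat *ᵥ q) = 0) :
    S.OnCommonLine (Projectivization.mk ℂ (cxVec p) (cxVec_ne_zero hp))
      (Projectivization.mk ℂ (cxVec q) (cxVec_ne_zero hq)) ↔ p ⬝ᵥ (S.mat *ᵥ q) = 0 := by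
  have hsymm : q ⬝ᵥ (S.mat *ᵥ p) = p ⬝ᵥ (S.mat *ᵥ q) := by
    rw [← Matrix.dotProduct_transpose_mulVec, S.symm]
  constructor
  · intro h
    by_cases hpq : p + q = 0
    · rw [eq_neg_of_add_eq_zero_right hpq, Matrix.mulVec_neg, dotProduct_neg, hSp, neg_zero]
    · have hmem : Projectivization.mk ℂ (cxVec (p + q)) (cxVec_ne_zero hpq) ∈ S.points :=
        h ((mk_mem_lineThrough _ _ _).2 ⟨1, 1, by funext i; simp [cxVec]⟩)
      rw [S.mk_cxVec_mem_points hpq, Matrix.mulVec_add, dotProduct_add, add_dotProduct,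
        add_dotProduct, hSp, hSq, hsymm] at hmem
      linarith
  · intro h x
    induction x using Projectivization.ind with
    | h v hv =>
      rw [mk_mem_lineThrough, S.mk_mem_points, ← form_apply]
      rintro ⟨a, b, rfl⟩
      simp only [map_add, map_smul, LinearMap.add_apply, LinearMap.smul_apply, form_cxVec, hSp, hSq,
        hsymm, h, Complex.ofReal_zero, smul_zero, add_zero]

lemma inCommonPlane_mk_cxVec {l m : Fin 4 → ℝ} (hl : l ≠ 0)
    (hS : S.mat = Matrix.vecMulVec l m + Matrix.vecMulVec m l) (hlp : l ⬝ᵥ p = 0)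
    (hlq : l ⬝ᵥ q = 0) :
    S.InCommonPlane (Projectivization.mk ℂ (cxVec p) (cxVec_ne_zero hp))
      (Projectivization.mk ℂ (cxVec q) (cxVec_ne_zero hq)) := by
  refine ⟨cxVec l, cxVec_ne_zero hl, fun x => ?_, ?_, ?_⟩
  · induction x using Projectivization.ind with
    | h v hv =>
      rw [mk_mem_plane, S.mk_mem_points, hS, cx_add, cx_vecMulVec, cx_vecMulVec, Matrix.add_mulVec,
        Matrix.vecMulVec_mulVec, Matrix.vecMulVec_mulVec, op_smul_eq_smul, op_smul_eq_smul,
        dotProduct_add, dotProduct_smul, dotProduct_smul, dotProduct_comm v (cxVec l)]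
      intro hlv
      rw [hlv, smul_zero, zero_smul, add_zero]
  · rw [mk_mem_plane, cxVec_dotProduct_cxVec, hlp, Complex.ofReal_zero]
  · rw [mk_mem_plane, cxVec_dotProduct_cxVec, hlq, Complex.ofReal_zero]

end Quadric

namespace CameraPair.Frame

variable {P : CameraPair} (φ : P.Frame) (S : Quadric)

lemma space_col_ne_zero (i : Fin 4) : φ.space.col i ≠ 0 := by
  rw [← Matrix.mulVec_single_one, ← Matrix.mulVec_zero φ.space]
  exact (mulVec_bijective φ.isUnit_space).injective.ne (by simp)

lemma center_fst :
    P.fst.center = Projectivization.mk ℂ _ (cxVec_ne_zero (φ.space_col_ne_zero 3)) := by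
  refine P.fst.center_eq_mk_cxVec (φ.space_col_ne_zero 3) ?_
  rw [← Matrix.mulVec_single_one, Matrix.mulVec_mulVec, φ.fst_mul, ← Matrix.mulVec_mulVec,
    stdFst_mulVec_single, Matrix.mulVec_zero]

lemma center_snd :
    P.snd.center = Projectivization.mk ℂ _ (cxVec_ne_zero (φ.space_col_ne_zero 2)) := by
  refine P.snd.center_eq_mk_cxVec (φ.space_col_ne_zero 2) ?_
  rw [← Matrix.mulVec_single_one, Matrix.mulVec_mulVec, φ.snd_mul, ← Matrix.mulVec_mulVec,
    stdSnd_mulVec_single, Matrix.mulVec_zero]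

lemma space_col_dotProduct_mulVec (S : Matrix (Fin 4) (Fin 4) ℝ) (i j : Fin 4) :
    φ.space.col i ⬝ᵥ (S *ᵥ φ.space.col j) = φ.pullQuad S i j := by
  rw [pullQuad, Matrix.mul_assoc, Matrix.mul_apply_eq_vecMul]
  rfl

lemma mulVec_space_col_eq_zero_iff (S : Matrix (Fin 4) (Fin 4) ℝ) (j : Fin 4) :
    S *ᵥ φ.space.col j = 0 ↔ (φ.pullQuad S).col j = 0 := by
  have htranspose := mulVec_bijective (Matrix.isUnit_det_transpose _ φ.isUnit_space)
  have hcol : (φ.pullQuad S).col j = φ.spaceᵀ *ᵥ (S *ᵥ φ.space.col j) := by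
    rw [← Matrix.mulVec_single_one, ← Matrix.mulVec_single_one, pullQuad,
      Matrix.mulVec_mulVec, Matrix.mulVec_mulVec, Matrix.mul_assoc]
  rw [hcol, htranspose.injective.eq_iff' (Matrix.mulVec_zero _)]

lemma center_fst_mem_points : P.fst.center ∈ S.points ↔ φ.pullQuad S.mat 3 3 = 0 := by
  rw [φ.center_fst, S.mk_cxVec_mem_points (φ.space_col_ne_zero 3),
    φ.space_col_dotProduct_mulVec]

lemma center_snd_mem_points : P.snd.center ∈ S.points ↔ φ.pullQuad S.mat 2 2 = 0 := by
  rw [φ.center_snd, S.mk_cxVec_mem_points (φ.space_col_ne_zero 2),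
    φ.space_col_dotProduct_mulVec]

lemma center_fst_mem_singularLocus :
    P.fst.center ∈ S.singularLocus ↔ (φ.pullQuad S.mat).col 3 = 0 := by
  rw [φ.center_fst, S.mk_cxVec_mem_singularLocus (φ.space_col_ne_zero 3),
    φ.mulVec_space_col_eq_zero_iff]

lemma center_snd_mem_singularLocus :
    P.snd.center ∈ S.singularLocus ↔ (φ.pullQuad S.mat).col 2 = 0 := by
  rw [φ.center_snd, S.mk_cxVec_mem_singularLocus (φ.space_col_ne_zero 2),
    φ.mulVec_space_col_eq_zero_iff]

lemma onCommonLine_center_iff (h₁ : P.fst.center ∈ S.points) (h₂ : P.snd.center ∈ S.points) :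
    S.OnCommonLine P.fst.center P.snd.center ↔ φ.pullQuad S.mat 3 2 = 0 := by
  rw [φ.center_fst_mem_points, ← φ.space_col_dotProduct_mulVec] at h₁
  rw [φ.center_snd_mem_points, ← φ.space_col_dotProduct_mulVec] at h₂
  rw [φ.center_fst, φ.center_snd,
    S.onCommonLine_mk_cxVec_iff (φ.space_col_ne_zero 3) (φ.space_col_ne_zero 2) h₁ h₂,
    φ.space_col_dotProduct_mulVec]

lemma inCommonPlane_center {l m : Fin 4 → ℝ} (hl : l ≠ 0) (h₂ : l 2 = 0) (h₃ : l 3 = 0)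
    (h : φ.pullQuad S.mat = Matrix.vecMulVec l m + Matrix.vecMulVec m l) :
    S.InCommonPlane P.fst.center P.snd.center := by
  have htranspose := mulVec_bijective (Matrix.isUnit_det_transpose _ φ.isUnit_space)
  obtain ⟨l, rfl⟩ := htranspose.surjective l
  obtain ⟨m, rfl⟩ := htranspose.surjective m
  rw [φ.center_fst, φ.center_snd]
  refine S.inCommonPlane_mk_cxVec (φ.space_col_ne_zero 3) (φ.space_col_ne_zero 2)
    (l := l) (m := m) ?_ (φ.pullQuad_bijective.injective ?_) ?_ ?_
  · rintro rfl
    exact hl (Matrix.mulVec_zero _)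
  · rw [h, pullQuad, Matrix.mul_add, Matrix.add_mul, Matrix.mul_vecMulVec, Matrix.mul_vecMulVec,
      Matrix.vecMulVec_mul, Matrix.vecMulVec_mul, Matrix.mulVec_transpose, Matrix.mulVec_transpose]
  · rw [dotProduct_comm]
    exact h₃
  · rw [dotProduct_comm]
    exact h₂

end CameraPair.Frame

lemma CameraPair.exists_eq_quadMat (P : CameraPair) (S : Quadric) (h₁ : P.fst.center ∈ S.points)
    (h₂ : P.snd.center ∈ S.points) : ∃ F, S.mat = P.quadMat F := by
  obtain ⟨φ⟩ := P.nonempty_frame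
  rw [φ.center_fst_mem_points] at h₁
  rw [φ.center_snd_mem_points] at h₂
  have hsymm : (φ.pullQuad S.mat).IsSymm := by
    rw [CameraPair.Frame.pullQuad, Matrix.IsSymm, Matrix.transpose_mul, Matrix.transpose_mul,
      Matrix.transpose_transpose, S.symm, Matrix.mul_assoc]
  have hentry (i j : Fin 4) : φ.pullQuad S.mat j i = φ.pullQuad S.mat i j := hsymm.apply i j
  obtain ⟨F, hF⟩ := φ.pull_bijective.surjective
    !![φ.pullQuad S.mat 0 0 / 2, φ.pullQuad S.mat 0 1, φ.pullQuad S.mat 0 3;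
       0, φ.pullQuad S.mat 1 1 / 2, φ.pullQuad S.mat 1 3;
       φ.pullQuad S.mat 0 2, φ.pullQuad S.mat 1 2, φ.pullQuad S.mat 2 3]
  refine ⟨F, φ.pullQuad_bijective.injective ?_⟩
  rw [φ.pullQuad_quadMat, hF]
  ext i j
  fin_cases i <;> fin_cases j <;>
    simp [stdQuad, h₁, h₂, mul_div_cancel₀, hentry 0 1, hentry 0 2, hentry 0 3, hentry 1 2,
      hentry 1 3, hentry 2 3]

/-! ### Pencils of fundamental matrices -/

section Pencil

variable {K : Type*} [Field K] (F G : Matrix (Fin 3) (Fin 3) K)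

/-- The coefficient of `a² b` in `det (a F + b G)`. -/
def mixedDet : K := (F.adjugate * G).trace

/-- The matrices have a common right kernel vector: for the fundamental matrices of two camera pairs
these are the epipoles in the second image. -/
def HaveCommonRightKernel : Prop := ∃ v, v ≠ 0 ∧ F *ᵥ v = 0 ∧ G *ᵥ v = 0

/-- The matrices have a common left kernel vector: for the fundamental matrices of two camera pairs
these are the epipoles in the first image. -/
def HaveCommonLeftKernel : Prop := ∃ v, v ≠ 0 ∧ v ᵥ* F = 0 ∧ v ᵥ* G = 0

/-- The pencil spanned by the matrices has a member of rank at most one. -/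
def PencilHasRankLeOne : Prop := ∃ a b : K, ¬ (a = 0 ∧ b = 0) ∧ (a • F + b • G).adjugate = 0

/-- The adjugate, as a quadratic map on the pencil spanned by the matrices, is degenerate: it is
invariant under translation by a member whose coefficients are not both zero. -/
def PencilHasDegenerateAdjugate : Prop :=
  ∃ a b : K, ¬ (a = 0 ∧ b = 0) ∧
    ∀ x y : K, ((x • F + y • G) + (a • F + b • G)).adjugate = (x • F + y • G).adjugate

/-- The type of the critical quadric of a camera pair with fundamental matrix `F` with respect to a
camera pair with fundamental matrix `G`, in terms of the pencil spanned by `F` and `G`. Exchanging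
`F` and `G`, and hence the two camera pairs, exchanges the second and the third row and preserves
the other ones. -/
def PencilType : QuadricType → Prop
  | .smoothNotOnLine => mixedDet F G ≠ 0 ∧ mixedDet G F ≠ 0
  | .smoothOnLine => mixedDet F G = 0 ∧ mixedDet G F ≠ 0
  | .coneNotOnLine => mixedDet F G ≠ 0 ∧ mixedDet G F = 0
  | .coneVertex =>
      mixedDet F G = 0 ∧ mixedDet G F = 0 ∧
        Xor (HaveCommonRightKernel F G) (HaveCommonLeftKernel F G) ∧ ¬ PencilHasRankLeOne F G
  | .planesSamePlane =>
      mixedDet F G = 0 ∧ mixedDet G F = 0 ∧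
        ¬ HaveCommonRightKernel F G ∧ ¬ HaveCommonLeftKernel F G
  | .planesOneSingular =>
      mixedDet F G = 0 ∧ mixedDet G F = 0 ∧
        Xor (HaveCommonRightKernel F G) (HaveCommonLeftKernel F G) ∧ PencilHasRankLeOne F G
  | .planesBothSingular =>
      mixedDet F G = 0 ∧ mixedDet G F = 0 ∧
        (HaveCommonRightKernel F G ∧ HaveCommonLeftKernel F G) ∧ ¬ PencilHasDegenerateAdjugate F G
  | .doublePlane =>
      mixedDet F G = 0 ∧ mixedDet G F = 0 ∧
        (HaveCommonRightKernel F G ∧ HaveCommonLeftKernel F G) ∧ PencilHasDegenerateAdjugate F G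

lemma exists_pencilType : ∃ t, PencilType F G t := by
  by_cases h₁ : mixedDet F G = 0 <;> by_cases h₂ : mixedDet G F = 0
  · by_cases hr : HaveCommonRightKernel F G <;> by_cases hl : HaveCommonLeftKernel F G
    · by_cases hd : PencilHasDegenerateAdjugate F G
      · exact ⟨.doublePlane, h₁, h₂, ⟨hr, hl⟩, hd⟩
      · exact ⟨.planesBothSingular, h₁, h₂, ⟨hr, hl⟩, hd⟩
    · by_cases ho : PencilHasRankLeOne F G
      · exact ⟨.planesOneSingular, h₁, h₂, .inl ⟨hr, hl⟩, ho⟩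
      · exact ⟨.coneVertex, h₁, h₂, .inl ⟨hr, hl⟩, ho⟩
    · by_cases ho : PencilHasRankLeOne F G
      · exact ⟨.planesOneSingular, h₁, h₂, .inr ⟨hl, hr⟩, ho⟩
      · exact ⟨.coneVertex, h₁, h₂, .inr ⟨hl, hr⟩, ho⟩
    · exact ⟨.planesSamePlane, h₁, h₂, hr, hl⟩
  · exact ⟨.smoothOnLine, h₁, h₂⟩
  · exact ⟨.coneNotOnLine, h₁, h₂⟩
  · exact ⟨.smoothNotOnLine, h₁, h₂⟩

lemma haveCommonRightKernel_comm : HaveCommonRightKernel F G ↔ HaveCommonRightKernel G F :=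
  exists_congr fun _ => and_congr_right fun _ => and_comm

lemma haveCommonLeftKernel_comm : HaveCommonLeftKernel F G ↔ HaveCommonLeftKernel G F :=
  exists_congr fun _ => and_congr_right fun _ => and_comm

lemma pencilHasRankLeOne_comm : PencilHasRankLeOne F G ↔ PencilHasRankLeOne G F := by
  rw [PencilHasRankLeOne, exists_comm]
  simp only [PencilHasRankLeOne, and_comm, add_comm]

lemma pencilHasDegenerateAdjugate_comm :
    PencilHasDegenerateAdjugate F G ↔ PencilHasDegenerateAdjugate G F := by
  rw [PencilHasDegenerateAdjugate, exists_comm]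
  refine exists₂_congr fun a b => and_congr (not_congr and_comm) (forall_comm.trans ?_)
  simp only [add_comm (_ • F)]

variable {F G}

lemma PencilType.swap {t : QuadricType} (h : PencilType F G t) : PencilType G F t.conjugate := by
  cases t <;>
    simp only [QuadricType.conjugate, PencilType, haveCommonRightKernel_comm G F,
      haveCommonLeftKernel_comm G F, pencilHasRankLeOne_comm G F,
      pencilHasDegenerateAdjugate_comm G F] at h ⊢ <;> tauto

variable (F G)

lemma det_add_smul (x : K) :
    (F + x • G).det = F.det + mixedDet F G * x + mixedDet G F * x ^ 2 + G.det * x ^ 3 := by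
  simp only [mixedDet, Matrix.det_fin_three, Matrix.adjugate_fin_three, Matrix.trace_fin_three,
    Matrix.mul_apply, Fin.sum_univ_three, Matrix.add_apply, Matrix.smul_apply, smul_eq_mul,
    Matrix.of_apply, Matrix.cons_val]
  ring

lemma haveCommonLeftKernel_iff_transpose :
    HaveCommonLeftKernel F G ↔ HaveCommonRightKernel Fᵀ Gᵀ := by
  simp only [HaveCommonLeftKernel, HaveCommonRightKernel, Matrix.mulVec_transpose]

lemma smul_mul_mul_add_smul_mul_mul (A B : Matrix (Fin 3) (Fin 3) K) (a b : K) :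
    a • (A * F * B) + b • (A * G * B) = A * (a • F + b • G) * B := by
  simp only [Matrix.mul_add, Matrix.add_mul, Matrix.mul_smul, Matrix.smul_mul]

lemma mixedDet_mul_mul (A B : Matrix (Fin 3) (Fin 3) K) :
    mixedDet (A * F * B) (A * G * B) = A.det * B.det * mixedDet F G :=
  calc mixedDet (A * F * B) (A * G * B)
    _ = (B.adjugate * (F.adjugate * (A.adjugate * A) * G * B)).trace := by
        rw [mixedDet, Matrix.adjugate_mul_distrib, Matrix.adjugate_mul_distrib]
        simp only [Matrix.mul_assoc]
    _ = (A.det • (F.adjugate * G) * (B * B.adjugate)).trace := by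
        rw [Matrix.trace_mul_comm, Matrix.adjugate_mul]
        simp only [Matrix.mul_assoc, Matrix.mul_smul, Matrix.smul_mul, Matrix.one_mul]
    _ = A.det * B.det * mixedDet F G := by
        rw [Matrix.mul_adjugate, Matrix.mul_smul, Matrix.mul_one, Matrix.trace_smul,
          Matrix.trace_smul, smul_eq_mul, smul_eq_mul, mixedDet]
        ring

variable {A B : Matrix (Fin 3) (Fin 3) K} (hA : IsUnit A.det) (hB : IsUnit B.det)
include hA hB

lemma adjugate_mul_mul_eq_iff :
    (A * F * B).adjugate = (A * G * B).adjugate ↔ F.adjugate = G.adjugate := by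
  have hAadj : IsUnit A.adjugate.det := Matrix.det_adjugate A ▸ hA.pow _
  have hBadj : IsUnit B.adjugate.det := Matrix.det_adjugate B ▸ hB.pow _
  simp only [Matrix.adjugate_mul_distrib, ← Matrix.mul_assoc]
  exact (mul_mul_bijective hBadj hAadj).injective.eq_iff

lemma adjugate_mul_mul_eq_zero_iff : (A * F * B).adjugate = 0 ↔ F.adjugate = 0 := by
  simpa using adjugate_mul_mul_eq_iff F 0 hA hB

lemma mixedDet_mul_mul_eq_zero_iff : mixedDet (A * F * B) (A * G * B) = 0 ↔ mixedDet F G = 0 := by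
  rw [mixedDet_mul_mul, mul_eq_zero, or_iff_right (mul_ne_zero hA.ne_zero hB.ne_zero)]

lemma haveCommonRightKernel_mul_mul_iff :
    HaveCommonRightKernel (A * F * B) (A * G * B) ↔ HaveCommonRightKernel F G := by
  have hinj := (mulVec_bijective hA).injective
  have hbij := mulVec_bijective hB
  refine (exists_congr fun v => ?_).trans hbij.surjective.exists.symm
  rw [← Matrix.mulVec_mulVec, ← Matrix.mulVec_mulVec, ← Matrix.mulVec_mulVec,
    ← Matrix.mulVec_mulVec, hinj.eq_iff' (Matrix.mulVec_zero A),
    hinj.eq_iff' (Matrix.mulVec_zero A), Ne, Ne, hbij.injective.eq_iff' (Matrix.mulVec_zero B)]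

lemma haveCommonLeftKernel_mul_mul_iff :
    HaveCommonLeftKernel (A * F * B) (A * G * B) ↔ HaveCommonLeftKernel F G := by
  simp only [haveCommonLeftKernel_iff_transpose, Matrix.transpose_mul, ← Matrix.mul_assoc]
  exact haveCommonRightKernel_mul_mul_iff _ _ (Matrix.isUnit_det_transpose _ hB)
    (Matrix.isUnit_det_transpose _ hA)

lemma pencilHasRankLeOne_mul_mul_iff :
    PencilHasRankLeOne (A * F * B) (A * G * B) ↔ PencilHasRankLeOne F G := by
  simp only [PencilHasRankLeOne, smul_mul_mul_add_smul_mul_mul,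
    adjugate_mul_mul_eq_zero_iff _ hA hB]

lemma pencilHasDegenerateAdjugate_mul_mul_iff :
    PencilHasDegenerateAdjugate (A * F * B) (A * G * B) ↔ PencilHasDegenerateAdjugate F G := by
  simp only [PencilHasDegenerateAdjugate, smul_mul_mul_add_smul_mul_mul, ← Matrix.mul_add,
    ← Matrix.add_mul, adjugate_mul_mul_eq_iff _ _ hA hB]

end Pencil

/-! ### Ranks of quadrics in adapted coordinates -/

section Factorization

variable {K : Type*} [Field K]

lemma exists_eq_mul_of_mul_eq_mul {a b c d : K} (h : ¬ (a = 0 ∧ b = 0)) (hcross : a * d = b * c) :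
    ∃ k, c = k * a ∧ d = k * b := by
  by_cases ha : a = 0
  · have hb : b ≠ 0 := fun hb => h ⟨ha, hb⟩
    refine ⟨d / b, ?_, by field_simp⟩
    rw [ha, zero_mul, zero_eq_mul] at hcross
    rw [ha, hcross.resolve_left hb, mul_zero]
  · refine ⟨c / a, by field_simp, ?_⟩
    field_simp
    linear_combination hcross

/-- The binary quadratic form with coefficients `a, s, b` has the root `(d₁, -d₀)`. -/
lemma exists_linear_factor_of_root {a b s d₀ d₁ : K} (hd : ¬ (d₀ = 0 ∧ d₁ = 0))
    (h : b * d₀ ^ 2 - s * d₀ * d₁ + a * d₁ ^ 2 = 0) :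
    ∃ m₀ m₁, a = d₀ * m₀ ∧ b = d₁ * m₁ ∧ s = d₀ * m₁ + d₁ * m₀ := by
  by_cases h₀ : d₀ = 0
  · have h₁ : d₁ ≠ 0 := fun h₁ => hd ⟨h₀, h₁⟩
    have ha : a = 0 := by simpa [h₀, h₁] using h
    exact ⟨s / d₁, b / d₁, by rw [ha, h₀, zero_mul], by field_simp, by rw [h₀]; field_simp; ring⟩
  · refine ⟨a / d₀, (s - d₁ * (a / d₀)) / d₀, by field_simp, ?_, by field_simp; ring⟩
    field_simp
    linear_combination h

lemma adjugate_vecMulVec (u v : Fin 3 → K) : (Matrix.vecMulVec u v).adjugate = 0 := by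
  rw [Matrix.adjugate_fin_three]
  ext i j
  fin_cases i <;> fin_cases j <;> simp [Matrix.vecMulVec_apply] <;> ring

lemma det_submatrix_eq_zero_of_rank_lt {m n k : Type*} [Fintype n] [Fintype k] [DecidableEq k]
    {A : Matrix m n K} (h : A.rank < Fintype.card k) (r : k → m) (c : k → n) :
    (A.submatrix r c).det = 0 := by
  by_contra hdet
  exact h.not_ge (card_le_rank_of_det_submatrix_ne_zero r c hdet)

end Factorization

section StdQuad

variable (g : Matrix (Fin 3) (Fin 3) ℝ)

lemma adjugate_stdFund : stdFund.adjugate = Matrix.single 2 2 1 := by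
  rw [Matrix.adjugate_fin_three]
  ext i j
  fin_cases i <;> fin_cases j <;> simp [stdFund]

lemma mixedDet_stdFund_left : mixedDet stdFund g = g 2 2 := by
  rw [mixedDet, adjugate_stdFund, Matrix.trace_fin_three]
  simp [Matrix.mul_apply, Fin.sum_univ_three]

lemma mixedDet_stdFund_right :
    mixedDet g stdFund = (g 0 1 * g 2 2 - g 0 2 * g 2 1) - (g 1 0 * g 2 2 - g 1 2 * g 2 0) := by
  rw [mixedDet, Matrix.adjugate_fin_three, Matrix.trace_fin_three]
  simp [Matrix.mul_apply, Fin.sum_univ_three, stdFund]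
  ring

lemma haveCommonRightKernel_stdFund_iff : HaveCommonRightKernel stdFund g ↔ g.col 2 = 0 := by
  have hker (v : Fin 3 → ℝ) : stdFund *ᵥ v = 0 ↔ v = v 2 • Pi.single 2 1 := by
    simp [stdFund, funext_iff, Fin.forall_fin_succ, Matrix.vecHead, Matrix.vecTail, and_comm]
  rw [← Matrix.mulVec_single_one]
  constructor
  · rintro ⟨v, hv, hstd, hg⟩
    rw [(hker v).1 hstd, Matrix.mulVec_smul, smul_eq_zero] at hg
    refine hg.resolve_left fun h2 => hv ?_
    rw [(hker v).1 hstd, h2, zero_smul]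
  · exact fun h => ⟨Pi.single 2 1, by simp, (hker _).2 (by simp), h⟩

lemma transpose_stdFund : stdFundᵀ = -stdFund := by
  ext i j
  fin_cases i <;> fin_cases j <;> simp [stdFund]

lemma haveCommonLeftKernel_stdFund_iff : HaveCommonLeftKernel stdFund g ↔ g 2 = 0 := by
  have h : HaveCommonRightKernel stdFund gᵀ ↔ g 2 = 0 := haveCommonRightKernel_stdFund_iff gᵀ
  rw [haveCommonLeftKernel_iff_transpose, transpose_stdFund, ← h]
  simp only [HaveCommonRightKernel, Matrix.neg_mulVec, neg_eq_zero]

lemma pencilHasRankLeOne_stdFund_transpose_iff :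
    PencilHasRankLeOne stdFund gᵀ ↔ PencilHasRankLeOne stdFund g := by
  rw [PencilHasRankLeOne, (Equiv.neg ℝ).surjective.exists]
  refine exists₂_congr fun a b => and_congr (by simp) ?_
  have hpencil : (Equiv.neg ℝ a) • stdFund + b • gᵀ = (a • stdFund + b • g)ᵀ := by
    rw [Matrix.transpose_add, Matrix.transpose_smul, Matrix.transpose_smul, transpose_stdFund,
      Equiv.neg_apply, neg_smul, smul_neg]
  rw [hpencil, ← Matrix.adjugate_transpose, Matrix.transpose_eq_zero]

lemma stdQuad_transpose :
    stdQuad gᵀ = (stdQuad g).submatrix (Equiv.swap 2 3) (Equiv.swap 2 3) := by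
  have h0 : Equiv.swap (2 : Fin 4) 3 0 = 0 := by decide
  have h1 : Equiv.swap (2 : Fin 4) 3 1 = 1 := by decide
  ext i j
  fin_cases i <;> fin_cases j <;> simp [stdQuad, h0, h1, add_comm]

lemma rank_stdQuad_transpose : (stdQuad gᵀ).rank = (stdQuad g).rank := by
  rw [stdQuad_transpose, Matrix.rank_submatrix]

lemma det_stdQuad :
    (stdQuad g).det = mixedDet g stdFund ^ 2 - 4 * mixedDet stdFund g * g.det := by
  rw [mixedDet_stdFund_left, mixedDet_stdFund_right, Matrix.det_succ_row_zero]
  simp only [Fin.sum_univ_four, Matrix.det_fin_three, Matrix.submatrix_apply]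
  simp [Fin.succAbove, stdQuad]
  ring

variable {g}

lemma rank_stdQuad_lt_four (hm : mixedDet g stdFund = 0) (h : mixedDet stdFund g * g.det = 0) :
    (stdQuad g).rank < 4 := by
  refine rank_lt_card_iff_det_eq_zero.2 ?_
  rw [det_stdQuad, hm, mul_assoc, h]
  ring

lemma three_le_rank_stdQuad_of_mixedDet (hadj : g.adjugate ≠ 0) (h : mixedDet stdFund g ≠ 0)
    (hm : mixedDet g stdFund = 0) : 3 ≤ (stdQuad g).rank := by
  by_contra! hrank
  rw [mixedDet_stdFund_left] at h
  rw [mixedDet_stdFund_right] at hm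
  have h00 := det_submatrix_eq_zero_of_rank_lt hrank ![0, 2, 3] ![0, 2, 3]
  have h11 := det_submatrix_eq_zero_of_rank_lt hrank ![1, 2, 3] ![1, 2, 3]
  have h01 := det_submatrix_eq_zero_of_rank_lt hrank ![0, 2, 3] ![1, 2, 3]
  simp only [Matrix.det_fin_three, stdQuad, Matrix.submatrix_apply, Matrix.of_apply,
    Matrix.cons_val] at h00 h01 h11
  have e00 : g 0 0 * g 2 2 = g 0 2 * g 2 0 := mul_left_cancel₀ h (by linear_combination -h00 / 2)
  have e11 : g 1 1 * g 2 2 = g 1 2 * g 2 1 := mul_left_cancel₀ h (by linear_combination -h11 / 2)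
  have hsum : (g 0 1 + g 1 0) * g 2 2 = g 0 2 * g 2 1 + g 1 2 * g 2 0 :=
    mul_left_cancel₀ h (by linear_combination -h01)
  have e01 : g 0 1 * g 2 2 = g 0 2 * g 2 1 := by linear_combination (hsum + hm) / 2
  have e10 : g 1 0 * g 2 2 = g 1 2 * g 2 0 := by linear_combination (hsum - hm) / 2
  have hg : g = Matrix.vecMulVec (g.col 2) ((g 2 2)⁻¹ • g 2) := by
    ext i j
    rw [Matrix.vecMulVec_apply, Pi.smul_apply, smul_eq_mul, Matrix.col_apply]
    field_simp
    fin_cases i <;> fin_cases j <;> first | assumption | exact mul_comm _ _ | rfl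
  exact hadj (hg ▸ adjugate_vecMulVec _ _)

lemma three_le_rank_stdQuad_of_det (h : mixedDet stdFund g = 0) (hm : mixedDet g stdFund = 0)
    (hdet : g.det ≠ 0) : 3 ≤ (stdQuad g).rank := by
  rw [mixedDet_stdFund_left] at h
  rw [mixedDet_stdFund_right] at hm
  refine card_le_rank_of_det_submatrix_ne_zero ![0, 1, 2] ![0, 1, 3] fun h0 => hdet ?_
  simp only [Matrix.det_fin_three, stdQuad, Matrix.submatrix_apply, Matrix.of_apply,
    Matrix.cons_val, h] at h0
  rw [h] at hm
  rw [Matrix.det_fin_three, h]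
  linear_combination (h0 + (g 0 1 - g 1 0) * hm) / 2

lemma two_le_rank_stdQuad_of_mixedDet (h : mixedDet stdFund g ≠ 0) : 2 ≤ (stdQuad g).rank := by
  rw [mixedDet_stdFund_left] at h
  refine card_le_rank_of_det_submatrix_ne_zero ![2, 3] ![2, 3] ?_
  rw [Matrix.det_fin_two]
  simpa [stdQuad] using h

lemma two_le_rank_stdQuad (hcol : g.col 2 ≠ 0) (h22 : g 2 2 = 0) : 2 ≤ (stdQuad g).rank := by
  obtain ⟨i, hi⟩ := Function.ne_iff.1 hcol
  by_contra! hrank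
  have h0 := det_submatrix_eq_zero_of_rank_lt hrank ![0, 3] ![0, 3]
  have h1 := det_submatrix_eq_zero_of_rank_lt hrank ![1, 3] ![1, 3]
  simp only [Matrix.det_fin_two, stdQuad, Matrix.submatrix_apply, Matrix.of_apply,
    Matrix.cons_val, mul_zero, zero_sub, neg_eq_zero, mul_self_eq_zero] at h0 h1
  fin_cases i
  exacts [hi h0, hi h1, hi h22]

lemma stdQuad_eq_vecMulVec_add_vecMulVec {k m₀ m₁ : ℝ} (h22 : g 2 2 = 0)
    (h00 : g 0 0 = g 0 2 * m₀) (h11 : g 1 1 = g 1 2 * m₁)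
    (h01 : g 0 1 + g 1 0 = g 0 2 * m₁ + g 1 2 * m₀) (h20 : g 2 0 = k * g 0 2)
    (h21 : g 2 1 = k * g 1 2) :
    stdQuad g = Matrix.vecMulVec ![g 0 2, g 1 2, 0, 0] ![m₀, m₁, k, 1] +
      Matrix.vecMulVec ![m₀, m₁, k, 1] ![g 0 2, g 1 2, 0, 0] := by
  ext i j
  fin_cases i <;> fin_cases j <;> simp [stdQuad, h00, h11, h01, h20, h21, h22] <;> ring

lemma exists_stdQuad_eq_vecMulVec_add_vecMulVec (h22 : g 2 2 = 0) (hm : mixedDet g stdFund = 0)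
    (hdet : g.det = 0) (hcol : g.col 2 ≠ 0) (hrow : g 2 ≠ 0) :
    ∃ l m : Fin 4 → ℝ, l ≠ 0 ∧ l 2 = 0 ∧ l 3 = 0 ∧
      stdQuad g = Matrix.vecMulVec l m + Matrix.vecMulVec m l := by
  have hne : ¬ (g 0 2 = 0 ∧ g 1 2 = 0) := fun h => hcol <| by
    ext i
    fin_cases i
    exacts [h.1, h.2, h22]
  rw [mixedDet_stdFund_right, h22] at hm
  obtain ⟨k, h20, h21⟩ := exists_eq_mul_of_mul_eq_mul hne (c := g 2 0) (d := g 2 1)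
    (by linear_combination -hm)
  have hk : k ≠ 0 := by
    rintro rfl
    refine hrow (funext fun i => ?_)
    fin_cases i
    exacts [h20.trans (zero_mul _), h21.trans (zero_mul _), h22]
  rw [Matrix.det_fin_three, h22, h20, h21] at hdet
  obtain ⟨m₀, m₁, h00, h11, h01⟩ := exists_linear_factor_of_root (a := g 0 0) (b := g 1 1)
    (s := g 0 1 + g 1 0) hne (mul_left_cancel₀ hk (by linear_combination -hdet))
  refine ⟨_, _, fun h => hne ⟨congrFun h 0, congrFun h 1⟩, rfl, rfl,
    stdQuad_eq_vecMulVec_add_vecMulVec h22 h00 h11 h01 h20 h21⟩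

lemma pencilHasRankLeOne_stdFund_of_rank_lt_three (hrow : g 2 = 0) (hcol : g.col 2 ≠ 0)
    (hrank : (stdQuad g).rank < 3) : PencilHasRankLeOne stdFund g := by
  have h2 (j : Fin 3) : g 2 j = 0 := by rw [hrow, Pi.zero_apply]
  have hne : ¬ (g 0 2 = 0 ∧ g 1 2 = 0) := fun h => hcol <| by
    ext i
    fin_cases i
    exacts [h.1, h.2, h2 2]
  have hminor := det_submatrix_eq_zero_of_rank_lt hrank ![0, 1, 3] ![0, 1, 3]
  simp only [Matrix.det_fin_three, stdQuad, Matrix.submatrix_apply, Matrix.of_apply,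
    Matrix.cons_val] at hminor
  obtain ⟨m₀, m₁, h00, h11, h01⟩ := exists_linear_factor_of_root (a := g 0 0) (b := g 1 1)
    (s := g 0 1 + g 1 0) hne (by linear_combination -hminor / 2)
  have hvec : (g 0 2 * m₁ - g 0 1) • stdFund + (1 : ℝ) • g =
      Matrix.vecMulVec (g.col 2) ![m₀, m₁, 1] := by
    ext i j
    fin_cases i <;> fin_cases j <;> simp [stdFund, h2, h00, h11, Matrix.vecMulVec_apply]
    linear_combination h01
  exact ⟨_, 1, by simp, hvec ▸ adjugate_vecMulVec _ _⟩

lemma pencilHasDegenerateAdjugate_stdFund_iff (hrow : g 2 = 0) (hcol : g.col 2 = 0) :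
    PencilHasDegenerateAdjugate stdFund g ↔ 4 * (g 0 0 * g 1 1) = (g 0 1 + g 1 0) ^ 2 := by
  have h2 (j : Fin 3) : g 2 j = 0 := by rw [hrow, Pi.zero_apply]
  have h2' (i : Fin 3) : g i 2 = 0 := congrFun hcol i
  have hadj (x y : ℝ) : (x • stdFund + y • g).adjugate = Matrix.single 2 2
      (y * g 0 0 * (y * g 1 1) - (x + y * g 0 1) * (-x + y * g 1 0)) := by
    rw [Matrix.adjugate_fin_three]
    ext i j
    fin_cases i <;> fin_cases j <;> simp [stdFund, h2, h2']
  have hsum (x y a b : ℝ) : x • stdFund + y • g + (a • stdFund + b • g) =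
      (x + a) • stdFund + (y + b) • g := by
    rw [add_smul, add_smul]
    abel
  have hinj (x y : ℝ) :
      Matrix.single (2 : Fin 3) (2 : Fin 3) x = Matrix.single 2 2 y ↔ x = y :=
    ⟨fun h => by simpa using congrFun₂ h 2 2, fun h => by rw [h]⟩
  simp only [PencilHasDegenerateAdjugate, hsum, hadj, hinj]
  constructor
  · rintro ⟨a, b, hab, h⟩
    have h0 := h 0 0
    have h1 := h 1 0
    have hb : b ≠ 0 := by
      rintro rfl
      exact hab ⟨by linear_combination (h1 - h0) / 2, rfl⟩
    refine mul_left_cancel₀ (pow_ne_zero 2 hb) ?_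
    linear_combination 4 * h0 - (h1 - h0) * (2 * a + b * (g 0 1 - g 1 0))
  · intro h
    refine ⟨(g 1 0 - g 0 1) / 2, 1, by simp, fun x y => ?_⟩
    linear_combination ((1 / 4) * (2 * y + 1)) * h

lemma rank_stdQuad_le_one_iff (hrow : g 2 = 0) (hcol : g.col 2 = 0) :
    (stdQuad g).rank ≤ 1 ↔ 4 * (g 0 0 * g 1 1) = (g 0 1 + g 1 0) ^ 2 := by
  have h2 (j : Fin 3) : g 2 j = 0 := by rw [hrow, Pi.zero_apply]
  have h2' (i : Fin 3) : g i 2 = 0 := congrFun hcol i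
  constructor
  · intro hrank
    have h := det_submatrix_eq_zero_of_rank_lt (Nat.lt_succ_of_le hrank) ![0, 1] ![0, 1]
    simp only [Matrix.det_fin_two, stdQuad, Matrix.submatrix_apply, Matrix.of_apply,
      Matrix.cons_val] at h
    linear_combination h
  · intro h
    obtain ⟨u, v, huv⟩ : ∃ u v, stdQuad g = Matrix.vecMulVec u v := by
      by_cases h00 : g 0 0 = 0
      · have h01 : g 0 1 + g 1 0 = 0 := by simpa [h00] using h.symm
        refine ⟨![0, 2 * g 1 1, 0, 0], ![0, 1, 0, 0], ?_⟩
        ext i j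
        fin_cases i <;> fin_cases j <;> simp [stdQuad, Matrix.vecMulVec_apply, h00, h01, h2, h2']
      · refine ⟨![2 * g 0 0, g 0 1 + g 1 0, 0, 0], ![1, (g 0 1 + g 1 0) / (2 * g 0 0), 0, 0], ?_⟩
        ext i j
        fin_cases i <;> fin_cases j <;>
          simp [stdQuad, Matrix.vecMulVec_apply, h2, h2'] <;> field_simp
        linear_combination h
    rw [huv]
    exact Matrix.rank_vecMulVec_le _ _

lemma rank_stdQuad_le_two (hrow : g 2 = 0) (hcol : g.col 2 = 0) : (stdQuad g).rank ≤ 2 := by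
  have h2 (j : Fin 3) : g 2 j = 0 := by rw [hrow, Pi.zero_apply]
  have h2' (i : Fin 3) : g i 2 = 0 := congrFun hcol i
  have hrows : stdQuad g = Matrix.vecMulVec (stdQuad g 0) ![1, 0, 0, 0] +
      Matrix.vecMulVec (stdQuad g 1) ![0, 1, 0, 0] := by
    ext i j
    fin_cases i <;> fin_cases j <;> simp [stdQuad, h2, h2']
  rw [hrows]
  exact rank_vecMulVec_add_vecMulVec_le _ _ _ _

end StdQuad

/-! ### The type of a critical quadric -/

namespace CameraPair.Frame

variable {P : CameraPair} (φ : P.Frame) (F G : Matrix (Fin 3) (Fin 3) ℝ)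

lemma isUnit_det_transpose_left : IsUnit φ.leftᵀ.det :=
  Matrix.isUnit_det_transpose _ φ.isUnit_left

lemma det_pull_eq_zero_iff : (φ.pull F).det = 0 ↔ F.det = 0 := by
  rw [pull, Matrix.det_mul, Matrix.det_mul, mul_eq_zero, mul_eq_zero,
    or_iff_left φ.isUnit_right.ne_zero, or_iff_right φ.isUnit_det_transpose_left.ne_zero]

lemma adjugate_pull_eq_zero_iff : (φ.pull F).adjugate = 0 ↔ F.adjugate = 0 :=
  adjugate_mul_mul_eq_zero_iff F φ.isUnit_det_transpose_left φ.isUnit_right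

lemma mixedDet_pull_eq_zero_iff : mixedDet (φ.pull F) (φ.pull G) = 0 ↔ mixedDet F G = 0 :=
  mixedDet_mul_mul_eq_zero_iff F G φ.isUnit_det_transpose_left φ.isUnit_right

lemma haveCommonRightKernel_pull_iff :
    HaveCommonRightKernel (φ.pull F) (φ.pull G) ↔ HaveCommonRightKernel F G :=
  haveCommonRightKernel_mul_mul_iff F G φ.isUnit_det_transpose_left φ.isUnit_right

lemma haveCommonLeftKernel_pull_iff :
    HaveCommonLeftKernel (φ.pull F) (φ.pull G) ↔ HaveCommonLeftKernel F G :=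
  haveCommonLeftKernel_mul_mul_iff F G φ.isUnit_det_transpose_left φ.isUnit_right

lemma pencilHasRankLeOne_pull_iff :
    PencilHasRankLeOne (φ.pull F) (φ.pull G) ↔ PencilHasRankLeOne F G :=
  pencilHasRankLeOne_mul_mul_iff F G φ.isUnit_det_transpose_left φ.isUnit_right

lemma pencilHasDegenerateAdjugate_pull_iff :
    PencilHasDegenerateAdjugate (φ.pull F) (φ.pull G) ↔ PencilHasDegenerateAdjugate F G :=
  pencilHasDegenerateAdjugate_mul_mul_iff F G φ.isUnit_det_transpose_left φ.isUnit_right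

lemma rank_stdQuad_pull : (stdQuad (φ.pull F)).rank = (P.quadMat F).rank := by
  rw [← φ.pullQuad_quadMat, φ.rank_pullQuad]

end CameraPair.Frame

section CriticalQuadric

variable (P : CameraPair)

lemma CameraPair.det_fundamentalMatrix : P.fundamentalMatrix.det = 0 := by
  obtain ⟨φ, hφ⟩ := P.exists_frame
  rw [← φ.det_pull_eq_zero_iff, hφ, Matrix.det_fin_three]
  simp [stdFund]

lemma CameraPair.adjugate_fundamentalMatrix_ne_zero : P.fundamentalMatrix.adjugate ≠ 0 := by
  obtain ⟨φ, hφ⟩ := P.exists_frame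
  rw [Ne, ← φ.adjugate_pull_eq_zero_iff, hφ, adjugate_stdFund]
  exact fun h => by simpa using congrFun₂ h 2 2

variable {F : Matrix (Fin 3) (Fin 3) ℝ}

section Rank

lemma CameraPair.rank_quadMat_eq_four (hdet : F.det = 0)
    (hm : mixedDet F P.fundamentalMatrix ≠ 0) : (P.quadMat F).rank = 4 := by
  obtain ⟨φ, hφ⟩ := P.exists_frame
  rw [← φ.det_pull_eq_zero_iff] at hdet
  rw [Ne, ← φ.mixedDet_pull_eq_zero_iff, hφ] at hm
  rw [← φ.rank_stdQuad_pull]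
  have hquad : (stdQuad (φ.pull F)).det ≠ 0 := by
    rw [det_stdQuad, hdet, mul_zero, sub_zero]
    exact pow_ne_zero 2 hm
  exact (Matrix.rank_of_det_ne_zero hquad).trans (Fintype.card_fin 4)

lemma CameraPair.rank_quadMat_lt_four (hdet : F.det = 0)
    (hm : mixedDet F P.fundamentalMatrix = 0) : (P.quadMat F).rank < 4 := by
  obtain ⟨φ, hφ⟩ := P.exists_frame
  rw [← φ.det_pull_eq_zero_iff] at hdet
  rw [← φ.mixedDet_pull_eq_zero_iff, hφ] at hm
  rw [← φ.rank_stdQuad_pull]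
  exact rank_stdQuad_lt_four hm (by rw [hdet, mul_zero])

lemma CameraPair.rank_quadMat_eq_three (hdet : F.det = 0) (hadj : F.adjugate ≠ 0)
    (hm : mixedDet F P.fundamentalMatrix = 0) (hm' : mixedDet P.fundamentalMatrix F ≠ 0) :
    (P.quadMat F).rank = 3 := by
  refine le_antisymm (Nat.le_of_lt_succ (P.rank_quadMat_lt_four hdet hm)) ?_
  obtain ⟨φ, hφ⟩ := P.exists_frame
  rw [← φ.mixedDet_pull_eq_zero_iff, hφ] at hm
  rw [Ne, ← φ.mixedDet_pull_eq_zero_iff, hφ] at hm'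
  rw [Ne, ← φ.adjugate_pull_eq_zero_iff] at hadj
  rw [← φ.rank_stdQuad_pull]
  exact three_le_rank_stdQuad_of_mixedDet hadj hm' hm

lemma CameraPair.rank_quadMat_le_two (h : F.adjugate = 0) : (P.quadMat F).rank ≤ 2 := by
  obtain ⟨u, v, rfl⟩ := exists_eq_vecMulVec_of_adjugate_eq_zero h
  rw [CameraPair.quadMat, Matrix.mul_vecMulVec, Matrix.vecMulVec_mul, Matrix.transpose_vecMulVec]
  exact rank_vecMulVec_add_vecMulVec_le _ _ _ _

lemma CameraPair.quadMat_smul_fundamentalMatrix_add (a : ℝ) (F : Matrix (Fin 3) (Fin 3) ℝ) :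
    P.quadMat (a • P.fundamentalMatrix + F) = P.quadMat F := by
  rw [P.quadMat_add, P.quadMat_smul, P.quadMat_fundamentalMatrix, smul_zero, zero_add]

lemma CameraPair.rank_quadMat_le_two_of_pencilHasRankLeOne
    (h : PencilHasRankLeOne P.fundamentalMatrix F) : (P.quadMat F).rank ≤ 2 := by
  obtain ⟨a, b, hab, hadj⟩ := h
  have hb : b ≠ 0 := by
    rintro rfl
    refine hab ⟨?_, rfl⟩
    rw [zero_smul, add_zero, Matrix.adjugate_smul, smul_eq_zero,
      or_iff_left P.adjugate_fundamentalMatrix_ne_zero] at hadj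
    simpa using hadj
  calc (P.quadMat F).rank
    _ = (b • P.quadMat F).rank :=
        (Matrix.rank_smul_of_mem_nonZeroDivisors _ (mem_nonZeroDivisors_of_ne_zero hb)).symm
    _ = (P.quadMat (a • P.fundamentalMatrix + b • F)).rank := by
        rw [P.quadMat_smul_fundamentalMatrix_add, P.quadMat_smul]
    _ ≤ 2 := P.rank_quadMat_le_two hadj

lemma CameraPair.two_le_rank_quadMat (hm : mixedDet P.fundamentalMatrix F = 0)
    (hker : ¬ (HaveCommonRightKernel P.fundamentalMatrix F ∧
      HaveCommonLeftKernel P.fundamentalMatrix F)) : 2 ≤ (P.quadMat F).rank := by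
  obtain ⟨φ, hφ⟩ := P.exists_frame
  rw [← φ.mixedDet_pull_eq_zero_iff, hφ, mixedDet_stdFund_left] at hm
  rw [← φ.haveCommonRightKernel_pull_iff, ← φ.haveCommonLeftKernel_pull_iff, hφ,
    haveCommonRightKernel_stdFund_iff, haveCommonLeftKernel_stdFund_iff] at hker
  rw [← φ.rank_stdQuad_pull]
  rcases not_and_or.1 hker with hcol | hrow
  · exact two_le_rank_stdQuad hcol hm
  · rw [← rank_stdQuad_transpose]
    exact two_le_rank_stdQuad hrow hm

lemma CameraPair.pencilHasRankLeOne_of_rank_quadMat_lt_three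
    (hker : Xor (HaveCommonRightKernel P.fundamentalMatrix F)
      (HaveCommonLeftKernel P.fundamentalMatrix F)) (hrank : (P.quadMat F).rank < 3) :
    PencilHasRankLeOne P.fundamentalMatrix F := by
  obtain ⟨φ, hφ⟩ := P.exists_frame
  rw [← φ.haveCommonRightKernel_pull_iff, ← φ.haveCommonLeftKernel_pull_iff, hφ,
    haveCommonRightKernel_stdFund_iff, haveCommonLeftKernel_stdFund_iff] at hker
  rw [← φ.rank_stdQuad_pull] at hrank
  rw [← φ.pencilHasRankLeOne_pull_iff, hφ]
  rcases hker with ⟨hcol, hrow⟩ | ⟨hrow, hcol⟩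
  · rw [← rank_stdQuad_transpose] at hrank
    rw [← pencilHasRankLeOne_stdFund_transpose_iff]
    exact pencilHasRankLeOne_stdFund_of_rank_lt_three hcol hrow hrank
  · exact pencilHasRankLeOne_stdFund_of_rank_lt_three hrow hcol hrank

lemma CameraPair.rank_quadMat_le_one_iff
    (hker : HaveCommonRightKernel P.fundamentalMatrix F ∧
      HaveCommonLeftKernel P.fundamentalMatrix F) :
    (P.quadMat F).rank ≤ 1 ↔ PencilHasDegenerateAdjugate P.fundamentalMatrix F := by
  obtain ⟨φ, hφ⟩ := P.exists_frame
  rw [← φ.haveCommonRightKernel_pull_iff, ← φ.haveCommonLeftKernel_pull_iff, hφ,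
    haveCommonRightKernel_stdFund_iff, haveCommonLeftKernel_stdFund_iff] at hker
  rw [← φ.pencilHasDegenerateAdjugate_pull_iff, hφ, ← φ.rank_stdQuad_pull,
    rank_stdQuad_le_one_iff hker.2 hker.1,
    pencilHasDegenerateAdjugate_stdFund_iff hker.2 hker.1]

lemma CameraPair.rank_quadMat_le_two_of_haveCommonKernels
    (hker : HaveCommonRightKernel P.fundamentalMatrix F ∧
      HaveCommonLeftKernel P.fundamentalMatrix F) : (P.quadMat F).rank ≤ 2 := by
  obtain ⟨φ, hφ⟩ := P.exists_frame
  rw [← φ.haveCommonRightKernel_pull_iff, ← φ.haveCommonLeftKernel_pull_iff, hφ,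
    haveCommonRightKernel_stdFund_iff, haveCommonLeftKernel_stdFund_iff] at hker
  rw [← φ.rank_stdQuad_pull]
  exact rank_stdQuad_le_two hker.2 hker.1

end Rank

variable {P} {S : Quadric} (hS : S.mat = P.quadMat F)
include hS

lemma Quadric.center_fst_mem_points : P.fst.center ∈ S.points := by
  obtain ⟨φ⟩ := P.nonempty_frame
  rw [φ.center_fst_mem_points, hS, φ.pullQuad_quadMat]
  rfl

lemma Quadric.center_snd_mem_points : P.snd.center ∈ S.points := by
  obtain ⟨φ⟩ := P.nonempty_frame
  rw [φ.center_snd_mem_points, hS, φ.pullQuad_quadMat]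
  rfl

lemma Quadric.onCommonLine_center_iff :
    S.OnCommonLine P.fst.center P.snd.center ↔ mixedDet P.fundamentalMatrix F = 0 := by
  obtain ⟨φ, hφ⟩ := P.exists_frame
  rw [φ.onCommonLine_center_iff S (S.center_fst_mem_points hS) (S.center_snd_mem_points hS),
    hS, φ.pullQuad_quadMat, ← φ.mixedDet_pull_eq_zero_iff, hφ, mixedDet_stdFund_left]
  rfl

lemma Quadric.center_fst_mem_singularLocus_iff (hm : mixedDet P.fundamentalMatrix F = 0) :
    P.fst.center ∈ S.singularLocus ↔ HaveCommonRightKernel P.fundamentalMatrix F := by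
  obtain ⟨φ, hφ⟩ := P.exists_frame
  rw [← φ.mixedDet_pull_eq_zero_iff, hφ, mixedDet_stdFund_left] at hm
  rw [φ.center_fst_mem_singularLocus, hS, φ.pullQuad_quadMat, ← φ.haveCommonRightKernel_pull_iff,
    hφ, haveCommonRightKernel_stdFund_iff]
  simp [funext_iff, Fin.forall_fin_succ, stdQuad, hm]

lemma Quadric.center_snd_mem_singularLocus_iff (hm : mixedDet P.fundamentalMatrix F = 0) :
    P.snd.center ∈ S.singularLocus ↔ HaveCommonLeftKernel P.fundamentalMatrix F := by
  obtain ⟨φ, hφ⟩ := P.exists_frame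
  rw [← φ.mixedDet_pull_eq_zero_iff, hφ, mixedDet_stdFund_left] at hm
  rw [φ.center_snd_mem_singularLocus, hS, φ.pullQuad_quadMat, ← φ.haveCommonLeftKernel_pull_iff,
    hφ, haveCommonLeftKernel_stdFund_iff]
  simp [funext_iff, Fin.forall_fin_succ, stdQuad, hm]

lemma Quadric.isTwoPlanes_and_inCommonPlane_center (hdet : F.det = 0)
    (hm : mixedDet P.fundamentalMatrix F = 0) (hm' : mixedDet F P.fundamentalMatrix = 0)
    (hr : ¬ HaveCommonRightKernel P.fundamentalMatrix F)
    (hl : ¬ HaveCommonLeftKernel P.fundamentalMatrix F) :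
    S.IsTwoPlanes ∧ S.InCommonPlane P.fst.center P.snd.center := by
  obtain ⟨φ, hφ⟩ := P.exists_frame
  have hrank := P.two_le_rank_quadMat hm fun h => hr h.1
  rw [← φ.det_pull_eq_zero_iff] at hdet
  rw [← φ.mixedDet_pull_eq_zero_iff, hφ] at hm hm'
  rw [← φ.haveCommonRightKernel_pull_iff, hφ, haveCommonRightKernel_stdFund_iff] at hr
  rw [← φ.haveCommonLeftKernel_pull_iff, hφ, haveCommonLeftKernel_stdFund_iff] at hl
  rw [mixedDet_stdFund_left] at hm
  obtain ⟨l, m, hl0, hl2, hl3, hquad⟩ :=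
    exists_stdQuad_eq_vecMulVec_add_vecMulVec hm hm' hdet hr hl
  refine ⟨le_antisymm ?_ (hS ▸ hrank), φ.inCommonPlane_center S (m := m) hl0 hl2 hl3 ?_⟩
  · rw [hS, ← φ.rank_stdQuad_pull, hquad]
    exact rank_vecMulVec_add_vecMulVec_le _ _ _ _
  · rw [hS, φ.pullQuad_quadMat, hquad]

lemma Quadric.isRuled_of_det_eq_zero (hdet : F.det = 0) : S.IsRuled := by
  obtain ⟨r, hr, hFr⟩ := Matrix.exists_mulVec_eq_zero_iff.2 hdet
  obtain ⟨R, hR⟩ := P.snd.exists_right_inverse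
  obtain ⟨q, hq0, hq⟩ := P.snd.exists_mulVec_eq_zero
  have hRr : P.snd.mat *ᵥ (R *ᵥ r) = r := by rw [Matrix.mulVec_mulVec, hR, Matrix.one_mulVec]
  -- The line consists of the points whose second image is the right kernel vector of `F`.
  have hindep : LinearIndependent ℝ ![q, R *ᵥ r] := by
    rw [LinearIndependent.pair_iff' hq0]
    rintro a ha
    rw [← hRr, ← ha, Matrix.mulVec_smul, hq, smul_zero] at hr
    exact hr rfl
  refine ⟨Submodule.span ℝ (Set.range ![q, R *ᵥ r]),
    (finrank_span_eq_card hindep).trans (Fintype.card_fin 2), fun w hw => ?_⟩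
  rw [Matrix.range_cons_cons_empty, Submodule.mem_span_pair] at hw
  obtain ⟨a, b, rfl⟩ := hw
  rw [hS, P.dotProduct_quadMat_mulVec, Matrix.mulVec_add P.snd.mat, Matrix.mulVec_smul,
    Matrix.mulVec_smul, hq, hRr, smul_zero, zero_add, Matrix.mulVec_smul F, hFr, smul_zero,
    dotProduct_zero, mul_zero]

lemma Quadric.hasType_of_pencilType (hdet : F.det = 0) (hadj : F.adjugate ≠ 0)
    {t : QuadricType} (h : PencilType P.fundamentalMatrix F t) : S.HasType P t := by
  have hline := S.onCommonLine_center_iff hS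
  have hrank := congrArg Matrix.rank hS
  have hruled := S.isRuled_of_det_eq_zero hS hdet
  refine ⟨S.center_fst_mem_points hS, S.center_snd_mem_points hS, ?_⟩
  cases t
  case smoothNotOnLine =>
    exact ⟨hrank.trans (P.rank_quadMat_eq_four hdet h.2), hruled, hline.not.2 h.1⟩
  case smoothOnLine =>
    exact ⟨hrank.trans (P.rank_quadMat_eq_four hdet h.2), hruled, hline.2 h.1⟩
  case coneNotOnLine =>
    exact ⟨hrank.trans (P.rank_quadMat_eq_three hdet hadj h.2 h.1), hline.not.2 h.1⟩
  all_goals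
    obtain ⟨hm, hm', h⟩ := h
    have hfst := S.center_fst_mem_singularLocus_iff hS hm
    have hsnd := S.center_snd_mem_singularLocus_iff hS hm
  case coneVertex =>
    obtain ⟨hker, hone⟩ := h
    have hlt := P.rank_quadMat_lt_four hdet hm'
    have hle := not_lt.1 (mt (P.pencilHasRankLeOne_of_rank_quadMat_lt_three hker) hone)
    exact ⟨hrank.trans (le_antisymm (Nat.le_of_lt_succ hlt) hle), by rwa [hfst, hsnd]⟩
  case planesSamePlane =>
    obtain ⟨hplanes, hplane⟩ := S.isTwoPlanes_and_inCommonPlane_center hS hdet hm hm' h.1 h.2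
    exact ⟨hplanes, hplane, hfst.not.2 h.1, hsnd.not.2 h.2⟩
  case planesOneSingular =>
    obtain ⟨hker, hone⟩ := h
    exact ⟨hrank.trans (le_antisymm (P.rank_quadMat_le_two_of_pencilHasRankLeOne hone)
      (P.two_le_rank_quadMat hm ((xor_iff_or_and_not_and _ _).1 hker).2)), by rwa [hfst, hsnd]⟩
  case planesBothSingular =>
    obtain ⟨hker, hdeg⟩ := h
    have hle := not_le.1 ((P.rank_quadMat_le_one_iff hker).not.2 hdeg)
    exact ⟨hrank.trans (le_antisymm (P.rank_quadMat_le_two_of_haveCommonKernels hker) hle),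
      hfst.2 hker.1, hsnd.2 hker.2⟩
  case doublePlane =>
    obtain ⟨hker, hdeg⟩ := h
    exact le_antisymm (hrank.trans_le ((P.rank_quadMat_le_one_iff hker).2 hdeg))
      (rank_pos_of_ne_zero S.ne_zero)

end CriticalQuadric

lemma Quadric.onCommonLine_center_of_singular {S : Quadric} {P : CameraPair}
    (h₁ : P.fst.center ∈ S.points) (h₂ : P.snd.center ∈ S.points)
    (h : P.fst.center ∈ S.singularLocus ∨ P.snd.center ∈ S.singularLocus) :
    S.OnCommonLine P.fst.center P.snd.center := by
  obtain ⟨F, hS⟩ := P.exists_eq_quadMat S h₁ h₂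
  obtain ⟨φ⟩ := P.nonempty_frame
  rw [φ.onCommonLine_center_iff S h₁ h₂, hS, φ.pullQuad_quadMat]
  rw [φ.center_fst_mem_singularLocus, φ.center_snd_mem_singularLocus, hS, φ.pullQuad_quadMat] at h
  exact h.elim (congrFun · 2) (congrFun · 3)

lemma Quadric.HasType.unique {S : Quadric} {P : CameraPair} {t t' : QuadricType}
    (h : S.HasType P t) (h' : S.HasType P t') : t = t' := by
  have hline := S.onCommonLine_center_of_singular h.1 h.2.1
  replace h := h.2.2
  replace h' := h'.2.2
  cases t <;> cases t' <;>
    simp only [Quadric.IsSmooth, Quadric.IsCone, Quadric.IsTwoPlanes, Quadric.IsDoublePlane,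
      xor_def] at h h' <;>
    first
    | rfl
    | (exfalso; omega)
    | (exfalso; tauto)

/-! ### Camera pairs with a given fundamental matrix -/

lemma exists_isUnit_det_row_eq {K : Type*} [Field K] {l : Fin 3 → K} (hl : l ≠ 0) :
    ∃ A : Matrix (Fin 3) (Fin 3) K, IsUnit A.det ∧ A 2 = l := by
  have hli : LinearIndependent K ![l] := .of_subsingleton 0 hl
  obtain ⟨s, hs⟩ := exists_linearIndependent_cons_of_lt_finrank hli (by simp)
  obtain ⟨t, ht⟩ := exists_linearIndependent_cons_of_lt_finrank hs (by simp)
  refine ⟨Matrix.of ![t, s, l], ?_, rfl⟩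
  rw [← Matrix.isUnit_iff_isUnit_det, ← Matrix.linearIndependent_rows_iff_isUnit]
  exact ht

lemma adjugate_eq_zero_of_crossProduct_eq_zero {R : Type*} [CommRing R]
    {M : Matrix (Fin 3) (Fin 3) R} (h₂ : M 2 = 0) (h : M 0 ⨯₃ M 1 = 0) : M.adjugate = 0 := by
  have hrow (j : Fin 3) : M 2 j = 0 := congrFun h₂ j
  have hcross (i : Fin 3) : (M 0 ⨯₃ M 1) i = 0 := congrFun h i
  simp only [cross_apply, Fin.forall_fin_succ, Matrix.cons_val, Fin.succ_zero_eq_one,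
    Fin.succ_one_eq_two, IsEmpty.forall_iff, and_true] at hcross
  rw [Matrix.adjugate_fin_three]
  ext i j
  fin_cases i <;> fin_cases j <;> simp [hrow] <;> grind

lemma exists_mul_mul_eq_stdFund {F : Matrix (Fin 3) (Fin 3) ℝ} (hdet : F.det = 0)
    (hadj : F.adjugate ≠ 0) :
    ∃ X Y : Matrix (Fin 3) (Fin 3) ℝ, IsUnit X.det ∧ IsUnit Y.det ∧ X * F * Y = stdFund := by
  obtain ⟨l, hl, hlF⟩ := Matrix.exists_vecMul_eq_zero_iff.2 hdet
  obtain ⟨X, hX, rfl⟩ := exists_isUnit_det_row_eq hl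
  have hrow : (X * F) 2 = 0 := hlF
  set M := X * F with hM
  have hcross : M 0 ⨯₃ M 1 ≠ 0 := fun h => hadj <| by
    rw [← adjugate_mul_mul_eq_zero_iff F hX (B := 1) (by simp), Matrix.mul_one, ← hM]
    exact adjugate_eq_zero_of_crossProduct_eq_zero hrow h
  let G : Matrix (Fin 3) (Fin 3) ℝ := Matrix.of ![-M 1, M 0, M 0 ⨯₃ M 1]
  have hG : IsUnit G.det := by
    have hdetG : G.det = (M 0 ⨯₃ M 1) ⬝ᵥ (M 0 ⨯₃ M 1) := by
      rw [Matrix.det_fin_three, cross_apply]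
      simp [G, dotProduct, Fin.sum_univ_three, cross_apply]
      ring
    rw [hdetG, isUnit_iff_ne_zero]
    exact dotProduct_self_eq_zero.not.2 hcross
  have hMG : M = stdFund * G := by
    ext i j
    have hj := congrFun hrow j
    fin_cases i <;> simp_all [Matrix.mul_apply, Fin.sum_univ_three, stdFund, G]
  refine ⟨X, G⁻¹, hX, Matrix.isUnit_nonsing_inv_det _ hG, ?_⟩
  rw [← hM, hMG, Matrix.mul_nonsing_inv_cancel_right _ _ hG]

lemma rank_stdFst : stdFst.rank = 3 := by
  refine le_antisymm stdFst.rank_le_height ?_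
  refine card_le_rank_of_det_submatrix_ne_zero id ![0, 1, 2] ?_
  rw [Matrix.det_fin_three]
  simp [stdFst]

lemma rank_stdSnd : stdSnd.rank = 3 := by
  refine le_antisymm stdSnd.rank_le_height ?_
  refine card_le_rank_of_det_submatrix_ne_zero id ![0, 1, 3] ?_
  rw [Matrix.det_fin_three]
  simp [stdSnd]

lemma exists_cameraPair_eq_mul_std {X Y : Matrix (Fin 3) (Fin 3) ℝ} (hX : IsUnit X.det)
    (hY : IsUnit Y.det) : ∃ Q : CameraPair, Q.fst.mat = X * stdFst ∧ Q.snd.mat = Y * stdSnd := by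
  let C : Camera := ⟨X * stdFst, by
    rw [Matrix.rank_mul_eq_right_of_isUnit_det _ _ hX, rank_stdFst]⟩
  let D : Camera := ⟨Y * stdSnd, by
    rw [Matrix.rank_mul_eq_right_of_isUnit_det _ _ hY, rank_stdSnd]⟩
  have hC : C.mat *ᵥ Pi.single 3 1 = 0 := by
    rw [← Matrix.mulVec_mulVec, stdFst_mulVec_single, Matrix.mulVec_zero]
  have hD : D.mat *ᵥ Pi.single 2 1 = 0 := by
    rw [← Matrix.mulVec_mulVec, stdSnd_mulVec_single, Matrix.mulVec_zero]
  refine ⟨⟨C, D, fun h => ?_⟩, rfl, rfl⟩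
  rw [C.center_eq_mk_cxVec (by simp) hC, D.center_eq_mk_cxVec (by simp) hD,
    Projectivization.mk_eq_mk_iff'] at h
  obtain ⟨a, ha⟩ := h
  simpa [cxVec] using congrFun ha 3

lemma exists_cameraPair {F : Matrix (Fin 3) (Fin 3) ℝ} (hdet : F.det = 0) (hadj : F.adjugate ≠ 0) :
    ∃ Q : CameraPair, ∃ c : ℝ, c ≠ 0 ∧ Q.fundamentalMatrix = c • F := by
  obtain ⟨X, Y, hX, hY, h⟩ := exists_mul_mul_eq_stdFund hdet hadj
  obtain ⟨Q, hQ₁, hQ₂⟩ := exists_cameraPair_eq_mul_std (Matrix.isUnit_det_transpose _ hX) hY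
  let φ : Q.Frame := ⟨1, Xᵀ, Y, by simp, Matrix.isUnit_det_transpose _ hX, hY,
    by rw [hQ₁, Matrix.mul_one], by rw [hQ₂, Matrix.mul_one]⟩
  have hF : φ.pull F = stdFund := by
    rw [CameraPair.Frame.pull, Matrix.transpose_transpose, h]
  obtain ⟨c, hc, hQ⟩ := φ.exists_pull_fundamentalMatrix_eq_smul
  refine ⟨Q, c, hc, φ.pull_bijective.injective ?_⟩
  rw [hQ, φ.pull_smul, hF]

/-! ### A fundamental matrix determines its camera pair up to projective transformations -/

section Automorphism

variable {X Y : Matrix (Fin 3) (Fin 3) ℝ} {k : ℝ}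

lemma transpose_mul_stdFund_mul_apply (X Y : Matrix (Fin 3) (Fin 3) ℝ) (i j : Fin 3) :
    (Xᵀ * stdFund * Y) i j = X 0 i * Y 1 j - X 1 i * Y 0 j := by
  simp [Matrix.mul_apply, Fin.sum_univ_three, stdFund]
  ring

lemma minor_mul_minor_of_transpose_mul_stdFund_mul (h : Xᵀ * stdFund * Y = k • stdFund) :
    (X 0 0 * X 1 1 - X 0 1 * X 1 0) * (Y 0 0 * Y 1 1 - Y 0 1 * Y 1 0) = k ^ 2 := by
  have hentry (i j) : X 0 i * Y 1 j - X 1 i * Y 0 j = k * stdFund i j := by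
    rw [← transpose_mul_stdFund_mul_apply, h, Matrix.smul_apply, smul_eq_mul]
  have h₀₀ := hentry 0 0
  have h₀₁ := hentry 0 1
  have h₁₀ := hentry 1 0
  have h₁₁ := hentry 1 1
  simp only [stdFund, Matrix.of_apply, Matrix.cons_val] at h₀₀ h₀₁ h₁₀ h₁₁
  grind

lemma right_col_two_eq_zero (hk : k ≠ 0) (h : Xᵀ * stdFund * Y = k • stdFund) :
    Y 0 2 = 0 ∧ Y 1 2 = 0 := by
  have hentry (i) : X 0 i * Y 1 2 - X 1 i * Y 0 2 = k * stdFund i 2 := by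
    rw [← transpose_mul_stdFund_mul_apply, h, Matrix.smul_apply, smul_eq_mul]
  have hminor := left_ne_zero_of_mul
    (minor_mul_minor_of_transpose_mul_stdFund_mul h ▸ pow_ne_zero 2 hk)
  have h₀₂ := hentry 0
  have h₁₂ := hentry 1
  simp only [stdFund, Matrix.of_apply, Matrix.cons_val] at h₀₂ h₁₂
  grind

/-- Automorphisms of `stdFund` act in proportional ways on the two pencils of epipolar lines. -/
lemma minor_mul_right_apply (h : Xᵀ * stdFund * Y = k • stdFund) (i j : Fin 2) :
    (X 0 0 * X 1 1 - X 0 1 * X 1 0) * Y i.castSucc j.castSucc =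
      k * X i.castSucc j.castSucc := by
  have hentry (i j) : X 0 i * Y 1 j - X 1 i * Y 0 j = k * stdFund i j := by
    rw [← transpose_mul_stdFund_mul_apply, h, Matrix.smul_apply, smul_eq_mul]
  have h₀ := hentry 0 j.castSucc
  have h₁ := hentry 1 j.castSucc
  fin_cases i <;> fin_cases j <;>
    simp [stdFund] at h₀ h₁ ⊢ <;> grind

lemma transpose_mul_stdFund_mul_swap (h : Xᵀ * stdFund * Y = k • stdFund) :
    Yᵀ * stdFund * X = k • stdFund := by
  simpa [Matrix.transpose_mul, Matrix.mul_assoc, transpose_stdFund] using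
    congrArg Matrix.transpose h

lemma exists_mul_eq_mul_std (hk : k ≠ 0) (hX : IsUnit X.det) (hY : IsUnit Y.det)
    (h : Xᵀ * stdFund * Y = k • stdFund) :
    ∃ (L : Matrix (Fin 4) (Fin 4) ℝ) (m : ℝ), L.det ≠ 0 ∧ m ≠ 0 ∧ stdFst * L = X * stdFst ∧
      stdSnd * L = m • (Y * stdSnd) := by
  obtain ⟨hY₀, hY₁⟩ := right_col_two_eq_zero hk h
  obtain ⟨hX₀, hX₁⟩ := right_col_two_eq_zero hk (transpose_mul_stdFund_mul_swap h)
  set d := X 0 0 * X 1 1 - X 0 1 * X 1 0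
  have hd0 : d ≠ 0 := left_ne_zero_of_mul
    (minor_mul_minor_of_transpose_mul_stdFund_mul h ▸ pow_ne_zero 2 hk)
  have hblock (i j : Fin 2) : d / k * Y i.castSucc j.castSucc = X i.castSucc j.castSucc := by
    rw [div_mul_eq_mul_div, minor_mul_right_apply h, mul_div_cancel_left₀ _ hk]
  have hX₂ : X 2 2 ≠ 0 := fun h0 => hX.ne_zero (by rw [Matrix.det_fin_three, hX₀, hX₁, h0]; ring)
  have hY₂ : Y 2 2 ≠ 0 := fun h0 => hY.ne_zero (by rw [Matrix.det_fin_three, hY₀, hY₁, h0]; ring)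
  let L : Matrix (Fin 4) (Fin 4) ℝ :=
    !![X 0 0, X 0 1, 0, 0;
       X 1 0, X 1 1, 0, 0;
       X 2 0, X 2 1, X 2 2, 0;
       d / k * Y 2 0, d / k * Y 2 1, 0, d / k * Y 2 2]
  have hL : L.det = d * X 2 2 * (d / k * Y 2 2) := by
    rw [Matrix.det_succ_row_zero]
    simp [L, Fin.sum_univ_four, Matrix.det_fin_three, Fin.succAbove]
    ring
  refine ⟨L, d / k, ?_, div_ne_zero hd0 hk, ?_, ?_⟩
  · rw [hL]
    exact mul_ne_zero (mul_ne_zero hd0 hX₂) (mul_ne_zero (div_ne_zero hd0 hk) hY₂)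
  · ext i j
    fin_cases i <;> fin_cases j <;>
      simp [L, Matrix.mul_apply, Fin.sum_univ_succ, stdFst, hX₀, hX₁]
  · have h₀₀ : d / k * Y 0 0 = X 0 0 := hblock 0 0
    have h₀₁ : d / k * Y 0 1 = X 0 1 := hblock 0 1
    have h₁₀ : d / k * Y 1 0 = X 1 0 := hblock 1 0
    have h₁₁ : d / k * Y 1 1 = X 1 1 := hblock 1 1
    ext i j
    fin_cases i <;> fin_cases j <;>
      simp [L, Matrix.mul_apply, Fin.sum_univ_succ, stdSnd, h₀₀, h₀₁, h₁₀, h₁₁, hY₀, hY₁]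

end Automorphism

lemma isUnit_det_inv_mul {R n : Type*} [CommRing R] [Fintype n] [DecidableEq n]
    {A B : Matrix n n R} (hA : IsUnit A.det) (hB : IsUnit B.det) : IsUnit (A⁻¹ * B).det := by
  rw [Matrix.det_mul]
  exact (Matrix.isUnit_nonsing_inv_det _ hA).mul hB

namespace CameraPair

lemma SameFundamental.symm {P Q : CameraPair} (h : P.SameFundamental Q) : Q.SameFundamental P := by
  obtain ⟨c, hc, h⟩ := h
  exact ⟨c⁻¹, inv_ne_zero hc, by rw [h, inv_smul_smul₀ hc]⟩

lemma sameFundamental_iff_quadMat_eq_zero (P Q : CameraPair) :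
    P.SameFundamental Q ↔ P.quadMat Q.fundamentalMatrix = 0 := by
  rw [P.quadMat_eq_zero_iff]
  refine ⟨fun ⟨c, _, h⟩ => ⟨c, h⟩, fun ⟨c, h⟩ => ⟨c, ?_, h⟩⟩
  rintro rfl
  exact Q.fundamentalMatrix_ne_zero (by rw [h, zero_smul])

lemma quadMat_eq_smul_of_mul_eq_smul {P Q : CameraPair} {H : Matrix (Fin 4) (Fin 4) ℝ} {a b : ℝ}
    (h₁ : P.fst.mat = a • (Q.fst.mat * H)) (h₂ : P.snd.mat = b • (Q.snd.mat * H))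
    (F : Matrix (Fin 3) (Fin 3) ℝ) : P.quadMat F = (a * b) • (Hᵀ * Q.quadMat F * H) := by
  simp only [quadMat, h₁, h₂, Matrix.transpose_smul, Matrix.transpose_mul, Matrix.smul_mul,
    Matrix.mul_smul, Matrix.mul_add, Matrix.add_mul, Matrix.mul_assoc, smul_add, smul_smul,
    Matrix.transpose_transpose, mul_comm b a]

lemma SameFundamental.exists_mul_eq_smul {Q R : CameraPair} (h : Q.SameFundamental R) :
    ∃ (H : GL (Fin 4) ℝ) (m : ℝ), m ≠ 0 ∧
      R.fst.mat * (H : Matrix (Fin 4) (Fin 4) ℝ) = Q.fst.mat ∧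
      R.snd.mat * (H : Matrix (Fin 4) (Fin 4) ℝ) = m • Q.snd.mat := by
  obtain ⟨c, hc, hQR⟩ := h
  obtain ⟨φ, hφ⟩ := Q.exists_frame
  obtain ⟨ψ, hψ⟩ := R.exists_frame
  have hleft : ψ.left * (ψ.left⁻¹ * φ.left) = φ.left :=
    Matrix.mul_nonsing_inv_cancel_left _ _ ψ.isUnit_left
  have hright : ψ.right * (ψ.right⁻¹ * φ.right) = φ.right :=
    Matrix.mul_nonsing_inv_cancel_left _ _ ψ.isUnit_right
  have hauto : (ψ.left⁻¹ * φ.left)ᵀ * stdFund * (ψ.right⁻¹ * φ.right) = c • stdFund :=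
    calc (ψ.left⁻¹ * φ.left)ᵀ * stdFund * (ψ.right⁻¹ * φ.right)
      _ = (ψ.left * (ψ.left⁻¹ * φ.left))ᵀ * R.fundamentalMatrix *
            (ψ.right * (ψ.right⁻¹ * φ.right)) := by
          rw [← hψ, Frame.pull]
          simp only [Matrix.transpose_mul, Matrix.mul_assoc]
      _ = c • φ.pull Q.fundamentalMatrix := by rw [hleft, hright, hQR, ← φ.pull_smul, Frame.pull]
      _ = c • stdFund := by rw [hφ]
  obtain ⟨L, m, hL, hm, h₁, h₂⟩ := exists_mul_eq_mul_std hc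
    (isUnit_det_inv_mul ψ.isUnit_left φ.isUnit_left)
    (isUnit_det_inv_mul ψ.isUnit_right φ.isUnit_right) hauto
  have hH : (ψ.space * L * φ.space⁻¹).det ≠ 0 := by
    rw [Matrix.det_mul, Matrix.det_mul]
    exact mul_ne_zero (mul_ne_zero ψ.isUnit_space.ne_zero hL)
      (Matrix.isUnit_nonsing_inv_det _ φ.isUnit_space).ne_zero
  refine ⟨Matrix.GeneralLinearGroup.mkOfDetNeZero _ hH, m, hm, ?_, ?_⟩
  · change R.fst.mat * (ψ.space * L * φ.space⁻¹) = _
    rw [← Matrix.mul_assoc, ← Matrix.mul_assoc, ψ.fst_mul, Matrix.mul_assoc ψ.left, h₁,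
      ← Matrix.mul_assoc, hleft, ← φ.fst_mul, Matrix.mul_nonsing_inv_cancel_right _ _
      φ.isUnit_space]
  · change R.snd.mat * (ψ.space * L * φ.space⁻¹) = _
    rw [← Matrix.mul_assoc, ← Matrix.mul_assoc, ψ.snd_mul, Matrix.mul_assoc ψ.right, h₂,
      Matrix.mul_smul, ← Matrix.mul_assoc, hright, ← φ.snd_mul, Matrix.smul_mul,
      Matrix.mul_nonsing_inv_cancel_right _ _ φ.isUnit_space]

end CameraPair

lemma Camera.sees_projAct_iff {C D : Camera} {H : GL (Fin 4) ℝ} {a : ℝ} (ha : a ≠ 0)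
    (h : D.mat * (H : Matrix (Fin 4) (Fin 4) ℝ) = a • C.mat) (x : Space) (u : Image) :
    D.Sees (projAct H x) u ↔ C.Sees x u := by
  obtain ⟨v, hv, rfl⟩ : ∃ v hv, x = Projectivization.mk ℂ v hv :=
    ⟨x.rep, x.rep_nonzero, x.mk_rep.symm⟩
  obtain ⟨w, hw, rfl⟩ : ∃ w hw, u = Projectivization.mk ℂ w hw :=
    ⟨u.rep, u.rep_nonzero, u.mk_rep.symm⟩
  have ha' : (a : ℂ) ≠ 0 := by exact_mod_cast ha
  rw [projAct, Projectivization.map_mk, Camera.sees_mk_mk_iff, Camera.sees_mk_mk_iff,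
    Matrix.mulVecLin_apply, Matrix.mulVec_mulVec, ← cx_mul, h, cx_smul, Matrix.smul_mulVec]
  constructor
  · rintro ⟨b, hb⟩
    exact ⟨(a : ℂ)⁻¹ * b, by rw [mul_smul, hb, inv_smul_smul₀ ha']⟩
  · rintro ⟨b, hb⟩
    exact ⟨a * b, by rw [mul_smul, hb]⟩

lemma Configuration.Equivalent.sameFundamental {c d : Configuration} (h : c.Equivalent d) :
    c.cameras.SameFundamental d.cameras := by
  obtain ⟨H, -, ⟨a, ha, h₁⟩, ⟨b, hb, h₂⟩⟩ := h
  refine CameraPair.SameFundamental.symm ?_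
  rw [CameraPair.sameFundamental_iff_quadMat_eq_zero,
    CameraPair.quadMat_eq_smul_of_mul_eq_smul (P := d.cameras) (Q := c.cameras) (H := ↑H⁻¹)
      (by rw [h₁, inv_smul_smul₀ ha]) (by rw [h₂, inv_smul_smul₀ hb]),
    CameraPair.quadMat_fundamentalMatrix, Matrix.mul_zero, Matrix.zero_mul, smul_zero]

lemma CameraPair.SameFundamental.equivalent {Q R : CameraPair} (h : Q.SameFundamental R)
    (P : CameraPair) : (Configuration.mk Q (criticalPoints Q P)).Equivalent
      (Configuration.mk R (criticalPoints R P)) := by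
  obtain ⟨H, m, hm, h₁, h₂⟩ := h.exists_mul_eq_smul
  rw [← one_smul ℝ Q.fst.mat] at h₁
  have hsees (x : Space) (s : Image × Image) : R.Sees (projAct H x) s ↔ Q.Sees x s :=
    and_congr (Camera.sees_projAct_iff one_ne_zero h₁ x s.1) (Camera.sees_projAct_iff hm h₂ x s.2)
  have hinv {C D : Matrix (Fin 3) (Fin 4) ℝ} {a : ℝ} (ha : a ≠ 0)
      (h : D * (H : Matrix (Fin 4) (Fin 4) ℝ) = a • C) :
      ∃ b : ℝ, b ≠ 0 ∧ C * (↑H⁻¹ : Matrix (Fin 4) (Fin 4) ℝ) = b • D := by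
    simpa only [inv_inv] using scale_symm (H := H⁻¹) ⟨a, ha, by rwa [inv_inv]⟩
  refine ⟨H, ?_, hinv one_ne_zero h₁, hinv hm h₂⟩
  have hH : projAct H ∘ projAct H⁻¹ = id := by rw [← projAct_mul, mul_inv_cancel, projAct_one]
  refine Set.Subset.antisymm ?_ fun x ⟨y, s, hx, hy⟩ => ?_
  · rintro _ ⟨x, ⟨y, s, hx, hy⟩, rfl⟩
    exact ⟨y, s, (hsees x s).2 hx, hy⟩
  · rw [← id_eq x, ← congrFun hH x, Function.comp_apply, hsees] at hx
    exact ⟨projAct H⁻¹ x, ⟨y, s, hx, hy⟩, congrFun hH x⟩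

/-! ### Conjugates of a critical quadric -/

section Conjugates

variable {P Q : CameraPair} {S : Quadric} {t : QuadricType} {d : Configuration}

/-- The quadric of the critical points of `P` with respect to `Q`. -/
def criticalQuadric (h : ¬ P.SameFundamental Q) : Quadric where
  mat := P.quadMat Q.fundamentalMatrix
  symm := P.isSymm_quadMat _
  ne_zero := (P.sameFundamental_iff_quadMat_eq_zero Q).not.1 h

lemma points_criticalQuadric (h : ¬ P.SameFundamental Q) :
    (criticalQuadric h).points = criticalPoints P Q := by
  ext x
  induction x using Projectivization.ind with
  | h v hv => rw [Quadric.mk_mem_points, CameraPair.mk_mem_criticalPoints_iff, criticalQuadric]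

lemma hasType_criticalQuadric (h : ¬ P.SameFundamental Q)
    (ht : PencilType P.fundamentalMatrix Q.fundamentalMatrix t) : (criticalQuadric h).HasType P t :=
  Quadric.hasType_of_pencilType rfl Q.det_fundamentalMatrix Q.adjugate_fundamentalMatrix_ne_zero ht

lemma Quadric.HasType.of_mat_eq_smul {S' : Quadric} {r : ℝ} (hr : r ≠ 0)
    (h : S'.mat = r • S.mat) (hS : S.HasType P t) : S'.HasType P t := by
  have hpoints := Quadric.points_eq_of_mat_eq_smul hr h
  have hsingular : S'.singularLocus = S.singularLocus := by
    ext x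
    simp only [Quadric.singularLocus, Set.mem_ofPred_eq, h, cx_smul, Matrix.smul_mulVec,
      smul_eq_zero, Complex.ofReal_eq_zero, hr, false_or]
  have hrank : S'.mat.rank = S.mat.rank := by
    rw [h, Matrix.rank_smul_of_mem_nonZeroDivisors _ (mem_nonZeroDivisors_of_ne_zero hr)]
  have hruled : S'.IsRuled ↔ S.IsRuled := by
    simp only [Quadric.IsRuled, h, Matrix.smul_mulVec, dotProduct_smul, smul_eq_zero, hr, false_or]
  cases t <;>
    simpa only [Quadric.HasType, Quadric.IsSmooth, Quadric.IsCone, Quadric.IsTwoPlanes,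
      Quadric.IsDoublePlane, Quadric.OnCommonLine, Quadric.InCommonPlane, hpoints, hsingular,
      hrank, hruled] using hS

lemma Quadric.exists_quadMat_eq_smul_of_mem_conjugates (hd : d ∈ S.conjugates P) :
    ∃ r : ℝ, r ≠ 0 ∧ P.quadMat d.cameras.fundamentalMatrix = r • S.mat := by
  obtain ⟨hne, hS, -⟩ := hd
  exact Quadric.exists_mat_eq_smul_of_points_eq (hS.trans (points_criticalQuadric hne).symm)

lemma Quadric.exists_hasType_conjugate (hS : S.HasType P t) (hd : d ∈ S.conjugates P) :
    ∃ S' : Quadric, d.points = S'.points ∧ S'.HasType d.cameras t.conjugate := by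
  obtain ⟨r, hr, hrS⟩ := Quadric.exists_quadMat_eq_smul_of_mem_conjugates hd
  obtain ⟨hne, -, hpoints⟩ := hd
  obtain ⟨t', ht'⟩ := exists_pencilType P.fundamentalMatrix d.cameras.fundamentalMatrix
  have hcrit : (criticalQuadric hne).HasType P t := hS.of_mat_eq_smul hr hrS
  obtain rfl : t' = t := (hasType_criticalQuadric hne ht').unique hcrit
  have hne' : ¬ d.cameras.SameFundamental P := fun h => hne h.symm
  exact ⟨criticalQuadric hne', hpoints.trans (points_criticalQuadric hne').symm,
    hasType_criticalQuadric hne' ht'.swap⟩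

lemma nontrivialConjugate_of_subset_criticalPoints (hne : ¬ P.SameFundamental Q) {X : Set Space}
    (hX : X ⊆ criticalPoints P Q) :
    (Configuration.mk P X).NontrivialConjugate
      ⟨Q, {y | ∃ x ∈ X, ∃ s, P.Sees x s ∧ Q.Sees y s}⟩ := by
  refine ⟨⟨⟨{s | (∃ x ∈ X, P.Sees x s) ∧ ∃ y, Q.Sees y s}, ⟨?_, ?_⟩, ?_, ?_⟩,
    fun h => hne h.sameFundamental⟩, hne⟩
  · intro x hx
    obtain ⟨y, s, hxs, hys⟩ := hX hx
    exact ⟨s, ⟨⟨x, hx, hxs⟩, ⟨y, hys⟩⟩, hxs⟩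
  · rintro s ⟨⟨x, hx, hxs⟩, -⟩
    exact ⟨x, hx, hxs⟩
  · rintro y ⟨x, hx, s, hxs, hys⟩
    exact ⟨s, ⟨⟨x, hx, hxs⟩, ⟨y, hys⟩⟩, hys⟩
  · rintro s ⟨⟨x, hx, hxs⟩, ⟨y, hys⟩⟩
    exact ⟨y, ⟨x, hx, s, hxs, hys⟩, hys⟩

lemma Quadric.nontrivialConjugate_of_mem_conjugates (hd : d ∈ S.conjugates P) :
    (Configuration.mk P S.points).NontrivialConjugate d := by
  obtain ⟨hne, hS, hY⟩ := hd
  have hd' : d = ⟨d.cameras, {y | ∃ x ∈ S.points, ∃ s, P.Sees x s ∧ d.cameras.Sees y s}⟩ := by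
    ext y
    · rfl
    · rw [hY, hS]
      exact ⟨fun ⟨x, s, hys, hxs⟩ => ⟨x, ⟨y, s, hxs, hys⟩, s, hxs, hys⟩,
        fun ⟨x, _, s, hxs, hys⟩ => ⟨x, s, hys, hxs⟩⟩
  rw [hd']
  exact nontrivialConjugate_of_subset_criticalPoints hne hS.subset

lemma Configuration.NontrivialConjugate.subset_criticalPoints {c : Configuration}
    (h : c.NontrivialConjugate d) :
    c.points ⊆ criticalPoints c.cameras d.cameras ∧
      d.points ⊆ criticalPoints d.cameras c.cameras := by
  obtain ⟨⟨⟨T, ⟨hcT, hTc⟩, hdT, hTd⟩, -⟩, -⟩ := h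
  constructor
  · intro x hx
    obtain ⟨s, hs, hxs⟩ := hcT x hx
    obtain ⟨y, -, hys⟩ := hTd s hs
    exact ⟨y, s, hxs, hys⟩
  · intro y hy
    obtain ⟨s, hs, hys⟩ := hdT y hy
    obtain ⟨x, -, hxs⟩ := hTc s hs
    exact ⟨x, s, hys, hxs⟩

lemma Quadric.exists_mem_conjugates_of_nontrivialConjugate (hS : 2 ≤ S.mat.rank)
    (hd : (Configuration.mk P S.points).NontrivialConjugate d) :
    ∃ e ∈ S.conjugates P, e.cameras = d.cameras ∧ d.points ⊆ e.points := by
  have hne : ¬ P.SameFundamental d.cameras := hd.2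
  obtain ⟨hS', hY⟩ := hd.subset_criticalPoints
  rw [← points_criticalQuadric hne] at hS'
  obtain ⟨r, hr, h⟩ := Quadric.exists_mat_eq_smul_of_points_subset hS hS'
  refine ⟨⟨d.cameras, criticalPoints d.cameras P⟩, ⟨hne, ?_, rfl⟩, rfl, hY⟩
  rw [← points_criticalQuadric hne, Quadric.points_eq_of_mat_eq_smul hr h]

lemma Quadric.HasType.two_le_rank (hS : S.HasType P t) (ht : t ≠ .doublePlane) :
    2 ≤ S.mat.rank := by
  replace hS := hS.2.2
  cases t <;>
    simp only [Quadric.IsSmooth, Quadric.IsCone, Quadric.IsTwoPlanes, ne_eq, not_true_eq_false]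
      at hS ht <;> omega

end Conjugates

/-! ### Matrices of rank two in a pencil -/

section RankTwoSet

lemma adjugate_add_smul {R : Type*} [CommRing R] (F G : Matrix (Fin 3) (Fin 3) R) (x : R) :
    (F + x • G).adjugate =
      F.adjugate + x • ((F + G).adjugate - F.adjugate - G.adjugate) + x ^ 2 • G.adjugate := by
  simp only [Matrix.adjugate_fin_three]
  ext i j
  fin_cases i <;> fin_cases j <;> simp <;> ring

variable {K : Type*} [Field K] (F G : Matrix (Fin 3) (Fin 3) K)

/-- The parameters of the matrices of rank two in the affine pencil `F + x • G`. If `G` is the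
fundamental matrix of a camera pair, these matrices are, up to scale, the fundamental matrices of
the conjugates of the quadric given by `F`. -/
def rankTwoSet : Set K := {x | (F + x • G).det = 0 ∧ (F + x • G).adjugate ≠ 0}

variable {F G}

lemma infinite_rankTwoSet [Infinite K] (hG : G.adjugate ≠ 0) (hdet : ∀ x : K, (F + x • G).det = 0) :
    (rankTwoSet F G).Infinite := by
  obtain ⟨i, j, hij⟩ : ∃ i j, G.adjugate i j ≠ 0 := by
    by_contra! h
    exact hG (Matrix.ext h)
  let p : Polynomial K := .C (G.adjugate i j) * .X ^ 2 +
    .C (((F + G).adjugate - F.adjugate - G.adjugate) i j) * .X + .C (F.adjugate i j)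
  have hp : p ≠ 0 := fun h0 => by
    have hdegree : p.degree = 2 := Polynomial.degree_quadratic hij
    rw [h0, Polynomial.degree_zero] at hdegree
    exact absurd hdegree (by decide)
  have heval (x : K) : p.eval x = (F + x • G).adjugate i j := by
    rw [adjugate_add_smul]
    simp only [p, Polynomial.eval_add, Polynomial.eval_mul, Polynomial.eval_C, Polynomial.eval_pow,
      Polynomial.eval_X, Matrix.add_apply, Matrix.smul_apply, smul_eq_mul]
    ring
  refine (Polynomial.finite_setOfPred_isRoot hp).infinite_compl.mono fun x hx => ?_
  exact ⟨hdet x, fun h0 => hx ((heval x).trans (congrFun₂ h0 i j))⟩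

end RankTwoSet

namespace CameraPair

variable (P : CameraPair) (F : Matrix (Fin 3) (Fin 3) ℝ)

lemma det_add_smul_fundamentalMatrix (x : ℝ) :
    (F + x • P.fundamentalMatrix).det =
      mixedDet P.fundamentalMatrix F * (x * x) + mixedDet F P.fundamentalMatrix * x + F.det := by
  rw [det_add_smul, P.det_fundamentalMatrix]
  ring

lemma exists_discrim_eq : ∃ c : ℝ, 0 < c ∧
    discrim (mixedDet P.fundamentalMatrix F) (mixedDet F P.fundamentalMatrix) F.det =
      c * (P.quadMat F).det := by
  obtain ⟨φ, hφ⟩ := P.exists_frame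
  have hmixed (G H : Matrix (Fin 3) (Fin 3) ℝ) :
      mixedDet (φ.pull G) (φ.pull H) = φ.left.det * φ.right.det * mixedDet G H := by
    rw [Frame.pull, Frame.pull, mixedDet_mul_mul, Matrix.det_transpose]
  have hquad : φ.space.det ^ 2 * (P.quadMat F).det = (stdQuad (φ.pull F)).det := by
    rw [← φ.pullQuad_quadMat, Frame.pullQuad, Matrix.det_mul, Matrix.det_mul, Matrix.det_transpose]
    ring
  rw [det_stdQuad, ← hφ, hmixed, hmixed, Frame.pull, Matrix.det_mul, Matrix.det_mul,
    Matrix.det_transpose] at hquad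
  have hk : φ.left.det * φ.right.det ≠ 0 := mul_ne_zero φ.isUnit_left.ne_zero φ.isUnit_right.ne_zero
  have hs : φ.space.det ≠ 0 := φ.isUnit_space.ne_zero
  refine ⟨(φ.space.det / (φ.left.det * φ.right.det)) ^ 2, by positivity, ?_⟩
  rw [div_pow, div_mul_eq_mul_div, hquad, eq_div_iff (pow_ne_zero 2 hk), discrim]
  ring

variable {P F}

lemma mixedDet_fundamentalMatrix_right_eq_zero (hA : mixedDet P.fundamentalMatrix F = 0)
    (hquad : (P.quadMat F).det = 0) : mixedDet F P.fundamentalMatrix = 0 := by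
  obtain ⟨c, -, hdiscrim⟩ := P.exists_discrim_eq F
  rwa [hA, hquad, mul_zero, discrim, mul_zero, zero_mul, sub_zero, sq_eq_zero_iff] at hdiscrim

lemma adjugate_add_smul_fundamentalMatrix_ne_zero (h : 3 ≤ (P.quadMat F).rank) (x : ℝ) :
    (F + x • P.fundamentalMatrix).adjugate ≠ 0 := by
  intro h0
  have hrank := P.rank_quadMat_le_two h0
  rw [add_comm, P.quadMat_smul_fundamentalMatrix_add] at hrank
  omega

lemma rankTwoSet_eq_setOf_quadratic (h : 3 ≤ (P.quadMat F).rank) :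
    rankTwoSet F P.fundamentalMatrix = {x | mixedDet P.fundamentalMatrix F * (x * x) +
      mixedDet F P.fundamentalMatrix * x + F.det = 0} := by
  ext x
  rw [Set.mem_ofPred_eq, ← det_add_smul_fundamentalMatrix]
  exact and_iff_left (adjugate_add_smul_fundamentalMatrix_ne_zero h x)

lemma encard_rankTwoSet_of_det_pos (hA : mixedDet P.fundamentalMatrix F ≠ 0)
    (hquad : 0 < (P.quadMat F).det) : (rankTwoSet F P.fundamentalMatrix).encard = 2 := by
  obtain ⟨c, hc, hdiscrim⟩ := P.exists_discrim_eq F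
  have hpos := hdiscrim ▸ mul_pos hc hquad
  have hrank := (Matrix.rank_of_det_ne_zero hquad.ne').trans (Fintype.card_fin 4)
  rw [rankTwoSet_eq_setOf_quadratic (by omega)]
  simp only [quadratic_eq_zero_iff hA (Real.mul_self_sqrt hpos.le).symm]
  refine Set.encard_pair fun h => (Real.sqrt_pos.2 hpos).ne' ?_
  rw [div_left_inj' (mul_ne_zero two_ne_zero hA)] at h
  linarith

lemma encard_rankTwoSet_of_mixedDet_eq_zero (hA : mixedDet P.fundamentalMatrix F = 0)
    (hquad : (P.quadMat F).det ≠ 0) : (rankTwoSet F P.fundamentalMatrix).encard = 1 := by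
  obtain ⟨c, hc, hdiscrim⟩ := P.exists_discrim_eq F
  have hB : mixedDet F P.fundamentalMatrix ≠ 0 := by
    intro hB
    rw [hA, hB, discrim, mul_zero, zero_mul, zero_pow two_ne_zero, sub_zero] at hdiscrim
    exact mul_ne_zero hc.ne' hquad hdiscrim.symm
  have hrank := (Matrix.rank_of_det_ne_zero hquad).trans (Fintype.card_fin 4)
  rw [rankTwoSet_eq_setOf_quadratic (by omega), Set.encard_eq_one]
  refine ⟨-F.det / mixedDet F P.fundamentalMatrix, Set.ext fun x => ?_⟩
  rw [Set.mem_ofPred_eq, Set.mem_singleton_iff, eq_div_iff hB, hA, zero_mul, zero_add, mul_comm,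
    add_eq_zero_iff_eq_neg]

lemma encard_rankTwoSet_of_rank_eq_three (hA : mixedDet P.fundamentalMatrix F ≠ 0)
    (hrank : (P.quadMat F).rank = 3) : (rankTwoSet F P.fundamentalMatrix).encard = 1 := by
  obtain ⟨c, -, hdiscrim⟩ := P.exists_discrim_eq F
  have hquad := rank_lt_card_iff_det_eq_zero.1 (hrank.trans_lt (by decide))
  rw [hquad, mul_zero] at hdiscrim
  rw [rankTwoSet_eq_setOf_quadratic hrank.ge, Set.encard_eq_one]
  exact ⟨_, Set.ext (quadratic_eq_zero_iff_of_discrim_eq_zero hA hdiscrim)⟩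

lemma encard_rankTwoSet_eq_top (hA : mixedDet P.fundamentalMatrix F = 0)
    (hrank : (P.quadMat F).rank < 4) (hdet : F.det = 0) :
    (rankTwoSet F P.fundamentalMatrix).encard = ⊤ := by
  have hquad := rank_lt_card_iff_det_eq_zero.1 hrank
  have hB := mixedDet_fundamentalMatrix_right_eq_zero hA hquad
  refine Set.encard_eq_top_iff.2 (infinite_rankTwoSet P.adjugate_fundamentalMatrix_ne_zero
    fun x => ?_)
  rw [det_add_smul_fundamentalMatrix, hA, hB, hdet]
  ring

end CameraPair

section EncardRankTwoSet

namespace CameraPair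

variable {P : CameraPair} {F : Matrix (Fin 3) (Fin 3) ℝ}

lemma det_eq_zero_of_rank_quadMat_le_two (hA : mixedDet P.fundamentalMatrix F = 0)
    (hrank : (P.quadMat F).rank ≤ 2) : F.det = 0 := by
  have hB := mixedDet_fundamentalMatrix_right_eq_zero hA
    (rank_lt_card_iff_det_eq_zero.1 (hrank.trans_lt (by decide)))
  obtain ⟨φ, hφ⟩ := P.exists_frame
  rw [← φ.mixedDet_pull_eq_zero_iff, hφ] at hA hB
  rw [← φ.rank_stdQuad_pull] at hrank
  rw [← φ.det_pull_eq_zero_iff]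
  by_contra hdet
  have := three_le_rank_stdQuad_of_det hA hB hdet
  omega

lemma encard_rankTwoSet_of_rank_le_two (hA : mixedDet P.fundamentalMatrix F = 0)
    (hrank : (P.quadMat F).rank ≤ 2) : (rankTwoSet F P.fundamentalMatrix).encard = ⊤ :=
  encard_rankTwoSet_eq_top hA (by omega) (det_eq_zero_of_rank_quadMat_le_two hA hrank)

lemma mixedDet_eq_zero_of_rank_quadMat_le_one (hrank : (P.quadMat F).rank ≤ 1) :
    mixedDet P.fundamentalMatrix F = 0 := by
  obtain ⟨φ, hφ⟩ := P.exists_frame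
  rw [← φ.rank_stdQuad_pull] at hrank
  rw [← φ.mixedDet_pull_eq_zero_iff, hφ]
  by_contra hA
  have := two_le_rank_stdQuad_of_mixedDet hA
  omega

end CameraPair

namespace Quadric

variable {S : Quadric} {P : CameraPair} {F : Matrix (Fin 3) (Fin 3) ℝ} {t : QuadricType}

lemma InCommonPlane.onCommonLine {p q : Space} (h : S.InCommonPlane p q) : S.OnCommonLine p q := by
  obtain ⟨l, -, hl, hp, hq⟩ := h
  refine Set.Subset.trans (fun x => ?_) hl
  induction p using Projectivization.ind with | h p hp0 =>
  induction q using Projectivization.ind with | h q hq0 =>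
  induction x using Projectivization.ind with | h v hv =>
  rw [mk_mem_plane] at hp hq ⊢
  rw [mk_mem_lineThrough]
  rintro ⟨a, b, rfl⟩
  rw [dotProduct_add, dotProduct_smul, dotProduct_smul, hp, hq, smul_zero, smul_zero, add_zero]

lemma det_eq_zero_of_center_mem_singularLocus (hS : S.mat = P.quadMat F)
    (hA : mixedDet P.fundamentalMatrix F = 0)
    (h : P.fst.center ∈ S.singularLocus ∨ P.snd.center ∈ S.singularLocus) : F.det = 0 := by
  rw [S.center_fst_mem_singularLocus_iff hS hA, S.center_snd_mem_singularLocus_iff hS hA] at h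
  obtain ⟨v, hv, -, hF⟩ | ⟨v, hv, -, hF⟩ := h
  · exact Matrix.exists_mulVec_eq_zero_iff.1 ⟨v, hv, hF⟩
  · exact Matrix.exists_vecMul_eq_zero_iff.1 ⟨v, hv, hF⟩

lemma IsRuled.det_pos (hruled : S.IsRuled) (hrank : S.IsSmooth) : 0 < S.mat.det := by
  obtain ⟨W, hW, hiso⟩ := hruled
  refine (det_nonneg_of_isotropic S.symm hW hiso).lt_of_ne fun hdet => ?_
  exact (rank_lt_card_iff_det_eq_zero.2 hdet.symm).ne hrank

lemma HasType.encard_rankTwoSet (ht : S.HasType P t) (hS : S.mat = P.quadMat F) :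
    (rankTwoSet F P.fundamentalMatrix).encard = t.numConjugates := by
  obtain ⟨h₁, h₂, ht⟩ := ht
  have hline := S.onCommonLine_center_iff hS
  have hsing := fun h => hline.1 (onCommonLine_center_of_singular h₁ h₂ h)
  cases t with
  | smoothNotOnLine =>
    exact CameraPair.encard_rankTwoSet_of_det_pos (mt hline.2 ht.2.2) (hS ▸ ht.2.1.det_pos ht.1)
  | smoothOnLine =>
    exact CameraPair.encard_rankTwoSet_of_mixedDet_eq_zero (hline.1 ht.2.2)
      (hS ▸ (ht.2.1.det_pos ht.1).ne')
  | coneNotOnLine =>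
    exact CameraPair.encard_rankTwoSet_of_rank_eq_three (mt hline.2 ht.2) (hS ▸ ht.1)
  | coneVertex =>
    have hvertex := ht.2.or
    have hrank : (P.quadMat F).rank = 3 := hS ▸ ht.1
    exact CameraPair.encard_rankTwoSet_eq_top (hsing hvertex) (by omega)
      (det_eq_zero_of_center_mem_singularLocus hS (hsing hvertex) hvertex)
  | planesSamePlane =>
    exact CameraPair.encard_rankTwoSet_of_rank_le_two (hline.1 ht.2.1.onCommonLine)
      (hS ▸ le_of_eq ht.1)
  | planesOneSingular =>
    exact CameraPair.encard_rankTwoSet_of_rank_le_two (hsing ht.2.or) (hS ▸ le_of_eq ht.1)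
  | planesBothSingular =>
    exact CameraPair.encard_rankTwoSet_of_rank_le_two (hsing (.inl ht.2.1)) (hS ▸ le_of_eq ht.1)
  | doublePlane =>
    have hrank : (P.quadMat F).rank = 1 := hS ▸ ht
    exact CameraPair.encard_rankTwoSet_of_rank_le_two
      (CameraPair.mixedDet_eq_zero_of_rank_quadMat_le_one hrank.le) (by omega)

end Quadric

end EncardRankTwoSet

/-! ### Counting conjugates -/

section Counting

variable {P Q R : CameraPair} {S : Quadric} {F : Matrix (Fin 3) (Fin 3) ℝ} {t : QuadricType}
  {c k x y : ℝ}

namespace Quadric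

lemma quadMat_fundamentalMatrix_eq_smul (hS : S.mat = P.quadMat F)
    (hQ : Q.fundamentalMatrix = c • (F + x • P.fundamentalMatrix)) :
    P.quadMat Q.fundamentalMatrix = c • S.mat := by
  rw [hQ, P.quadMat_smul, add_comm, P.quadMat_smul_fundamentalMatrix_add, hS]

lemma mk_mem_conjugates (hS : S.mat = P.quadMat F) (hc : c ≠ 0)
    (hQ : Q.fundamentalMatrix = c • (F + x • P.fundamentalMatrix)) :
    ⟨Q, criticalPoints Q P⟩ ∈ S.conjugates P := by
  have hquad := quadMat_fundamentalMatrix_eq_smul hS hQ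
  have hne : ¬ P.SameFundamental Q := by
    rw [P.sameFundamental_iff_quadMat_eq_zero, hquad]
    exact smul_ne_zero hc S.ne_zero
  refine ⟨hne, ?_, rfl⟩
  rw [← points_criticalQuadric hne]
  exact (points_eq_of_mat_eq_smul (S' := criticalQuadric hne) hc hquad).symm

lemma exists_mem_rankTwoSet_of_mem_conjugates (hS : S.mat = P.quadMat F) {d : Configuration}
    (hd : d ∈ S.conjugates P) : ∃ x ∈ rankTwoSet F P.fundamentalMatrix, ∃ c : ℝ, c ≠ 0 ∧
      d.cameras.fundamentalMatrix = c • (F + x • P.fundamentalMatrix) := by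
  obtain ⟨c, hc, hquad⟩ := exists_quadMat_eq_smul_of_mem_conjugates hd
  obtain ⟨a, ha⟩ := (P.quadMat_eq_zero_iff (d.cameras.fundamentalMatrix + (-c) • F)).1 (by
    rw [P.quadMat_add, P.quadMat_smul, hquad, hS, neg_smul, add_neg_cancel])
  have hF : d.cameras.fundamentalMatrix = c • (F + (c⁻¹ * a) • P.fundamentalMatrix) := by
    rw [smul_add, smul_smul, mul_inv_cancel_left₀ hc, ← ha, neg_smul]
    abel
  have hdet := d.cameras.det_fundamentalMatrix
  have hadj := d.cameras.adjugate_fundamentalMatrix_ne_zero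
  rw [hF, Matrix.det_smul] at hdet
  rw [hF, Matrix.adjugate_smul] at hadj
  exact ⟨c⁻¹ * a, ⟨(mul_eq_zero.1 hdet).resolve_left (pow_ne_zero _ hc),
    right_ne_zero_of_smul hadj⟩, c, hc, hF⟩

lemma sameFundamental_iff_eq (hS : S.mat = P.quadMat F) (hc : c ≠ 0) (hk : k ≠ 0)
    (hQ : Q.fundamentalMatrix = c • (F + x • P.fundamentalMatrix))
    (hR : R.fundamentalMatrix = k • (F + y • P.fundamentalMatrix)) :
    Q.SameFundamental R ↔ x = y := by
  constructor
  · rintro ⟨a, -, h⟩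
    have hquad := congrArg P.quadMat h
    rw [P.quadMat_smul, quadMat_fundamentalMatrix_eq_smul hS hQ,
      quadMat_fundamentalMatrix_eq_smul hS hR, smul_smul] at hquad
    have hka : k = a * c := smul_left_injective ℝ S.ne_zero hquad
    rw [hQ, hR, smul_smul, ← hka] at h
    exact smul_left_injective ℝ P.fundamentalMatrix_ne_zero
      (add_left_cancel (smul_right_injective _ hk h)).symm
  · rintro rfl
    refine ⟨k * c⁻¹, mul_ne_zero hk (inv_ne_zero hc), ?_⟩
    rw [hQ, hR, mul_smul, inv_smul_smul₀ hc]

lemma conjugateCount_eq_encard_rankTwoSet (hS : S.mat = P.quadMat F) :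
    S.conjugateCount P = (rankTwoSet F P.fundamentalMatrix).encard := by
  have : Nonempty CameraPair := ⟨P⟩
  choose! Q c hc hQ using fun x (hx : x ∈ rankTwoSet F P.fundamentalMatrix) =>
    exists_cameraPair hx.1 hx.2
  let conj : ℝ → Configuration := fun x => ⟨Q x, criticalPoints (Q x) P⟩
  have himage : Quotient.mk configurationSetoid '' S.conjugates P =
      (fun x => ⟦conj x⟧) '' rankTwoSet F P.fundamentalMatrix := by
    refine Set.Subset.antisymm ?_ ?_
    · rintro _ ⟨d, hd, rfl⟩
      obtain ⟨x, hx, k, hk, hF⟩ := exists_mem_rankTwoSet_of_mem_conjugates hS hd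
      have hequiv := ((sameFundamental_iff_eq hS (hc x hx) hk (hQ x hx) hF).2 rfl).equivalent P
      rw [← hd.2.2] at hequiv
      exact ⟨x, hx, Quotient.sound hequiv⟩
    · rintro _ ⟨x, hx, rfl⟩
      exact ⟨conj x, mk_mem_conjugates hS (hc x hx) (hQ x hx), rfl⟩
  have hinj : Set.InjOn (fun x => (⟦conj x⟧ : Quotient configurationSetoid))
      (rankTwoSet F P.fundamentalMatrix) := by
    intro x hx y hy hxy
    have hequiv : (conj x).Equivalent (conj y) := Quotient.exact hxy
    exact (sameFundamental_iff_eq hS (hc x hx) (hc y hy) (hQ x hx) (hQ y hy)).1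
      hequiv.sameFundamental
  rw [conjugateCount, himage, hinj.encard_image]

theorem HasType.conjugateCount_eq (ht : S.HasType P t) : S.conjugateCount P = t.numConjugates := by
  obtain ⟨F, hS⟩ := P.exists_eq_quadMat S ht.1 ht.2.1
  rw [conjugateCount_eq_encard_rankTwoSet hS, ht.encard_rankTwoSet hS]

lemma HasType.conjugates_nonempty (ht : S.HasType P t) : (S.conjugates P).Nonempty := by
  by_contra! h
  have hcount := ht.conjugateCount_eq
  rw [conjugateCount, h, Set.image_empty, Set.encard_empty] at hcount
  cases t <;> simp [QuadricType.numConjugates] at hcount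

end Quadric

theorem nontriviallyCritical_iff (P : CameraPair) (X : Set Space) :
    (Configuration.mk P X).NontriviallyCritical ↔
      ∃ S : Quadric, S.IsCritical P ∧
        P.fst.center ∈ S.points ∧ P.snd.center ∈ S.points ∧ X ⊆ S.points := by
  constructor
  · rintro ⟨d, hd⟩
    have hne : ¬ P.SameFundamental d.cameras := hd.2
    obtain ⟨t, ht⟩ := exists_pencilType P.fundamentalMatrix d.cameras.fundamentalMatrix
    have hS := hasType_criticalQuadric hne ht
    refine ⟨criticalQuadric hne, ⟨t, hS⟩, hS.1, hS.2.1, ?_⟩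
    rw [points_criticalQuadric]
    exact hd.subset_criticalPoints.1
  · rintro ⟨S, ⟨t, ht⟩, -, -, hX⟩
    obtain ⟨d, hne, hS, -⟩ := ht.conjugates_nonempty
    exact ⟨_, nontrivialConjugate_of_subset_criticalPoints hne (hX.trans hS.subset)⟩

end Counting

end

end TwoView

theorem mainTheorem3 (P : TwoView.CameraPair) :
    (∀ X : Set TwoView.Space,
      (TwoView.Configuration.mk P X).NontriviallyCritical ↔
        ∃ S : TwoView.Quadric, S.IsCritical P ∧
          P.fst.center ∈ S.points ∧ P.snd.center ∈ S.points ∧ X ⊆ S.points) ∧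
    (∀ (S : TwoView.Quadric) (t : TwoView.QuadricType), S.HasType P t →
      (∀ d ∈ S.conjugates P,
        (TwoView.Configuration.mk P S.points).NontrivialConjugate d ∧
          ∃ S' : TwoView.Quadric, d.points = S'.points ∧ S'.HasType d.cameras t.conjugate) ∧
      (t ≠ TwoView.QuadricType.doublePlane →
        ∀ d : TwoView.Configuration,
          (TwoView.Configuration.mk P S.points).NontrivialConjugate d →
            ∃ e ∈ S.conjugates P, e.cameras = d.cameras ∧ d.points ⊆ e.points) ∧
      S.conjugateCount P = t.numConjugates) := by
  refine ⟨TwoView.nontriviallyCritical_iff P,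
    fun S t hS => ⟨fun d hd => ⟨?_, ?_⟩, fun ht d hd => ?_, ?_⟩⟩
  · exact TwoView.Quadric.nontrivialConjugate_of_mem_conjugates hd
  · exact TwoView.Quadric.exists_hasType_conjugate hS hd
  · exact TwoView.Quadric.exists_mem_conjugates_of_nontrivialConjugate (hS.two_le_rank ht) hd
  · exact hS.conjugateCount_eq
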